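/- **Setting.** For $\alpha>-1$ and $k\in\mathbb N=\{0,1,\dots\}$ let $L_k^{\alpha}(u)=\sum_{i=0}^k\frac{(-1)^i\,\Gamma(k+\alpha+1)}{\Gamma(i+\alpha+1)\,(k-i)!\,i!}u^i$ be the Laguerre polynomials, and let $$\varphi_k^{\alpha}(x)=\Big(\frac{2\Gamma(k+1)}{\Gamma(k+\alpha+1)}\Big)^{1/2}L_k^{\alpha}(x^2)\,x^{\alpha+1/2}e^{-x^2/2},\qquad x>0 .$$ For $n\ge1$, $\nu\in[-1/2,\infty)^n$, $k\in\mathbb N^n$ and $x\in\mathbb R^n_+=(0,\infty)^n$ put $\varphi_k^\nu(x)=\prod_j\varphi_{k_j}^{\nu_j}(x_j)$, $|k|=\sum_jk_j$, $|\nu|=\sum_j\nu_j$. The Laguerre operator is $\mathcal L_\nu f=\sum_k(4|k|+2|\nu|+2n)\langle f,\varphi_k^\nu\rangle\varphi_k^\nu$, and its heat kernel (the kernel of $e^{-t\mathcal L_\nu}$) is $$p_t^\nu(x,y)=\sum_{k\in\mathbb N^n}e^{-t(4|k|+2|\nu|+2n)}\varphi_k^\nu(x)\varphi_k^\nu(y),\qquad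 t>0,\ x,y\in\mathbb R^n_+ .$$ All derivatives are taken in $x$: $\delta_{\nu_j}=\partial_{x_j}+x_j-\frac{1}{x_j}(\nu_j+\frac12)$, and for multi-indices $\delta_\nu^\ell=\delta_{\nu_n}^{\ell_n}\cdots\delta_{\nu_1}^{\ell_1}$, $\partial^k=\partial_{x_n}^{k_n}\cdots\partial_{x_1}^{k_1}$. Let $\mathcal J_\nu=\{j:\nu_j>-1/2\}$, $\nu_{\min}=\min\{\nu_j:j\in\mathcal J_\nu\}$ and $$\rho_\nu(x)=\tfrac1{16}\min\{|x|^{-1},1,x_j:j\in\mathcal J_\nu\}$$ in dimension $n$. In the one-dimensional statements, $\rho_\nu(x)=\frac1{16}\min\{x,x^{-1}\}$ if $\nu>-1/2$ and $\rho_\nu(x)=\frac1{16}\min\{1,x^{-1}\}$ if $\nu=-1/2$. Write $\Theta_\nu=1+\frac{\sqrt t}{\rho_\nu(x)}+\frac{\sqrt t}{\rho_\nu(y)}$. If $\mathcal J_\nu=\emptyset$ then $\nu_{\min}=\infty$, and a bound containing $\Theta_\nu^{-(\nu_{\min}+1/2)}$ means that it holds with $\Theta_\nu^{-N}$ for every $N>0$.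 The notation $A\lesssim B\exp(-|x-y|^2/(ct))$ means that there are $C,c>0$, depending only on the dimension, $\nu$, the orders of differentiation, the power of $x$ and $N$ where these occur, with $A\le C B\exp(-|x-y|^2/(ct))$ for all stated $t,x,y$. **Claim.** For every $\nu\in[-1/2,\infty)^n$, $n\ge1$, the series for $p_t^\nu(x,y)$ converges absolutely and $x\mapsto p^\nu_t(x,y)$ is $C^\infty$ on $\mathbb R^n_+$ for all $t>0$, $y\in\mathbb R^n_+$. Moreover: (A) *Dimension one.* Let $\nu>-1/2$ and $x,y>0$. 1. For $t>0$: $|p_t^\nu(x,y)|\lesssim \frac{e^{-t/2}}{\sqrt t}\exp(-\frac{|x-y|^2}{ct})\,\Theta_\nu^{-(\nu+1/2)}$. 2. For $k,m\in\mathbb N$, $0<t<1$, and ($xy<t$, or $xy\ge t$ and $y<x/2$, or $xy\ge t$ and $y>2x$): $\big|(\frac{x}{\sqrt t})^k\delta_\nu^mp_t^\nu(x,y)\big|\lesssim t^{-(m+1)/2}\exp(-\frac{|x-y|^2}{ct})\,\Theta_\nu^{-(\nu+1/2)}$. 3. For $k,m\in\mathbb N$ and $t\ge1$: $|x^k\delta_\nu^mp_t^\nu(x,y)|\lesssim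 e^{-t/2^{m+2}}t^{-(m+1)/2}\exp(-\frac{|x-y|^2}{ct})\,\Theta_\nu^{-(\nu+1/2)}$. 4. For $m\ge1$, $0<t<1$, $xy\ge t$ and $x/2\le y\le2x$: $|\delta_\nu^mp_t^\nu(x,y)|+\frac xt\big|\delta_\nu^{m-1}[p_t^\nu(x,y)-p_t^{\nu+1}(x,y)]\big|\lesssim t^{-(m+1)/2}\exp(-\frac{|x-y|^2}{ct})\,\Theta_\nu^{-(\nu+1/2)}$. 5. For $k\in\mathbb N$ and $t>0$: $|\delta_\nu^kp_t^\nu(x,y)|\lesssim t^{-(k+1)/2}\exp(-\frac{|x-y|^2}{ct})\,\Theta_\nu^{-(\nu+1/2)}$. 6. For $k,j\in\mathbb N$ and $t>0$: $|\partial^k\delta_\nu^jp_t^\nu(x,y)|\lesssim\big[\rho_\nu(x)^{-k}+t^{-k/2}\big]t^{-(j+1)/2}\exp(-\frac{|x-y|^2}{ct})\,\Theta_\nu^{-(\nu+1/2)}$. 7. If instead $\nu=-1/2$, then for $k,j\in\mathbb N$, $N>0$ and $t>0$: $|\partial^k\delta_\nu^jp_t^\nu(x,y)|\lesssim t^{-(j+k+1)/2}\exp(-\frac{|x-y|^2}{ct})\,\Theta_\nu^{-N}$.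 (B) *Dimension $n\ge1$.* Let $\nu\in[-1/2,\infty)^n$. For every $\ell\in\mathbb N^n$, all $t>0$ and $x,y\in\mathbb R^n_+$, $$|\delta_\nu^\ell p_t^\nu(x,y)|\lesssim t^{-(n+|\ell|)/2}\exp\Big(-\frac{|x-y|^2}{ct}\Big)\Theta_\nu^{-(\nu_{\min}+1/2)},$$ and for all $k,j\in\mathbb N^n$, $$|\partial^k\delta_\nu^jp_t^\nu(x,y)|\lesssim\Big[\frac1{\rho_\nu(x)^{|k|}}+\frac1{t^{|k|/2}}\Big]\frac1{t^{(n+|j|)/2}}\exp\Big(-\frac{|x-y|^2}{ct}\Big)\Theta_\nu^{-(\nu_{\min}+1/2)}.$$ -/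

import Mathlib

open Real Set
open scoped ContDiff

noncomputable section

namespace Laguerre

/-- The Laguerre polynomial `L_k^α` of degree `k` and order `α` (used for `α > -1`),
`L_k^α(u) = ∑_{i ≤ k} (-1)^i Γ(k+α+1) / (Γ(i+α+1) (k-i)! i!) u^i`. -/
def laguerrePoly (k : ℕ) (α u : ℝ) : ℝ :=
  ∑ i ∈ Finset.range (k + 1),
    (-1) ^ i * (Gamma (k + α + 1) / (Gamma (i + α + 1) * (k - i).factorial * i.factorial)) * u ^ i

/-- The one-dimensional Laguerre function `φ_k^ν` on `(0, ∞)`; `Γ(k+1) = k!`. -/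
def laguerreFun (ν : ℝ) (k : ℕ) (x : ℝ) : ℝ :=
  √(2 * Gamma (k + 1) / Gamma (k + ν + 1)) * laguerrePoly k ν (x ^ 2) *
    x ^ (ν + 1 / 2) * exp (-x ^ 2 / 2)

/-! ### Dimension one -/

/-- The general term of the spectral expansion of the kernel of `e^{-t𝓛_ν}` in dimension one;
`𝓛_ν φ_k^ν = (4k + 2ν + 2) φ_k^ν`. -/
def heatTerm₁ (ν t x y : ℝ) (k : ℕ) : ℝ :=
  exp (-t * (4 * k + 2 * ν + 2)) * laguerreFun ν k x * laguerreFun ν k y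

/-- The one-dimensional Laguerre heat kernel `p_t^ν(x, y)`, the kernel of `e^{-t𝓛_ν}`, where
`𝓛_ν f = ∑_k (4k + 2ν + 2) ⟨f, φ_k^ν⟩ φ_k^ν`. -/
def heatKernel₁ (ν t x y : ℝ) : ℝ := ∑' k : ℕ, heatTerm₁ ν t x y k

/-- `δ_ν = d/dx + x - (ν + 1/2)/x`. -/
def delta₁ (ν : ℝ) (f : ℝ → ℝ) : ℝ → ℝ :=
  fun x => deriv f x + (x - (ν + 1 / 2) / x) * f x

/-- The one-dimensional critical function. -/
def rho₁ (ν x : ℝ) : ℝ :=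
  if ν = -1 / 2 then 1 / 16 * min 1 x⁻¹ else 1 / 16 * min x x⁻¹

/-- `1 + √t / ρ_ν(x) + √t / ρ_ν(y)` in dimension one. -/
def decay₁ (ν t x y : ℝ) : ℝ := 1 + √t / rho₁ ν x + √t / rho₁ ν y

/-! ### Dimension `n` -/

variable {n : ℕ}

/-- The open orthant `(0, ∞)^n`. -/
def orthant (n : ℕ) : Set (EuclideanSpace ℝ (Fin n)) := {x | ∀ j, 0 < x j}

/-- The Laguerre function `φ_k^ν(x) = ∏_j φ_{k_j}^{ν_j}(x_j)`. -/
def laguerreFunN (ν : Fin n → ℝ) (k : Fin n → ℕ) (x : EuclideanSpace ℝ (Fin n)) : ℝ :=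
  ∏ j, laguerreFun (ν j) (k j) (x j)

/-- The general term of the spectral expansion of the kernel of `e^{-t𝓛_ν}`;
`𝓛_ν φ_k^ν = (4|k| + 2|ν| + 2n) φ_k^ν`. -/
def heatTerm (ν : Fin n → ℝ) (t : ℝ) (x y : EuclideanSpace ℝ (Fin n)) (k : Fin n → ℕ) : ℝ :=
  exp (-t * (4 * (∑ j, (k j : ℝ)) + 2 * (∑ j, ν j) + 2 * n)) *
    laguerreFunN ν k x * laguerreFunN ν k y

/-- The Laguerre heat kernel `p_t^ν(x, y)`, the kernel of `e^{-t𝓛_ν}`, where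
`𝓛_ν f = ∑_{k ∈ ℕ^n} (4|k| + 2|ν| + 2n) ⟨f, φ_k^ν⟩ φ_k^ν`. -/
def heatKernel (ν : Fin n → ℝ) (t : ℝ) (x y : EuclideanSpace ℝ (Fin n)) : ℝ :=
  ∑' k : Fin n → ℕ, heatTerm ν t x y k

/-- The partial derivative `∂/∂x_j`. -/
def partialD (j : Fin n) (f : EuclideanSpace ℝ (Fin n) → ℝ) : EuclideanSpace ℝ (Fin n) → ℝ :=
  fun x => lineDeriv ℝ f x (EuclideanSpace.single j 1)

/-- `δ_{ν_j} = ∂/∂x_j + x_j - (ν_j + 1/2)/x_j`. -/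
def delta (ν : Fin n → ℝ) (j : Fin n) (f : EuclideanSpace ℝ (Fin n) → ℝ) :
    EuclideanSpace ℝ (Fin n) → ℝ :=
  fun x => partialD j f x + (x j - (ν j + 1 / 2) / x j) * f x

/-- For operators `D_1, …, D_n` and a multi-index `k`, the operator `D_n^{k_n} ⋯ D_1^{k_1}`. -/
def multiPow (D : Fin n → (EuclideanSpace ℝ (Fin n) → ℝ) → (EuclideanSpace ℝ (Fin n) → ℝ))
    (k : Fin n → ℕ) (f : EuclideanSpace ℝ (Fin n) → ℝ) : EuclideanSpace ℝ (Fin n) → ℝ :=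
  (List.finRange n).foldl (fun g j => (D j)^[k j] g) f

/-- `𝒥_ν = {j : ν_j > -1/2}`. -/
def J (ν : Fin n → ℝ) : Finset (Fin n) := Finset.univ.filter fun j => -1 / 2 < ν j

/-- The critical function `ρ_ν(x) = (1/16) min {1/|x|, 1, x_j : j ∈ 𝒥_ν}`. -/
def rho (ν : Fin n → ℝ) (x : EuclideanSpace ℝ (Fin n)) : ℝ :=
  1 / 16 * (insert ‖x‖⁻¹ (insert 1 ((J ν).image fun j => x j))).min' (Finset.insert_nonempty _ _)

/-- `1 + √t / ρ_ν(x) + √t / ρ_ν(y)`. -/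
def decay (ν : Fin n → ℝ) (t : ℝ) (x y : EuclideanSpace ℝ (Fin n)) : ℝ :=
  1 + √t / rho ν x + √t / rho ν y

/-- `P` holds at the exponent `ν_min + 1/2`, where `ν_min = min {ν_j : j ∈ 𝒥_ν}`; by convention
`ν_min = ∞` if `𝒥_ν` is empty, and then `P` has to hold at every positive exponent. -/
def ForDecayExponent (ν : Fin n → ℝ) (P : ℝ → Prop) : Prop :=
  (∀ h : (J ν).Nonempty, P ((J ν).inf' h ν + 1 / 2)) ∧ (J ν = ∅ → ∀ N : ℝ, 0 < N → P N)

end Laguerre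

end

/-!
The proof rests on writing the one-dimensional kernel as a superposition of Gaussians. The
Hille–Hardy formula (`hasSum_hilleHardy`) sums the spectral series to a Bessel series, and Poisson's
integral (`integral_exp_besselMeasure`) turns the latter into exponential moments of a finite
measure `besselMeasure ν` on `[-1, 1]`, a multiple of `(1 - s²)^{ν - 1/2} ds` that degenerates to two point
masses if `ν = -1/2`. With `S = sinh 2t` this gives (`heatKernel₁_eq`)
`p_t^ν(x, y) = 2 (2S)^{-ν-1} (xy)^{ν+1/2} ∫ e^{-phase t x y s} dμ_ν(s)`, where
`phase t x y s = ½ (x² + y²) coth 2t - xys / S`. The kernel of order `ν + 1` is the same integral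
with the additional factor `s` (`heatKernel₁_add_one_eq`).

As `δ_ν` is `d/dx` conjugated by `x^{ν+1/2} e^{-x²/2}`, the function `δ_ν^m p_t^ν` has the same
representation with a Hermite polynomial of degree `m` in the integrand
(`iterate_delta₁_heatKernel₁`). The square of the argument of that polynomial is at most a constant
times `phase / t`, for all `t`, `x`, `y`, `s` (`sq_hermiteArg_le`), so that each `δ_ν` costs
`t^{-1/2}` and a fraction of the exponent, whether or not the points are close to the diagonal.
Finally
`phase = ½ ((x - y)² / S + (x² + y²) tanh t) + (xy / S) (1 - s)`; the last term makes the integral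
small for large `xy / S` (`exists_integral_exp_besselMeasure_le`), while the first two, called
`energy`, yield the Gaussian factor, the factor `Θ_ν^{-γ}`, and room for powers of `x`. All
one-dimensional claims follow from the resulting bound `exists_abs_weightedKernel_le_majorant`; in
the difference of the kernels of orders `ν` and `ν + 1` the factor `1 - s` gains `S / (xy)`.
Ordinary derivatives are expressed through `δ_ν` (`exists_abs_iterate_deriv_le`).

In dimension `n` the kernel is the product of one-dimensional kernels, the operators act on one
factor each (`multiPow_eqOn_prodFun`), and `Θ_ν` is at most `n` times the product of the
one-dimensional quantities (`decay_le_prod`).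
-/

noncomputable section

namespace Laguerre

/-! ### The generating function of the Laguerre polynomials -/

theorem hasSum_of_eq {ι : Type*} {f g : ι → ℝ} {a b : ℝ} (h : HasSum f a) (hfg : ∀ n, f n = g n)
    (hab : a = b) : HasSum g b := by
  rwa [← funext hfg, ← hab]

theorem hasSum_pow_div_factorial (x : ℝ) : HasSum (fun n : ℕ => x ^ n / n.factorial) (exp x) := by
  rw [Real.exp_eq_exp_ℝ]
  exact NormedSpace.expSeries_div_hasSum_exp x

theorem multichoose_eq_Gamma {β : ℝ} (hβ : 0 < β) (n : ℕ) :
    Ring.multichoose β n = Gamma (β + n) / (Gamma β * n.factorial) := by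
  have hΓ : (0 : ℝ) < Gamma β := Gamma_pos_of_pos hβ
  have h : ∀ n : ℕ, (ascPochhammer ℝ n).eval β = Gamma (β + n) / Gamma β := by
    intro n
    induction n with
    | zero => simp [hΓ.ne']
    | succ n ih =>
      rw [ascPochhammer_succ_eval, ih]
      have : β + (n + 1 : ℕ) = (β + n) + 1 := by push_cast; ring
      rw [this, Gamma_add_one (by positivity)]
      ring
  have h2 := Ring.factorial_nsmul_multichoose_eq_ascPochhammer β n
  rw [Polynomial.ascPochhammer_smeval_eq_eval, h, nsmul_eq_mul] at h2
  have hn : (n.factorial : ℝ) ≠ 0 := by positivity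
  field_simp
  field_simp at h2
  linarith

/-- The binomial series with a negative exponent, written with Gamma functions. -/
theorem hasSum_Gamma_mul_pow {β r : ℝ} (hβ : 0 < β) (hr : |r| < 1) :
    HasSum (fun l : ℕ => Gamma (β + l) / l.factorial * r ^ l) (Gamma β * (1 - r) ^ (-β)) := by
  have h := (one_div_one_sub_rpow_hasFPowerSeriesOnBall_zero β).hasSum (y := r)
    (by simpa [enorm_eq_nnnorm, ← NNReal.coe_lt_one] using! hr)
  simp only [FormalMultilinearSeries.ofScalars_apply_eq, zero_add, smul_eq_mul] at h
  have h1 : 0 ≤ 1 - r := by linarith [le_abs_self r]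
  rw [one_div, ← rpow_neg h1] at h
  refine hasSum_of_eq (h.mul_left (Gamma β)) (fun l => ?_) rfl
  have : Ring.choose (β + l - 1) l = Ring.multichoose β l := by
    rw [Ring.choose]; congr 1; ring
  rw [this, multichoose_eq_Gamma hβ]
  have : Gamma β ≠ 0 := (Gamma_pos_of_pos hβ).ne'
  field_simp

/-- A family on `ℕ × ℕ` whose row sums of absolute values are summable is summable. -/
theorem summable_prod_of_rows {f : ℕ × ℕ → ℝ} {g : ℕ → ℝ}
    (hf : ∀ i, HasSum (fun j => |f (i, j)|) (g i)) (hg : Summable g) : Summable f := by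
  refine Summable.of_norm ?_
  rw [summable_prod_of_nonneg (fun _ => norm_nonneg _)]
  refine ⟨fun i => (hf i).summable, ?_⟩
  convert hg with i
  exact (hf i).tsum_eq

/-- The general term of the expansion of `∑ k, r ^ k L_k^α(u)` in the powers of `u`. -/
def genTerm (α u r : ℝ) (p : ℕ × ℕ) : ℝ :=
  (-u) ^ p.1 / (Gamma (p.1 + α + 1) * p.1.factorial) *
    (Gamma (p.1 + p.2 + α + 1) / p.2.factorial) * r ^ (p.1 + p.2)

theorem hasSum_genTerm_row {α r : ℝ} (u : ℝ) (hα : -1 < α) (hr : |r| < 1) (i : ℕ) :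
    HasSum (fun l => genTerm α u r (i, l))
      ((1 - r) ^ (-(α + 1)) * ((-(u * r / (1 - r))) ^ i / i.factorial)) := by
  have hβ : (0 : ℝ) < i + α + 1 := by have : (0 : ℝ) ≤ i := i.cast_nonneg; linarith
  have h1 : 0 < 1 - r := by linarith [le_abs_self r]
  have h := (hasSum_Gamma_mul_pow hβ hr).mul_left
    ((-u) ^ i / (Gamma (i + α + 1) * i.factorial) * r ^ i)
  refine hasSum_of_eq h (fun l => ?_) ?_
  · simp only [genTerm]
    rw [pow_add, show (i : ℝ) + l + α + 1 = i + α + 1 + l by ring]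
    ring
  · have : Gamma (i + α + 1) ≠ 0 := (Gamma_pos_of_pos hβ).ne'
    rw [show -((i : ℝ) + α + 1) = -(α + 1) - i by ring, rpow_sub_natCast h1.ne']
    rw [show -(u * r / (1 - r)) = (-u) * r / (1 - r) by ring, div_pow, mul_pow]
    field_simp

theorem abs_genTerm {α : ℝ} (hα : -1 < α) (u r : ℝ) (p : ℕ × ℕ) :
    |genTerm α u r p| = genTerm α (-|u|) |r| p := by
  have h1 : (0 : ℝ) < p.1 + α + 1 := by have : (0 : ℝ) ≤ p.1 := p.1.cast_nonneg; linarith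
  have h2 : (0 : ℝ) < p.1 + p.2 + α + 1 := by have : (0 : ℝ) ≤ p.2 := p.2.cast_nonneg; linarith
  have h3 := Gamma_pos_of_pos h1
  have h4 := Gamma_pos_of_pos h2
  simp only [genTerm, abs_mul, abs_div, abs_pow, abs_neg, neg_neg, abs_of_pos h3, abs_of_pos h4,
    Nat.abs_cast]

theorem sum_genTerm_antidiagonal (α u r : ℝ) (k : ℕ) :
    ∑ p ∈ Finset.HasAntidiagonal.antidiagonal k, genTerm α u r p = r ^ k * laguerrePoly k α u := by
  rw [Finset.Nat.sum_antidiagonal_eq_sum_range_succ_mk, laguerrePoly, Finset.mul_sum]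
  refine Finset.sum_congr rfl fun i hi => ?_
  have hik : i ≤ k := by simpa [Nat.lt_succ_iff] using hi
  simp only [genTerm]
  rw [Nat.add_sub_cancel' hik, Nat.cast_sub hik, neg_pow]
  rw [show (i : ℝ) + (k - i) + α + 1 = k + α + 1 by ring]
  field_simp

theorem abs_laguerrePoly_le {α : ℝ} (hα : -1 < α) (u : ℝ) (k : ℕ) :
    |laguerrePoly k α u| ≤ laguerrePoly k α (-|u|) := by
  have h1 := sum_genTerm_antidiagonal α u 1 k
  have h2 := sum_genTerm_antidiagonal α (-|u|) 1 k
  rw [one_pow, one_mul] at h1 h2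
  rw [← h1, ← h2]
  refine (Finset.abs_sum_le_sum_abs _ _).trans_eq (Finset.sum_congr rfl fun p _ => ?_)
  rw [abs_genTerm hα, abs_one]

/-- The generating function `∑ k, r ^ k L_k^α(u) = (1 - r)^{-α-1} e^{-ur/(1-r)}`. -/
theorem hasSum_pow_mul_laguerrePoly {α r : ℝ} (u : ℝ) (hα : -1 < α) (hr : |r| < 1) :
    HasSum (fun k => r ^ k * laguerrePoly k α u)
      ((1 - r) ^ (-(α + 1)) * exp (-(u * r / (1 - r)))) := by
  have hr' : |(|r|)| < 1 := by rwa [abs_abs]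
  have hs : Summable (genTerm α u r) := by
    refine summable_prod_of_rows (fun i => ?_)
      ((hasSum_pow_div_factorial (-((-|u|) * |r| / (1 - |r|)))).mul_left
        ((1 - |r|) ^ (-(α + 1)))).summable
    simp only [abs_genTerm hα]
    exact hasSum_genTerm_row _ hα hr' i
  have h1 : HasSum (genTerm α u r) ((1 - r) ^ (-(α + 1)) * exp (-(u * r / (1 - r)))) := by
    have := hs.hasSum.prod_fiberwise (hasSum_genTerm_row u hα hr)
    rw [← this.unique ((hasSum_pow_div_factorial (-(u * r / (1 - r)))).mul_left _)]
    exact hs.hasSum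
  have h2 := (Finset.HasAntidiagonal.sigmaAntidiagonalEquivProd (A := ℕ)).hasSum_iff.2 h1
  refine h2.sigma fun k => ?_
  rw [← sum_genTerm_antidiagonal]
  have := hasSum_fintype (fun p : Finset.HasAntidiagonal.antidiagonal k => genTerm α u r p)
  rw [Finset.univ_eq_attach, Finset.sum_attach _ (genTerm α u r)] at this
  exact this

theorem summable_pow_mul_abs_laguerrePoly {α r : ℝ} (u : ℝ) (hα : -1 < α) (hr0 : 0 ≤ r)
    (hr : r < 1) : Summable fun k => r ^ k * |laguerrePoly k α u| :=
  Summable.of_nonneg_of_le (fun k => by positivity)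
    (fun k => mul_le_mul_of_nonneg_left (abs_laguerrePoly_le hα u k) (by positivity))
    (hasSum_pow_mul_laguerrePoly (-|u|) hα (by rwa [abs_of_nonneg hr0])).summable

/-! ### The Hille–Hardy formula -/

theorem hasSum_choose_mul_pow (k : ℕ) (r h : ℝ) :
    HasSum (fun j => (k.choose j : ℝ) * r ^ (k - j) * h ^ j) ((r + h) ^ k) := by
  rw [add_comm r h, add_pow]
  refine hasSum_of_eq (hasSum_sum_of_ne_finset_zero (s := Finset.range (k + 1)) (fun j hj => ?_))
    (fun j => rfl) (Finset.sum_congr rfl fun j _ => by ring)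
  rw [Nat.choose_eq_zero_of_lt (by simpa [Nat.lt_succ_iff] using hj)]
  simp

/-- Taylor expansion of the generating function at `r`. -/
theorem hasSum_choose_mul_laguerrePoly {α r : ℝ} (u : ℝ) (hα : -1 < α) (hr0 : 0 ≤ r)
    (hr : r < 1) (j : ℕ) :
    HasSum (fun k => (k.choose j : ℝ) * r ^ (k - j) * laguerrePoly k α u)
      ((1 - r) ^ (-(α + 1)) * exp (-(u * r / (1 - r))) *
        ((1 - r)⁻¹ ^ j * laguerrePoly j α (u / (1 - r)))) := by
  have h1r : 0 < 1 - r := by linarith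
  -- the double family whose two iterated sums are the two expansions of `g (r + h)`
  have hsum : ∀ h : ℝ, |h| < 1 - r → Summable fun p : ℕ × ℕ =>
      (p.1.choose p.2 : ℝ) * r ^ (p.1 - p.2) * h ^ p.2 * laguerrePoly p.1 α u := by
    intro h hh
    refine summable_prod_of_rows (fun k => ?_) (summable_pow_mul_abs_laguerrePoly (r := r + |h|) u
      hα (by positivity) (by linarith))
    refine hasSum_of_eq ((hasSum_choose_mul_pow k r |h|).mul_right _) (fun j => ?_) rfl
    simp [abs_mul, abs_pow, abs_of_nonneg hr0]
  have hcol : ∀ j, Summable fun k : ℕ =>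
      (k.choose j : ℝ) * r ^ (k - j) * laguerrePoly k α u := by
    intro j
    have hh : 0 < (1 - r) / 2 := by linarith
    have := (hsum ((1 - r) / 2) (by rw [abs_of_pos hh]; linarith)).prod_symm.prod_factor j
    refine (this.mul_left ((((1 - r) / 2) ^ j)⁻¹)).congr fun k => ?_
    simp only [Prod.swap_prod_mk]
    field_simp
  set c : ℕ → ℝ := fun j => ∑' k : ℕ, (k.choose j : ℝ) * r ^ (k - j) * laguerrePoly k α u with hc
  set d : ℕ → ℝ := fun j => (1 - r) ^ (-(α + 1)) * exp (-(u * r / (1 - r))) *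
        ((1 - r)⁻¹ ^ j * laguerrePoly j α (u / (1 - r))) with hd
  have key : c = d := by
    have e1 : HasFPowerSeriesAt (fun s => (1 - s) ^ (-(α + 1)) * exp (-(u * s / (1 - s))))
        (FormalMultilinearSeries.ofScalars ℝ c) r := by
      rw [hasFPowerSeriesAt_iff]
      filter_upwards [Metric.ball_mem_nhds (0 : ℝ) h1r] with h hh
      have hh : |h| < 1 - r := by simpa using hh
      simp only [FormalMultilinearSeries.coeff_ofScalars, smul_eq_mul]
      have hs := hsum h hh
      have hrh : |r + h| < 1 := (abs_add_le _ _).trans_lt (by rw [abs_of_nonneg hr0]; linarith)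
      have a1 := hs.hasSum.prod_fiberwise
        (fun k => (hasSum_choose_mul_pow k r h).mul_right (laguerrePoly k α u))
      rw [← a1.unique (hasSum_pow_mul_laguerrePoly u hα hrh)]
      refine (((Equiv.prodComm ℕ ℕ).hasSum_iff).2 hs.hasSum).prod_fiberwise fun j => ?_
      refine hasSum_of_eq ((hcol j).hasSum.mul_left (h ^ j)) (fun k => ?_) rfl
      simp only [Function.comp_apply, Equiv.prodComm_apply, Prod.swap_prod_mk]
      ring
    have e2 : HasFPowerSeriesAt (fun s => (1 - s) ^ (-(α + 1)) * exp (-(u * s / (1 - s))))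
        (FormalMultilinearSeries.ofScalars ℝ d) r := by
      rw [hasFPowerSeriesAt_iff]
      filter_upwards [Metric.ball_mem_nhds (0 : ℝ) h1r] with h hh
      have hh : |h| < 1 - r := by simpa using hh
      simp only [FormalMultilinearSeries.coeff_ofScalars, smul_eq_mul]
      have hη : |h / (1 - r)| < 1 := by rwa [abs_div, abs_of_pos h1r, div_lt_one h1r]
      have h1 : 0 < 1 - h / (1 - r) := by linarith [le_abs_self (h / (1 - r))]
      have h2 : 0 < 1 - (r + h) := by linarith [le_abs_self h]
      have h3 : 1 - (r + h) = (1 - r) * (1 - h / (1 - r)) := by field_simp; ring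
      refine hasSum_of_eq ((hasSum_pow_mul_laguerrePoly (u / (1 - r)) hα hη).mul_left
        ((1 - r) ^ (-(α + 1)) * exp (-(u * r / (1 - r))))) (fun j => ?_) ?_
      · simp only [hd, div_pow, inv_pow]
        field_simp
      · rw [h3, mul_rpow h1r.le h1.le, mul_mul_mul_comm, ← exp_add]
        congr 2
        have h4 : 1 - r - h ≠ 0 := by linarith
        have h5 : (1 - r) * (1 - h / (1 - r)) = 1 - r - h := by rw [← h3]; ring
        rw [h5, show 1 - h / (1 - r) = (1 - r - h) / (1 - r) by field_simp]
        field_simp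
        ring
    exact (FormalMultilinearSeries.ofScalars_series_eq_iff ℝ c d).1
      (e1.eq_formalMultilinearSeries e2)
  have := (hcol j).hasSum
  rwa [show (∑' k : ℕ, (k.choose j : ℝ) * r ^ (k - j) * laguerrePoly k α u) = d j from
    congrFun key j] at this

theorem Gamma_nat_add_pos {α : ℝ} (hα : -1 < α) (j : ℕ) : 0 < Gamma (j + α + 1) :=
  Gamma_pos_of_pos (by have : (0 : ℝ) ≤ j := j.cast_nonneg; linarith)

theorem summable_pow_div_Gamma {α x : ℝ} (hα : -1 < α) (hx : 0 ≤ x) :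
    Summable fun j : ℕ => x ^ j / Gamma (j + α + 1) := by
  rw [← summable_nat_add_iff 1]
  have hG : ∀ j : ℕ, j.factorial * Gamma (α + 2) ≤ Gamma ((j + 1 : ℕ) + α + 1) := by
    intro j
    induction j with
    | zero => simp [show (1 : ℝ) + α + 1 = α + 2 by ring]
    | succ j ih =>
      have hj : (0 : ℝ) ≤ j := j.cast_nonneg
      rw [show ((j + 1 + 1 : ℕ) : ℝ) + α + 1 = ((j + 1 : ℕ) + α + 1) + 1 by push_cast; ring,
        Gamma_add_one (by push_cast; linarith), Nat.factorial_succ, Nat.cast_mul, mul_assoc]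
      refine mul_le_mul (by push_cast; linarith) ih ?_ (by push_cast; linarith)
      exact mul_nonneg (by positivity) (Gamma_pos_of_pos (by linarith)).le
  have hΓ : 0 < Gamma (α + 2) := Gamma_pos_of_pos (by linarith)
  refine Summable.of_nonneg_of_le (fun j => ?_) (fun j => ?_)
    ((hasSum_pow_div_factorial x).mul_left (x / Gamma (α + 2))).summable
  · exact div_nonneg (by positivity) (Gamma_nat_add_pos hα _).le
  · calc x ^ (j + 1) / Gamma ((j + 1 : ℕ) + α + 1) ≤ x ^ (j + 1) / (j.factorial * Gamma (α + 2)) :=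
          div_le_div_of_nonneg_left (by positivity) (by positivity) (hG j)
      _ = _ := by field_simp; ring

/-- The series `∑ m, z ^ m / (m! Γ(m + α + 1))`, which is `z^{-α/2} I_α(2√z)` for the modified
Bessel function `I_α`; this normalization has no singularity at `z = 0`. -/
def besselSeries (α z : ℝ) : ℝ := ∑' m : ℕ, z ^ m / (m.factorial * Gamma (m + α + 1))

theorem summable_abs_besselSeries {α : ℝ} (hα : -1 < α) (z : ℝ) :
    Summable fun m : ℕ => ‖z ^ m / (m.factorial * Gamma (m + α + 1))‖ := by
  refine Summable.of_nonneg_of_le (fun m => norm_nonneg _) (fun m => ?_)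
    (summable_pow_div_Gamma hα (abs_nonneg z))
  have hΓ := Gamma_nat_add_pos hα m
  rw [norm_eq_abs, abs_div, abs_mul, abs_pow, abs_of_pos hΓ, Nat.abs_cast]
  refine div_le_div_of_nonneg_left (by positivity) hΓ ?_
  exact le_mul_of_one_le_left hΓ.le (by exact_mod_cast m.factorial_pos)

/-- The second generating function, `∑ j, w ^ j L_j^α(X) / Γ(j + α + 1)`. -/
theorem tsum_pow_div_Gamma_mul_laguerrePoly {α : ℝ} (hα : -1 < α) (w X : ℝ) :
    ∑' j : ℕ, w ^ j / Gamma (j + α + 1) * laguerrePoly j α X =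
      exp w * besselSeries α (-(X * w)) := by
  have h := tsum_mul_tsum_eq_tsum_sum_antidiagonal_of_summable_norm
    (summable_abs_besselSeries hα (-(X * w))) (hasSum_pow_div_factorial w).summable.norm
  rw [(hasSum_pow_div_factorial w).tsum_eq] at h
  rw [besselSeries, mul_comm, h]
  refine tsum_congr fun j => ?_
  rw [Finset.Nat.sum_antidiagonal_eq_sum_range_succ_mk, laguerrePoly, Finset.mul_sum]
  refine Finset.sum_congr rfl fun i hi => ?_
  have hij : i ≤ j := by simpa [Nat.lt_succ_iff] using hi
  have h1 := (Gamma_nat_add_pos hα i).ne'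
  have h2 := (Gamma_nat_add_pos hα j).ne'
  dsimp only
  rw [neg_pow (X * w), mul_pow]
  nth_rewrite 1 [← Nat.add_sub_cancel' hij]
  rw [pow_add]
  field_simp

theorem hasSum_choose_div_Gamma {α : ℝ} (hα : -1 < α) (k : ℕ) (v : ℝ) :
    HasSum (fun j : ℕ => (k.choose j : ℝ) * ((-v) ^ j / Gamma (j + α + 1)))
      (k.factorial / Gamma (k + α + 1) * laguerrePoly k α v) := by
  refine hasSum_of_eq (hasSum_sum_of_ne_finset_zero (s := Finset.range (k + 1)) (fun j hj => ?_))
    (fun j => rfl) ?_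
  · rw [Nat.choose_eq_zero_of_lt (by simpa [Nat.lt_succ_iff] using hj)]
    simp
  · rw [laguerrePoly, Finset.mul_sum]
    refine Finset.sum_congr rfl fun j hj => ?_
    have hjk : j ≤ k := by simpa [Nat.lt_succ_iff] using hj
    have h1 := (Gamma_nat_add_pos hα j).ne'
    have h2 := (Gamma_nat_add_pos hα k).ne'
    rw [Nat.cast_choose ℝ hjk, neg_pow v]
    field_simp

/-- The **Hille–Hardy formula**. -/
theorem hasSum_hilleHardy {α r : ℝ} (hα : -1 < α) (hr0 : 0 < r) (hr : r < 1) (u v : ℝ) :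
    HasSum (fun k : ℕ => r ^ k * (k.factorial / Gamma (k + α + 1)) *
        laguerrePoly k α u * laguerrePoly k α v)
      ((1 - r) ^ (-(α + 1)) * exp (-((u + v) * r / (1 - r))) *
        besselSeries α (u * v * r / (1 - r) ^ 2)) := by
  have h1r : 0 < 1 - r := by linarith
  -- `ε` is small enough for `r (1 + ε) < 1`
  set ε : ℝ := (1 - r) / 2 with hε
  have hε0 : 0 < ε := by positivity
  have hrε : r * (1 + ε) < 1 := by rw [hε]; nlinarith
  obtain ⟨K, hK⟩ := (summable_pow_div_Gamma hα
    (div_nonneg (abs_nonneg v) hε0.le)).tendsto_atTop_zero.bddAbove_range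
  have hK' : ∀ j : ℕ, |v| ^ j / Gamma (j + α + 1) ≤ K * ε ^ j := by
    intro j
    have := hK ⟨j, rfl⟩
    simp only [div_pow] at this
    have hΓ := Gamma_nat_add_pos hα j
    rw [div_div, mul_comm, ← div_div, div_le_iff₀ (by positivity)] at this
    exact this
  have hs : Summable fun p : ℕ × ℕ => r ^ p.1 * laguerrePoly p.1 α u *
      ((p.1.choose p.2 : ℝ) * ((-v) ^ p.2 / Gamma (p.2 + α + 1))) := by
    have hs1 : Summable fun p : ℕ × ℕ => r ^ p.1 * laguerrePoly p.1 α u *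
        ((p.1.choose p.2 : ℝ) * 1 ^ (p.1 - p.2) * ε ^ p.2 * K) := by
      refine summable_prod_of_rows (g := fun k => (r * (1 + ε)) ^ k * |laguerrePoly k α u| * |K|)
        (fun k => ?_) ((summable_pow_mul_abs_laguerrePoly u hα (by positivity) hrε).mul_right _)
      refine hasSum_of_eq (((hasSum_choose_mul_pow k 1 ε).mul_left
        (r ^ k * |laguerrePoly k α u|)).mul_right |K|) (fun j => ?_) ?_
      · simp only [abs_mul, abs_pow, abs_of_pos hr0, abs_of_pos hε0, Nat.abs_cast, abs_one]
        ring
      · rw [mul_pow]; ring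
    refine Summable.of_norm_bounded hs1.norm fun p => ?_
    have hΓ := Gamma_nat_add_pos hα p.2
    simp only [norm_eq_abs, abs_mul, abs_div, abs_pow, abs_neg, abs_of_pos hΓ, Nat.abs_cast,
      one_pow, mul_one, abs_of_pos hε0]
    rw [mul_assoc ((p.1.choose p.2 : ℝ))]
    gcongr
    rw [mul_comm]
    exact (hK' p.2).trans (mul_le_mul_of_nonneg_right (le_abs_self K) (by positivity))
  have hrow : HasSum _ _ := hs.hasSum.prod_fiberwise
    (fun k => (hasSum_choose_div_Gamma hα k v).mul_left (r ^ k * laguerrePoly k α u))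
  refine hasSum_of_eq hrow (fun k => by ring) ?_
  have hcol := (((Equiv.prodComm ℕ ℕ).hasSum_iff).2 hs.hasSum).prod_fiberwise
    (g := fun j : ℕ => (1 - r) ^ (-(α + 1)) * exp (-(u * r / (1 - r))) *
      ((-(v * r / (1 - r))) ^ j / Gamma (j + α + 1) * laguerrePoly j α (u / (1 - r)))) fun j => by
    refine hasSum_of_eq ((hasSum_choose_mul_laguerrePoly u hα hr0.le hr j).mul_left
      ((-v) ^ j / Gamma (j + α + 1) * r ^ j)) (fun k => ?_) ?_
    · simp only [Function.comp_apply, Equiv.prodComm_apply, Prod.swap_prod_mk]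
      rcases le_or_gt j k with hjk | hjk
      · rw [show r ^ k = r ^ (k - j) * r ^ j by rw [← pow_add, Nat.sub_add_cancel hjk]]
        ring
      · simp [Nat.choose_eq_zero_of_lt hjk]
    · rw [show -(v * r / (1 - r)) = (-v) * r * (1 - r)⁻¹ by ring, mul_pow, mul_pow]
      ring
  rw [← hcol.tsum_eq, tsum_mul_left, tsum_pow_div_Gamma_mul_laguerrePoly hα]
  rw [show -((u + v) * r / (1 - r)) = -(u * r / (1 - r)) + -(v * r / (1 - r)) by ring, exp_add,
    show -(u / (1 - r) * -(v * r / (1 - r))) = u * v * r / (1 - r) ^ 2 by field_simp]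
  ring

open MeasureTheory ProbabilityTheory

/-! ### The Poisson representation of the Bessel series -/

/-- The law of the square of the integration variable in Poisson's integral: up to its mass
`1 / Γ(ν + 1)` the Beta distribution with parameters `1/2` and `ν + 1/2`, which degenerates to
the point mass at `1` if `ν = -1/2`. -/
def squareMeasure (ν : ℝ) : Measure ℝ :=
  ENNReal.ofReal (1 / Gamma (ν + 1)) •
    if ν = -1 / 2 then Measure.dirac 1 else betaMeasure (1 / 2) (ν + 1 / 2)

/-- The symmetric measure on `[-1, 1]` whose image under squaring is `squareMeasure ν`. For
`ν > -1/2` it is a multiple of `(1 - s²)^{ν - 1/2} ds`, and its exponential moments are the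
values of the Bessel series (Poisson's integral). -/
def besselMeasure (ν : ℝ) : Measure ℝ :=
  (2⁻¹ : ENNReal) • ((squareMeasure ν).map (fun v => √v) + (squareMeasure ν).map (fun v => -√v))

theorem isFiniteMeasure_squareMeasure {ν : ℝ} (hν : -1 / 2 ≤ ν) :
    IsFiniteMeasure (squareMeasure ν) := by
  unfold squareMeasure
  split_ifs with h
  · exact Measure.smul_finite _ ENNReal.ofReal_ne_top
  · have : -1 / 2 < ν := lt_of_le_of_ne hν (Ne.symm h)
    have := isProbabilityMeasureBeta (α := 1 / 2) (β := ν + 1 / 2) (by norm_num) (by linarith)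
    exact Measure.smul_finite _ ENNReal.ofReal_ne_top

theorem isFiniteMeasure_besselMeasure {ν : ℝ} (hν : -1 / 2 ≤ ν) :
    IsFiniteMeasure (besselMeasure ν) := by
  have := isFiniteMeasure_squareMeasure hν
  exact Measure.smul_finite _ (by simp)

theorem ae_squareMeasure_mem_Icc (ν : ℝ) : ∀ᵐ v ∂squareMeasure ν, v ∈ Icc (0 : ℝ) 1 := by
  unfold squareMeasure
  refine Measure.ae_smul_measure ?_ _
  split_ifs
  · exact (ae_dirac_iff measurableSet_Icc).2 (by simp)
  · refine (ae_withDensity_iff (measurable_betaPDFReal _ _).ennreal_ofReal).2 ?_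
    refine Filter.Eventually.of_forall fun v hv => ?_
    by_contra h
    rw [mem_Icc, not_and_or, not_le, not_le] at h
    rcases h with h | h
    · exact hv (betaPDF_eq_zero_of_nonpos h.le)
    · exact hv (betaPDF_eq_zero_of_one_le h.le)

theorem ae_besselMeasure_mem_Icc (ν : ℝ) : ∀ᵐ s ∂besselMeasure ν, s ∈ Icc (-1 : ℝ) 1 := by
  refine Measure.ae_smul_measure ?_ _
  refine ae_add_measure_iff.2 ⟨?_, ?_⟩
  · refine (ae_map_iff (by fun_prop) measurableSet_Icc).2 ?_
    filter_upwards [ae_squareMeasure_mem_Icc ν] with v hv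
    exact ⟨by linarith [sqrt_nonneg v], sqrt_le_one.2 hv.2⟩
  · refine (ae_map_iff (by fun_prop) measurableSet_Icc).2 ?_
    filter_upwards [ae_squareMeasure_mem_Icc ν] with v hv
    exact ⟨by linarith [sqrt_le_one.2 hv.2], by linarith [sqrt_nonneg v]⟩

theorem integrable_of_continuous_squareMeasure {ν : ℝ} (hν : -1 / 2 ≤ ν) {f : ℝ → ℝ}
    (hf : Continuous f) : Integrable f (squareMeasure ν) := by
  have := isFiniteMeasure_squareMeasure hν
  obtain ⟨C, hC⟩ := isCompact_Icc.exists_bound_of_continuousOn (hf.continuousOn (s := Icc 0 1))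
  refine Integrable.of_bound hf.aestronglyMeasurable C ?_
  filter_upwards [ae_squareMeasure_mem_Icc ν] with v hv using hC v hv

theorem integrable_of_continuous_besselMeasure {ν : ℝ} (hν : -1 / 2 ≤ ν) {f : ℝ → ℝ}
    (hf : Continuous f) : Integrable f (besselMeasure ν) := by
  have := isFiniteMeasure_besselMeasure hν
  obtain ⟨C, hC⟩ := isCompact_Icc.exists_bound_of_continuousOn (hf.continuousOn (s := Icc (-1) 1))
  refine Integrable.of_bound hf.aestronglyMeasurable C ?_
  filter_upwards [ae_besselMeasure_mem_Icc ν] with v hv using hC v hv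

theorem integral_besselMeasure {ν : ℝ} (hν : -1 / 2 ≤ ν) {f : ℝ → ℝ} (hf : Continuous f) :
    ∫ s, f s ∂besselMeasure ν = ∫ v, (f (√v) + f (-√v)) / 2 ∂squareMeasure ν := by
  have h1 : Continuous fun v : ℝ => √v := continuous_sqrt
  have h2 : Continuous fun v : ℝ => -√v := continuous_sqrt.neg
  have i1 : Integrable (fun v => f (√v)) (squareMeasure ν) :=
    integrable_of_continuous_squareMeasure hν (hf.comp h1)
  have i2 : Integrable (fun v => f (-√v)) (squareMeasure ν) :=
    integrable_of_continuous_squareMeasure hν (hf.comp h2)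
  rw [besselMeasure, integral_smul_measure, integral_add_measure
    ((integrable_map_measure hf.aestronglyMeasurable h1.aemeasurable).2 i1)
    ((integrable_map_measure hf.aestronglyMeasurable h2.aemeasurable).2 i2),
    integral_map h1.aemeasurable hf.aestronglyMeasurable,
    integral_map h2.aemeasurable hf.aestronglyMeasurable, ← integral_add i1 i2,
    ← integral_smul]
  refine integral_congr_ae (Filter.Eventually.of_forall fun v => ?_)
  simp
  ring

theorem integral_betaMeasure {a b : ℝ} (ha : 0 < a) (hb : 0 < b) (f : ℝ → ℝ) :
    ∫ v, f v ∂betaMeasure a b = ∫ v, betaPDFReal a b v * f v := by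
  have hpos : ∀ v, 0 ≤ betaPDFReal a b v := fun v => by
    by_cases h : 0 < v ∧ v < 1
    · exact (betaPDFReal_pos h.1 h.2 ha hb).le
    · rw [betaPDFReal, if_neg h]
  refine (integral_withDensity_eq_integral_toReal_smul
    (measurable_betaPDFReal _ _).ennreal_ofReal
    (Filter.Eventually.of_forall fun v => ENNReal.ofReal_lt_top) f).trans ?_
  refine integral_congr_ae (Filter.Eventually.of_forall fun v => ?_)
  simp [ENNReal.toReal_ofReal (hpos v)]

theorem integral_betaPDFReal {a b : ℝ} (ha : 0 < a) (hb : 0 < b) :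
    ∫ v, betaPDFReal a b v = 1 := by
  have h := integral_betaMeasure ha hb (fun _ => 1)
  have := isProbabilityMeasureBeta ha hb
  simpa using h.symm

theorem integrable_betaPDFReal {a b : ℝ} (ha : 0 < a) (hb : 0 < b) :
    Integrable (betaPDFReal a b) := by
  by_contra h
  have := integral_betaPDFReal ha hb
  rw [integral_undef h] at this
  exact zero_ne_one this

theorem integral_pow_betaMeasure {a b : ℝ} (ha : 0 < a) (hb : 0 < b) (m : ℕ) :
    ∫ v, v ^ m ∂betaMeasure a b = beta (a + m) b / beta a b := by
  have ham : 0 < a + m := by positivity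
  have h1 := beta_pos ha hb
  have h2 := beta_pos ham hb
  rw [integral_betaMeasure ha hb, ← mul_one (beta (a + m) b / beta a b),
    ← integral_betaPDFReal ham hb, ← integral_const_mul]
  refine integral_congr_ae (Filter.Eventually.of_forall fun v => ?_)
  simp only [betaPDFReal]
  split_ifs with h
  · rw [show a + m - 1 = (a - 1) + m by ring, rpow_add_natCast h.1.ne']
    field_simp
  · simp

theorem Gamma_natCast_add_half (m : ℕ) :
    Gamma (m + 1 / 2) = √π * (2 * m).factorial / (4 ^ m * m.factorial) := by
  induction m with
  | zero => simp [← Gamma_one_half_eq]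
  | succ m ih =>
    rw [show ((m + 1 : ℕ) : ℝ) + 1 / 2 = (m + 1 / 2) + 1 by push_cast; ring,
      Gamma_add_one (by positivity), ih, show 2 * (m + 1) = 2 * m + 1 + 1 by ring,
      Nat.factorial_succ, Nat.factorial_succ, Nat.factorial_succ]
    push_cast
    field_simp
    ring

theorem integral_pow_squareMeasure {ν : ℝ} (hν : -1 / 2 ≤ ν) (m : ℕ) :
    ∫ v, v ^ m ∂squareMeasure ν =
      (2 * m).factorial / (4 ^ m * m.factorial * Gamma (m + ν + 1)) := by
  have hΓ : 0 < Gamma (ν + 1) := Gamma_pos_of_pos (by linarith)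
  have hπ : (0 : ℝ) < √π := sqrt_pos.2 pi_pos
  rw [squareMeasure, integral_smul_measure, ENNReal.toReal_ofReal (by positivity)]
  split_ifs with h
  · subst h
    rw [integral_dirac, show (-1 / 2 : ℝ) + 1 = 1 / 2 by norm_num, Gamma_one_half_eq,
      show (m : ℝ) + -1 / 2 + 1 = m + 1 / 2 by ring, Gamma_natCast_add_half]
    simp only [one_pow, smul_eq_mul, mul_one]
    field_simp
  · have hν' : -1 / 2 < ν := lt_of_le_of_ne hν (Ne.symm h)
    have h2 : 0 < Gamma (ν + 1 / 2) := Gamma_pos_of_pos (by linarith)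
    have h3 := Gamma_nat_add_pos (α := ν) (by linarith) m
    rw [integral_pow_betaMeasure (by norm_num) (by linarith), beta, beta,
      Gamma_one_half_eq, add_comm (1 / 2 : ℝ) m, Gamma_natCast_add_half,
      show (m : ℝ) + 1 / 2 + (ν + 1 / 2) = m + ν + 1 by ring,
      show (1 : ℝ) / 2 + (ν + 1 / 2) = ν + 1 by ring, smul_eq_mul]
    generalize Gamma (ν + 1 / 2) = G at h2
    field_simp

/-- **Poisson's integral** for the Bessel series. -/
theorem integral_exp_besselMeasure {ν : ℝ} (hν : -1 / 2 ≤ ν) (z : ℝ) :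
    ∫ s, exp (2 * z * s) ∂besselMeasure ν = besselSeries ν (z ^ 2) := by
  have := isFiniteMeasure_squareMeasure hν
  rw [integral_besselMeasure hν (by fun_prop)]
  have h : HasSum (fun m : ℕ => ∫ v, (2 * z) ^ (2 * m) / (2 * m).factorial * v ^ m ∂squareMeasure ν)
      (∫ v, (exp (2 * z * √v) + exp (2 * z * -√v)) / 2 ∂squareMeasure ν) := by
    refine hasSum_integral_of_dominated_convergence
      (fun m _ => |2 * z| ^ (2 * m) / (2 * m).factorial)
      (fun m => (by fun_prop : Continuous _).aestronglyMeasurable) (fun m => ?_)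
      (Filter.Eventually.of_forall fun _ => (hasSum_cosh _).summable) (integrable_const _) ?_
    · filter_upwards [ae_squareMeasure_mem_Icc ν] with v hv
      rw [norm_mul, norm_div, norm_pow, norm_pow, norm_eq_abs, norm_eq_abs v, RCLike.norm_natCast]
      refine mul_le_of_le_one_right (by positivity) (pow_le_one₀ (abs_nonneg v) ?_)
      rw [abs_of_nonneg hv.1]; exact hv.2
    · filter_upwards [ae_squareMeasure_mem_Icc ν] with v hv
      refine hasSum_of_eq (hasSum_cosh (2 * z * √v)) (fun m => ?_) ?_
      · rw [mul_pow (2 * z), pow_mul (√v), sq_sqrt hv.1]; ring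
      · rw [cosh_eq]; simp
  rw [← h.tsum_eq, besselSeries]
  refine tsum_congr fun m => ?_
  rw [integral_const_mul, integral_pow_squareMeasure hν, mul_pow, pow_mul, pow_mul,
    show (2 : ℝ) ^ 2 = 4 by norm_num]
  have h3 := (Gamma_nat_add_pos (α := ν) (by linarith) m).ne'
  field_simp

/-- Poisson's integral for the Bessel series of the next order, over the same measure. -/
theorem integral_mul_exp_besselMeasure {ν : ℝ} (hν : -1 / 2 ≤ ν) (z : ℝ) :
    ∫ s, s * exp (2 * z * s) ∂besselMeasure ν = z * besselSeries (ν + 1) (z ^ 2) := by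
  have := isFiniteMeasure_squareMeasure hν
  rw [integral_besselMeasure hν (f := fun s => s * exp (2 * z * s)) (by fun_prop)]
  have h : HasSum (fun m : ℕ => ∫ v, (2 * z) ^ (2 * m + 1) / (2 * m + 1).factorial * v ^ (m + 1)
      ∂squareMeasure ν)
      (∫ v, (√v * exp (2 * z * √v) + -√v * exp (2 * z * -√v)) / 2 ∂squareMeasure ν) := by
    refine hasSum_integral_of_dominated_convergence
      (fun m _ => |2 * z| ^ (2 * m + 1) / (2 * m + 1).factorial)
      (fun m => (by fun_prop : Continuous _).aestronglyMeasurable) (fun m => ?_)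
      (Filter.Eventually.of_forall fun _ => (hasSum_sinh _).summable) (integrable_const _) ?_
    · filter_upwards [ae_squareMeasure_mem_Icc ν] with v hv
      rw [norm_mul, norm_div, norm_pow, norm_pow, norm_eq_abs, norm_eq_abs v, RCLike.norm_natCast]
      refine mul_le_of_le_one_right (by positivity) (pow_le_one₀ (abs_nonneg v) ?_)
      rw [abs_of_nonneg hv.1]; exact hv.2
    · filter_upwards [ae_squareMeasure_mem_Icc ν] with v hv
      refine hasSum_of_eq ((hasSum_sinh (2 * z * √v)).mul_left (√v)) (fun m => ?_) ?_
      · have : (√v) ^ (2 * m + 1) = v ^ m * √v := by rw [pow_succ, pow_mul, sq_sqrt hv.1]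
        rw [mul_pow (2 * z), this, pow_succ v, show v ^ m * v = v ^ m * (√v * √v) by
          rw [mul_self_sqrt hv.1]]
        ring
      · rw [sinh_eq, mul_neg (2 * z)]; ring
  rw [← h.tsum_eq, besselSeries, ← tsum_mul_left]
  refine tsum_congr fun m => ?_
  rw [integral_const_mul, integral_pow_squareMeasure hν, mul_pow, pow_succ, pow_succ z, pow_mul,
    pow_mul, show (2 : ℝ) ^ 2 = 4 by norm_num, show 2 * (m + 1) = 2 * m + 1 + 1 by ring,
    Nat.factorial_succ (2 * m + 1), Nat.factorial_succ m]
  have h3 := (Gamma_nat_add_pos (α := ν + 1) (by linarith) m).ne'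
  rw [show ((m + 1 : ℕ) : ℝ) + ν + 1 = m + (ν + 1) + 1 by push_cast; ring]
  push_cast
  field_simp
  ring

/-! ### Closed form of the one-dimensional heat kernel -/

/-- The phase of Mehler's kernel at times `2t`, with `s ∈ [-1, 1]` in front of the product `xy`. -/
def phase (t x y s : ℝ) : ℝ :=
  (x ^ 2 + y ^ 2) / 2 * (cosh (2 * t) / sinh (2 * t)) - x * y * s / sinh (2 * t)

/-- The factor of the heat kernel in front of the integral of `exp (-phase)`. -/
def heatFactor (ν t x y : ℝ) : ℝ := 2 * (2 * sinh (2 * t)) ^ (-(ν + 1)) * (x * y) ^ (ν + 1 / 2)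

theorem hasSum_heatTerm₁_besselSeries {ν t x y : ℝ} (hν : -1 / 2 ≤ ν) (ht : 0 < t) (hx : 0 < x)
    (hy : 0 < y) :
    HasSum (heatTerm₁ ν t x y) (heatFactor ν t x y *
      (exp (-((x ^ 2 + y ^ 2) / 2 * (cosh (2 * t) / sinh (2 * t)))) *
        besselSeries ν ((x * y / (2 * sinh (2 * t))) ^ 2))) := by
  have hα : -1 < ν := by linarith
  have hS : 0 < sinh (2 * t) := sinh_pos_iff.2 (by linarith)
  have hr0 : 0 < exp (-4 * t) := exp_pos _
  have hr : exp (-4 * t) < 1 := by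
    rw [exp_lt_one_iff]; linarith
  have h1r : 1 - exp (-4 * t) = exp (-(2 * t)) * (2 * sinh (2 * t)) := by
    rw [sinh_eq, mul_div_cancel₀ _ two_ne_zero, mul_sub, ← exp_add, ← exp_add]
    rw [neg_add_cancel, exp_zero]
    ring_nf
  have hrr : exp (-4 * t) = exp (-(2 * t)) * exp (-(2 * t)) := by rw [← exp_add]; ring_nf
  refine hasSum_of_eq ((hasSum_hilleHardy hα hr0 hr (x ^ 2) (y ^ 2)).mul_left
    (2 * exp (-t * (2 * ν + 2)) * (x * y) ^ (ν + 1 / 2) * exp (-(x ^ 2 + y ^ 2) / 2)))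
    (fun k => ?_) ?_
  · have hΓ := Gamma_nat_add_pos hα k
    have hΓk : Gamma ((k : ℝ) + 1) = k.factorial := Gamma_nat_eq_factorial k
    have hsq : √(2 * k.factorial / Gamma (k + ν + 1)) * √(2 * k.factorial / Gamma (k + ν + 1)) =
        2 * k.factorial / Gamma (k + ν + 1) := mul_self_sqrt (by positivity)
    have e1 : exp (-t * (4 * k + 2 * ν + 2)) = exp (-t * (2 * ν + 2)) * exp (-4 * t) ^ k := by
      rw [← exp_nat_mul, ← exp_add]; ring_nf
    have e2 : exp (-(x ^ 2 + y ^ 2) / 2) = exp (-x ^ 2 / 2) * exp (-y ^ 2 / 2) := by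
      rw [← exp_add]; ring_nf
    rw [heatTerm₁, laguerreFun, laguerreFun, hΓk, e1, e2, mul_rpow hx.le hy.le]
    calc _ = exp (-t * (2 * ν + 2)) * exp (-4 * t) ^ k * (2 * k.factorial / Gamma (k + ν + 1)) *
          laguerrePoly k ν (x ^ 2) * laguerrePoly k ν (y ^ 2) * (x ^ (ν + 1 / 2) * y ^ (ν + 1 / 2))
          * (exp (-x ^ 2 / 2) * exp (-y ^ 2 / 2)) := by ring
      _ = (√(2 * k.factorial / Gamma (k + ν + 1)) * √(2 * k.factorial / Gamma (k + ν + 1))) *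
          (exp (-t * (2 * ν + 2)) * exp (-4 * t) ^ k *
          laguerrePoly k ν (x ^ 2) * laguerrePoly k ν (y ^ 2) * (x ^ (ν + 1 / 2) * y ^ (ν + 1 / 2))
          * (exp (-x ^ 2 / 2) * exp (-y ^ 2 / 2))) := by rw [hsq]; ring
      _ = _ := by ring
  · rw [h1r]
    have e1 : (exp (-(2 * t)) * (2 * sinh (2 * t))) ^ (-(ν + 1)) =
        exp (t * (2 * ν + 2)) * (2 * sinh (2 * t)) ^ (-(ν + 1)) := by
      rw [mul_rpow (exp_pos _).le (by positivity), ← exp_mul]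
      ring_nf
    have e2 : exp (-t * (2 * ν + 2)) * exp (t * (2 * ν + 2)) = 1 := by
      rw [← exp_add]; ring_nf; simp
    have e3 : x ^ 2 * y ^ 2 * exp (-4 * t) / (exp (-(2 * t)) * (2 * sinh (2 * t))) ^ 2 =
        (x * y / (2 * sinh (2 * t))) ^ 2 := by
      rw [hrr]; field_simp
    have e4 : exp (-((x ^ 2 + y ^ 2) / 2 * (cosh (2 * t) / sinh (2 * t)))) =
        exp (-(x ^ 2 + y ^ 2) / 2) *
        exp (-((x ^ 2 + y ^ 2) * exp (-4 * t) / (exp (-(2 * t)) * (2 * sinh (2 * t))))) := by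
      rw [← exp_add]
      congr 1
      have : cosh (2 * t) = sinh (2 * t) + exp (-(2 * t)) := by rw [cosh_eq, sinh_eq]; ring
      rw [hrr, this]
      field_simp
      ring
    rw [e1, e3, e4, heatFactor]
    linear_combination (2 * (x * y) ^ (ν + 1 / 2) * exp (-(x ^ 2 + y ^ 2) / 2) *
      (2 * sinh (2 * t)) ^ (-(ν + 1)) *
      exp (-((x ^ 2 + y ^ 2) * exp (-4 * t) / (exp (-(2 * t)) * (2 * sinh (2 * t))))) *
      besselSeries ν ((x * y / (2 * sinh (2 * t))) ^ 2)) * e2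

theorem exp_neg_phase {t : ℝ} (x y s : ℝ) :
    exp (-phase t x y s) = exp (-((x ^ 2 + y ^ 2) / 2 * (cosh (2 * t) / sinh (2 * t)))) *
      exp (2 * (x * y / (2 * sinh (2 * t))) * s) := by
  rw [← exp_add, phase]
  congr 1
  field_simp
  ring

/-- The heat kernel as a superposition of Mehler-type Gaussian kernels. -/
theorem hasSum_heatTerm₁ {ν t x y : ℝ} (hν : -1 / 2 ≤ ν) (ht : 0 < t) (hx : 0 < x) (hy : 0 < y) :
    HasSum (heatTerm₁ ν t x y)
      (heatFactor ν t x y * ∫ s, exp (-phase t x y s) ∂besselMeasure ν) := by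
  refine hasSum_of_eq (hasSum_heatTerm₁_besselSeries hν ht hx hy) (fun _ => rfl) ?_
  simp_rw [exp_neg_phase]
  rw [integral_const_mul, integral_exp_besselMeasure hν]

theorem heatKernel₁_eq {ν t x y : ℝ} (hν : -1 / 2 ≤ ν) (ht : 0 < t) (hx : 0 < x) (hy : 0 < y) :
    heatKernel₁ ν t x y = heatFactor ν t x y * ∫ s, exp (-phase t x y s) ∂besselMeasure ν :=
  (hasSum_heatTerm₁ hν ht hx hy).tsum_eq

theorem heatKernel₁_add_one_eq {ν t x y : ℝ} (hν : -1 / 2 ≤ ν) (ht : 0 < t) (hx : 0 < x)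
    (hy : 0 < y) :
    heatKernel₁ (ν + 1) t x y =
      heatFactor ν t x y * ∫ s, s * exp (-phase t x y s) ∂besselMeasure ν := by
  have hS : 0 < sinh (2 * t) := sinh_pos_iff.2 (by linarith)
  have hxy : 0 < x * y := by positivity
  rw [heatKernel₁, (hasSum_heatTerm₁_besselSeries (by linarith) ht hx hy).tsum_eq]
  have e : ∀ s, s * exp (-phase t x y s) =
      exp (-((x ^ 2 + y ^ 2) / 2 * (cosh (2 * t) / sinh (2 * t)))) *
        (s * exp (2 * (x * y / (2 * sinh (2 * t))) * s)) := fun s => by rw [exp_neg_phase]; ring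
  simp_rw [e]
  rw [integral_const_mul, integral_mul_exp_besselMeasure hν, heatFactor, heatFactor,
    show -(ν + 1 + 1) = -(ν + 1) - 1 by ring, rpow_sub_one (by positivity),
    show ν + 1 + 1 / 2 = (ν + 1 / 2) + 1 by ring, rpow_add_one hxy.ne']
  field_simp

/-- The difference of the kernels of orders `ν` and `ν + 1` carries the extra factor `1 - s`. -/
theorem heatKernel₁_sub_add_one_eq {ν t x y : ℝ} (hν : -1 / 2 ≤ ν) (ht : 0 < t) (hx : 0 < x)
    (hy : 0 < y) :
    heatKernel₁ ν t x y - heatKernel₁ (ν + 1) t x y =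
      heatFactor ν t x y * ∫ s, exp (-phase t x y s) * (1 - s) ∂besselMeasure ν := by
  have hc : Continuous fun s => exp (-phase t x y s) := by unfold phase; fun_prop
  rw [heatKernel₁_eq hν ht hx hy, heatKernel₁_add_one_eq hν ht hx hy, ← mul_sub,
    ← integral_sub (integrable_of_continuous_besselMeasure hν hc)
      (integrable_of_continuous_besselMeasure hν (f := fun s => s * exp (-phase t x y s))
        (continuous_id.mul hc))]
  congr 2
  funext s
  ring

/-! ### Decay of exponential integrals against the Bessel measure -/

/-- Exponentials beat powers. -/
theorem exists_one_add_rpow_mul_exp_le (p : ℝ) {c : ℝ} (hc : 0 < c) :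
    ∃ C > 0, ∀ x : ℝ, 0 ≤ x → (1 + x) ^ p * exp (-(c * x)) ≤ C := by
  obtain ⟨n, hn⟩ := exists_nat_ge p
  refine ⟨n.factorial / c ^ n * exp c, by positivity, fun x hx => ?_⟩
  have h1 : (1 + x) ^ p ≤ (1 + x) ^ n := by
    rw [← rpow_natCast]
    exact rpow_le_rpow_of_exponent_le (by linarith) hn
  have h2 := pow_div_factorial_le_exp (c * (1 + x)) (by positivity) n
  rw [div_le_iff₀ (by positivity), mul_pow] at h2
  have h3 : exp (c * (1 + x)) * exp (-(c * x)) = exp c := by rw [← exp_add]; ring_nf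
  calc (1 + x) ^ p * exp (-(c * x)) ≤ (1 + x) ^ n * exp (-(c * x)) := by gcongr
    _ = (c ^ n * (1 + x) ^ n) / c ^ n * exp (-(c * x)) := by field_simp
    _ ≤ (exp (c * (1 + x)) * n.factorial) / c ^ n * exp (-(c * x)) := by gcongr
    _ = n.factorial / c ^ n * (exp (c * (1 + x)) * exp (-(c * x))) := by ring
    _ = _ := by rw [h3]

theorem exists_integral_exp_betaMeasure_le {b : ℝ} (hb : 0 < b) :
    ∃ C > 0, ∀ z : ℝ, 1 ≤ z →
      z ^ b * ∫ v, exp (-(z * (1 - v) / 8)) ∂betaMeasure (1 / 2) b ≤ C := by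
  obtain ⟨C₁, hC₁, h₁⟩ := exists_one_add_rpow_mul_exp_le b (c := 1 / 16) (by norm_num)
  have hB : 0 < beta (1 / 2) b := beta_pos (by norm_num) hb
  set D : ℝ := 1 / beta (1 / 2) b * (1 / 2 : ℝ) ^ ((1 : ℝ) / 2 - 1) with hD
  have hD0 : 0 < D := by positivity
  have hΓ := Gamma_pos_of_pos hb
  refine ⟨C₁ + D * 8 ^ b * Gamma b, by positivity, fun z hz => ?_⟩
  have hz0 : 0 < z := by linarith
  -- the singularity of the density at `v = 1` produces the power of `z`
  set G : ℝ → ℝ := (Ioi 0).indicator fun σ => σ ^ (b - 1) * exp (-(z / 8 * σ)) with hG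
  have hGint : ∫ σ, G σ = (1 / (z / 8)) ^ b * Gamma b := by
    rw [hG, integral_indicator measurableSet_Ioi, integral_rpow_mul_exp_neg_mul_Ioi hb (by positivity)]
  have hGi : Integrable G := by
    by_contra h
    rw [integral_undef h] at hGint
    exact absurd hGint (by positivity)
  have hGi' : Integrable fun v => G (1 - v) := hGi.comp_sub_left 1
  have hpdf := integrable_betaPDFReal (a := 1 / 2) (by norm_num) hb
  have hle : ∫ v, exp (-(z * (1 - v) / 8)) ∂betaMeasure (1 / 2) b ≤
      exp (-(1 / 16 * z)) + D * ((1 / (z / 8)) ^ b * Gamma b) := by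
    rw [integral_betaMeasure (by norm_num) hb]
    calc _ ≤ ∫ v, (exp (-(1 / 16 * z)) * betaPDFReal (1 / 2) b v + D * G (1 - v)) := by
          refine integral_mono_of_nonneg (Filter.Eventually.of_forall fun v => ?_)
            ((hpdf.const_mul _).add (hGi'.const_mul _)) (Filter.Eventually.of_forall fun v => ?_)
          · refine mul_nonneg ?_ (exp_pos _).le
            by_cases h : 0 < v ∧ v < 1
            · exact (betaPDFReal_pos h.1 h.2 (by norm_num) hb).le
            · rw [betaPDFReal, if_neg h]
          · have hG0 : 0 ≤ G (1 - v) :=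
              indicator_nonneg (fun σ hσ => mul_nonneg (rpow_nonneg (le_of_lt hσ) _)
                (exp_pos _).le) _
            by_cases h : 0 < v ∧ v < 1
            · have hp := (betaPDFReal_pos (α := 1 / 2) h.1 h.2 (by norm_num) hb).le
              dsimp only
              rcases le_or_gt v (1 / 2) with hv | hv
              · have : exp (-(z * (1 - v) / 8)) ≤ exp (-(1 / 16 * z)) :=
                  exp_le_exp.2 (by nlinarith)
                have h4 : 0 ≤ D * G (1 - v) := by positivity
                nlinarith [mul_le_mul_of_nonneg_left this hp]
              · have h1v : 0 < 1 - v := by linarith [h.2]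
                have h5 : v ^ ((1 : ℝ) / 2 - 1) ≤ (1 / 2 : ℝ) ^ ((1 : ℝ) / 2 - 1) :=
                  rpow_le_rpow_of_nonpos (by norm_num) hv.le (by norm_num)
                have h6 : G (1 - v) = (1 - v) ^ (b - 1) * exp (-(z * (1 - v) / 8)) := by
                  rw [hG, indicator_of_mem (mem_Ioi.2 h1v)]
                  ring_nf
                have h7 : 0 ≤ exp (-(1 / 16 * z)) * betaPDFReal (1 / 2) b v :=
                  mul_nonneg (exp_pos _).le hp
                refine le_trans ?_ (le_add_of_nonneg_left h7)
                rw [h6, betaPDFReal, if_pos h, hD]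
                rw [← mul_assoc]
                gcongr
            · have h0 : betaPDFReal (1 / 2) b v = 0 := by rw [betaPDFReal, if_neg h]
              simp only [h0, zero_mul, mul_zero, zero_add]
              positivity
      _ = _ := by
          rw [integral_add (hpdf.const_mul _) (hGi'.const_mul _), integral_const_mul,
            integral_const_mul, integral_betaPDFReal (by norm_num) hb, mul_one,
            integral_sub_left_eq_self G volume 1, hGint]
  calc z ^ b * ∫ v, exp (-(z * (1 - v) / 8)) ∂betaMeasure (1 / 2) b
      ≤ z ^ b * (exp (-(1 / 16 * z)) + D * ((1 / (z / 8)) ^ b * Gamma b)) := by gcongr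
    _ = z ^ b * exp (-(1 / 16 * z)) + D * 8 ^ b * Gamma b := by
        rw [show (1 / (z / 8)) = 8 / z by field_simp, div_rpow (by norm_num) hz0.le]
        field_simp
    _ ≤ C₁ + D * 8 ^ b * Gamma b := by
        gcongr
        refine le_trans ?_ (h₁ z hz0.le)
        gcongr
        linarith

/-- The exponential integral loses a factor `z ^ (-(ν + 1/2))` for large `z`, as the mass of
`besselMeasure ν` near `s = 1` does; this is the uniform bound for `z^{1/2} e^{-z} I_ν(z)`. -/
theorem exists_integral_exp_besselMeasure_le {ν : ℝ} (hν : -1 / 2 ≤ ν) :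
    ∃ C > 0, ∀ z : ℝ, 0 < z →
      z ^ (ν + 1 / 2) * ∫ s, exp (-(z * (1 - s) / 4)) ∂besselMeasure ν ≤
        C * min 1 z ^ (ν + 1 / 2) := by
  have := isFiniteMeasure_squareMeasure hν
  have hle : ∀ z : ℝ, 0 < z → ∫ s, exp (-(z * (1 - s) / 4)) ∂besselMeasure ν ≤
      ∫ v, exp (-(z * (1 - v) / 8)) ∂squareMeasure ν := by
    intro z hz
    rw [integral_besselMeasure hν (by fun_prop)]
    refine integral_mono_ae (integrable_of_continuous_squareMeasure hν (by fun_prop))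
      (integrable_of_continuous_squareMeasure hν (by fun_prop)) ?_
    filter_upwards [ae_squareMeasure_mem_Icc ν] with v hv
    have h1 := sqrt_nonneg v
    have h2 := sqrt_le_one.2 hv.2
    have h3 := mul_self_sqrt hv.1
    have h4 : (1 - v) / 2 ≤ 1 - √v := by nlinarith
    have h5 : exp (-(z * (1 - √v) / 4)) ≤ exp (-(z * (1 - v) / 8)) :=
      exp_le_exp.2 (by nlinarith)
    have h6 : exp (-(z * (1 - -√v) / 4)) ≤ exp (-(z * (1 - v) / 8)) :=
      exp_le_exp.2 (by nlinarith)
    linarith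
  set K : ℝ := ∫ _, (1 : ℝ) ∂squareMeasure ν with hK
  have hK0 : 0 ≤ K := integral_nonneg fun _ => zero_le_one
  have hle1 : ∀ z : ℝ, 0 < z → ∫ v, exp (-(z * (1 - v) / 8)) ∂squareMeasure ν ≤ K := by
    intro z hz
    refine integral_mono_ae (integrable_of_continuous_squareMeasure hν (by fun_prop))
      (integrable_const _) ?_
    filter_upwards [ae_squareMeasure_mem_Icc ν] with v hv
    refine exp_le_one_iff.2 ?_
    have := mul_nonneg hz.le (sub_nonneg.2 hv.2)
    linarith
  have hbig : ∃ C > 0, ∀ z : ℝ, 1 ≤ z →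
      z ^ (ν + 1 / 2) * ∫ v, exp (-(z * (1 - v) / 8)) ∂squareMeasure ν ≤ C := by
    by_cases h : ν = -1 / 2
    · refine ⟨K + 1, by positivity, fun z hz => ?_⟩
      rw [show ν + 1 / 2 = 0 by rw [h]; norm_num, rpow_zero, one_mul]
      linarith [hle1 z (by linarith)]
    · obtain ⟨C, hC, hb⟩ := exists_integral_exp_betaMeasure_le (b := ν + 1 / 2)
        (by linarith [lt_of_le_of_ne hν (Ne.symm h)])
      have hΓ : 0 < Gamma (ν + 1) := Gamma_pos_of_pos (by linarith)
      refine ⟨1 / Gamma (ν + 1) * C, by positivity, fun z hz => ?_⟩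
      rw [squareMeasure, if_neg h, integral_smul_measure, ENNReal.toReal_ofReal (by positivity),
        smul_eq_mul, mul_left_comm]
      gcongr
      exact hb z hz
  obtain ⟨C, hC, hb⟩ := hbig
  refine ⟨C + K, by positivity, fun z hz => ?_⟩
  rcases le_total 1 z with h | h
  · rw [min_eq_left h, one_rpow, mul_one]
    calc _ ≤ z ^ (ν + 1 / 2) * ∫ v, exp (-(z * (1 - v) / 8)) ∂squareMeasure ν := by
          gcongr; exact hle z hz
      _ ≤ C + K := by linarith [hb z h]
  · rw [min_eq_right h, mul_comm]
    gcongr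
    linarith [hle z hz, hle1 z hz]

/-! ### The operator `δ_ν` -/

theorem delta₁_congr {ν : ℝ} {f g : ℝ → ℝ} (h : EqOn f g (Ioi 0)) :
    EqOn (delta₁ ν f) (delta₁ ν g) (Ioi 0) := by
  intro x hx
  have : f =ᶠ[nhds x] g := h.eventuallyEq_of_mem (Ioi_mem_nhds hx)
  rw [delta₁, delta₁, this.deriv_eq, h hx]

theorem iterate_delta₁_congr {ν : ℝ} {f g : ℝ → ℝ} (h : EqOn f g (Ioi 0)) (m : ℕ) :
    EqOn ((delta₁ ν)^[m] f) ((delta₁ ν)^[m] g) (Ioi 0) := by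
  induction m with
  | zero => exact h
  | succ m ih => simpa only [Function.iterate_succ_apply'] using delta₁_congr ih

theorem contDiffOn_deriv {f : ℝ → ℝ} (hf : ContDiffOn ℝ ∞ f (Ioi 0)) :
    ContDiffOn ℝ ∞ (deriv f) (Ioi 0) :=
  hf.deriv_of_isOpen isOpen_Ioi (by simp)

theorem contDiffOn_delta₁ {ν : ℝ} {f : ℝ → ℝ} (hf : ContDiffOn ℝ ∞ f (Ioi 0)) :
    ContDiffOn ℝ ∞ (delta₁ ν f) (Ioi 0) := by
  refine (contDiffOn_deriv hf).add (ContDiffOn.mul ?_ hf)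
  exact contDiffOn_id.sub (contDiffOn_const.div contDiffOn_id fun x hx => (mem_Ioi.1 hx).ne')

theorem contDiffOn_iterate_delta₁ {ν : ℝ} {f : ℝ → ℝ} (hf : ContDiffOn ℝ ∞ f (Ioi 0)) (m : ℕ) :
    ContDiffOn ℝ ∞ ((delta₁ ν)^[m] f) (Ioi 0) := by
  induction m with
  | zero => exact hf
  | succ m ih => simpa only [Function.iterate_succ_apply'] using contDiffOn_delta₁ ih

theorem contDiffOn_iterate_deriv {f : ℝ → ℝ} (hf : ContDiffOn ℝ ∞ f (Ioi 0)) (m : ℕ) :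
    ContDiffOn ℝ ∞ (deriv^[m] f) (Ioi 0) := by
  induction m with
  | zero => exact hf
  | succ m ih => simpa only [Function.iterate_succ_apply'] using contDiffOn_deriv ih

/-! ### Derivatives of the heat kernel through Hermite polynomials -/

theorem hasDerivAt_integral_besselMeasure {ν : ℝ} (hν : -1 / 2 ≤ ν) {F F' : ℝ → ℝ → ℝ}
    (hF : Continuous (Function.uncurry F)) (hF' : Continuous (Function.uncurry F'))
    (h : ∀ x s, HasDerivAt (fun x => F x s) (F' x s) x) (x : ℝ) :
    HasDerivAt (fun x => ∫ s, F x s ∂besselMeasure ν) (∫ s, F' x s ∂besselMeasure ν) x := by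
  have := isFiniteMeasure_besselMeasure hν
  have hFx : ∀ x, Continuous (F x) := fun x => hF.comp (by fun_prop : Continuous fun s => (x, s))
  have hFx' : ∀ x, Continuous (F' x) := fun x => hF'.comp (by fun_prop : Continuous fun s => (x, s))
  obtain ⟨C, hC⟩ := ((isCompact_closedBall x 1).prod (isCompact_Icc (a := (-1 : ℝ)) (b := 1))
    ).exists_bound_of_continuousOn hF'.continuousOn
  refine (hasDerivAt_integral_of_dominated_loc_of_deriv_le (bound := fun _ => C)
    (Metric.closedBall_mem_nhds x one_pos)
    (Filter.Eventually.of_forall fun x => (hFx x).aestronglyMeasurable)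
    (integrable_of_continuous_besselMeasure hν (hFx x)) (hFx' x).aestronglyMeasurable ?_
    (integrable_const _) (Filter.Eventually.of_forall fun s x _ => h x s)).2
  filter_upwards [ae_besselMeasure_mem_Icc ν] with s hs z hz using hC (z, s) ⟨hz, hs⟩

/-- The rate `coth 2t - 1` of the Gaussian `x ↦ exp (x ^ 2 / 2 - phase t x y s)`. -/
def rate (t : ℝ) : ℝ := cosh (2 * t) / sinh (2 * t) - 1

theorem rate_pos {t : ℝ} (ht : 0 < t) : 0 < rate t := by
  have hS : 0 < sinh (2 * t) := sinh_pos_iff.2 (by linarith)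
  rw [rate, sub_pos, lt_div_iff₀ hS, one_mul]
  exact sinh_lt_cosh _

/-- The argument of the Hermite polynomial in the derivatives of `exp (x ^ 2 / 2 - phase)`. -/
def hermiteArg (t x y s : ℝ) : ℝ := (y * s / sinh (2 * t) - rate t * x) / √(rate t)

/-- The integrand of `δ_ν^m p_t^ν`: it is
`e^{-x²/2} (d/dx)^m e^{x²/2 - phase} = a^{m/2} He_m(U) e^{-phase}`, where `a = rate t`,
`U = hermiteArg t x y s`. -/
def hermiteKernel (m : ℕ) (t x y s : ℝ) : ℝ :=
  √(rate t) ^ m * Polynomial.aeval (hermiteArg t x y s) (Polynomial.hermite m) *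
    exp (-phase t x y s)

theorem hermiteKernel_zero (t x y s : ℝ) : hermiteKernel 0 t x y s = exp (-phase t x y s) := by
  simp [hermiteKernel]

theorem continuous_hermiteKernel (m : ℕ) (t y : ℝ) :
    Continuous fun p : ℝ × ℝ => hermiteKernel m t p.1 y p.2 := by
  have h1 : Continuous fun p : ℝ × ℝ => hermiteArg t p.1 y p.2 := by
    unfold hermiteArg; fun_prop
  have h2 : Continuous fun p : ℝ × ℝ => phase t p.1 y p.2 := by unfold phase; fun_prop
  have h3 := (Polynomial.continuous_aeval (A := ℝ) (Polynomial.hermite m)).comp h1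
  exact (continuous_const.mul h3).mul h2.neg.rexp

theorem hasDerivAt_hermiteKernel {t : ℝ} (ht : 0 < t) (m : ℕ) (x y s : ℝ) :
    HasDerivAt (fun x => hermiteKernel m t x y s)
      (hermiteKernel (m + 1) t x y s - x * hermiteKernel m t x y s) x := by
  have ha := rate_pos ht
  have hsa : 0 < √(rate t) := sqrt_pos.2 ha
  have hss : √(rate t) * √(rate t) = rate t := mul_self_sqrt ha.le
  have h1 : HasDerivAt (fun x => hermiteArg t x y s) (-√(rate t)) x := by
    have := (((hasDerivAt_id x).const_mul (rate t)).const_sub (y * s / sinh (2 * t))).div_const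
      (√(rate t))
    refine this.congr_deriv ?_
    rw [mul_one, neg_div, neg_inj, div_eq_iff hsa.ne', hss]
  have h2 : HasDerivAt (fun x => -phase t x y s)
      (√(rate t) * hermiteArg t x y s - x) x := by
    have := ((((hasDerivAt_id x).pow 2).add_const (y ^ 2)).div_const 2).mul_const
      (cosh (2 * t) / sinh (2 * t))
    have h3 := (((hasDerivAt_id x).mul_const y).mul_const s).div_const (sinh (2 * t))
    refine (this.sub h3).neg.congr_deriv ?_
    rw [hermiteArg, mul_div_cancel₀ _ hsa.ne', rate]
    simp
    ring
  have h3 := ((Polynomial.hermite m).hasDerivAt_aeval (hermiteArg t x y s)).comp x h1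
  have h4 := (h3.const_mul (√(rate t) ^ m)).mul h2.exp
  refine h4.congr_deriv ?_
  simp only [hermiteKernel, Polynomial.hermite_succ, map_sub, map_mul, Polynomial.aeval_X,
    Function.comp_apply]
  ring

/-- The heat kernel integral with the integrand of `δ_ν^m p_t^ν` and an additional weight. -/
def weightedKernel (ν : ℝ) (ψ : ℝ → ℝ) (m : ℕ) (t y x : ℝ) : ℝ :=
  heatFactor ν t x y * ∫ s, hermiteKernel m t x y s * ψ s ∂besselMeasure ν

theorem hasDerivAt_weightedKernel {ν t x y : ℝ} (hν : -1 / 2 ≤ ν) (ht : 0 < t) (hx : 0 < x)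
    (hy : 0 < y) {ψ : ℝ → ℝ} (hψ : Continuous ψ) (m : ℕ) :
    HasDerivAt (weightedKernel ν ψ m t y)
      (weightedKernel ν ψ (m + 1) t y x -
        (x - (ν + 1 / 2) / x) * weightedKernel ν ψ m t y x) x := by
  have hψ2 : Continuous fun p : ℝ × ℝ => ψ p.2 := hψ.comp continuous_snd
  have hi : ∀ m, Integrable (fun s => hermiteKernel m t x y s * ψ s) (besselMeasure ν) :=
    fun m => integrable_of_continuous_besselMeasure hν
      (((continuous_hermiteKernel m t y).comp (by fun_prop : Continuous fun s => (x, s))).mul hψ)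
  have h1 := hasDerivAt_integral_besselMeasure hν
    (F := fun x s => hermiteKernel m t x y s * ψ s)
    (F' := fun x s => (hermiteKernel (m + 1) t x y s - x * hermiteKernel m t x y s) * ψ s)
    ((continuous_hermiteKernel m t y).mul hψ2)
    (((continuous_hermiteKernel (m + 1) t y).sub
      (continuous_fst.mul (continuous_hermiteKernel m t y))).mul hψ2)
    (fun x s => (hasDerivAt_hermiteKernel ht m x y s).mul_const _) x
  have h2 : HasDerivAt (fun x => heatFactor ν t x y) ((ν + 1 / 2) / x * heatFactor ν t x y) x := by
    have hxy : 0 < x * y := by positivity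
    have := (((hasDerivAt_id x).mul_const y).rpow_const (p := ν + 1 / 2)
      (Or.inl hxy.ne')).const_mul (2 * (2 * sinh (2 * t)) ^ (-(ν + 1)))
    refine this.congr_deriv ?_
    simp only [id, heatFactor]
    rw [rpow_sub_one hxy.ne']
    field_simp
  refine (h2.mul h1).congr_deriv ?_
  have e : ∫ s, (hermiteKernel (m + 1) t x y s - x * hermiteKernel m t x y s) * ψ s
      ∂besselMeasure ν = ∫ s, hermiteKernel (m + 1) t x y s * ψ s ∂besselMeasure ν -
        x * ∫ s, hermiteKernel m t x y s * ψ s ∂besselMeasure ν := by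
    rw [← integral_const_mul, ← integral_sub (hi _) ((hi _).const_mul _)]
    congr 1
    funext s
    ring
  rw [e, weightedKernel, weightedKernel]
  ring

theorem iterate_delta₁_weightedKernel {ν t y : ℝ} (hν : -1 / 2 ≤ ν) (ht : 0 < t) (hy : 0 < y)
    {ψ : ℝ → ℝ} (hψ : Continuous ψ) (m : ℕ) :
    EqOn ((delta₁ ν)^[m] (weightedKernel ν ψ 0 t y)) (weightedKernel ν ψ m t y) (Ioi 0) := by
  induction m with
  | zero => exact fun _ _ => rfl
  | succ m ih =>
    rw [Function.iterate_succ_apply']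
    refine (delta₁_congr ih).trans fun x hx => ?_
    rw [delta₁, (hasDerivAt_weightedKernel hν ht hx hy hψ m).deriv]
    ring

theorem contDiffOn_weightedKernel {ν t y : ℝ} (hν : -1 / 2 ≤ ν) (ht : 0 < t) (hy : 0 < y)
    {ψ : ℝ → ℝ} (hψ : Continuous ψ) (m : ℕ) :
    ContDiffOn ℝ ∞ (weightedKernel ν ψ m t y) (Ioi 0) := by
  rw [contDiffOn_infty]
  intro n
  induction n generalizing m with
  | zero =>
    exact contDiffOn_zero.2 fun x hx =>
      (hasDerivAt_weightedKernel hν ht hx hy hψ m).continuousAt.continuousWithinAt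
  | succ n ih =>
    rw [show ((n + 1 : ℕ) : WithTop ℕ∞) = (n : WithTop ℕ∞) + 1 by norm_cast,
      contDiffOn_succ_iff_deriv_of_isOpen isOpen_Ioi]
    refine ⟨fun x hx => (hasDerivAt_weightedKernel hν ht hx hy hψ
      m).differentiableAt.differentiableWithinAt, by simp, ?_⟩
    have hq : ContDiffOn ℝ n (fun x : ℝ => x - (ν + 1 / 2) / x) (Ioi 0) :=
      contDiffOn_id.sub (contDiffOn_const.div contDiffOn_id fun x hx => (mem_Ioi.1 hx).ne')
    exact ((ih (m + 1)).sub (hq.mul (ih m))).congr fun x hx =>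
      (hasDerivAt_weightedKernel hν ht hx hy hψ m).deriv

theorem heatKernel₁_eqOn {ν t y : ℝ} (hν : -1 / 2 ≤ ν) (ht : 0 < t) (hy : 0 < y) :
    EqOn (fun z => heatKernel₁ ν t z y) (weightedKernel ν (fun _ => 1) 0 t y) (Ioi 0) := by
  intro x hx
  simp only [heatKernel₁_eq hν ht hx hy, weightedKernel, hermiteKernel_zero, mul_one]

theorem heatKernel₁_sub_eqOn {ν t y : ℝ} (hν : -1 / 2 ≤ ν) (ht : 0 < t) (hy : 0 < y) :
    EqOn (fun z => heatKernel₁ ν t z y - heatKernel₁ (ν + 1) t z y)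
      (weightedKernel ν (fun s => 1 - s) 0 t y) (Ioi 0) := by
  intro x hx
  simp only [heatKernel₁_sub_add_one_eq hν ht hx hy, weightedKernel, hermiteKernel_zero]

theorem contDiffOn_heatKernel₁ {ν t y : ℝ} (hν : -1 / 2 ≤ ν) (ht : 0 < t) (hy : 0 < y) :
    ContDiffOn ℝ ∞ (fun z => heatKernel₁ ν t z y) (Ioi 0) :=
  (contDiffOn_weightedKernel hν ht hy continuous_const 0).congr (heatKernel₁_eqOn hν ht hy)

theorem iterate_delta₁_heatKernel₁ {ν t x y : ℝ} (hν : -1 / 2 ≤ ν) (ht : 0 < t) (hx : 0 < x)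
    (hy : 0 < y) (m : ℕ) :
    (delta₁ ν)^[m] (fun z => heatKernel₁ ν t z y) x = weightedKernel ν (fun _ => 1) m t y x :=
  ((iterate_delta₁_congr (heatKernel₁_eqOn hν ht hy) m).trans
    (iterate_delta₁_weightedKernel hν ht hy continuous_const m)) hx

theorem iterate_delta₁_heatKernel₁_sub {ν t x y : ℝ} (hν : -1 / 2 ≤ ν) (ht : 0 < t) (hx : 0 < x)
    (hy : 0 < y) (m : ℕ) :
    (delta₁ ν)^[m] (fun z => heatKernel₁ ν t z y - heatKernel₁ (ν + 1) t z y) x =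
      weightedKernel ν (fun s => 1 - s) m t y x :=
  ((iterate_delta₁_congr (heatKernel₁_sub_eqOn hν ht hy) m).trans
    (iterate_delta₁_weightedKernel hν ht hy (by fun_prop) m)) hx

/-! ### Elementary inequalities for hyperbolic functions -/

theorem two_mul_le_sinh {t : ℝ} (ht : 0 < t) : 2 * t ≤ sinh (2 * t) :=
  self_le_sinh_iff.2 (by linarith)

theorem sinh_two_mul_pos {t : ℝ} (ht : 0 < t) : 0 < sinh (2 * t) := sinh_pos_iff.2 (by linarith)

theorem tanh_eq_div (t : ℝ) : tanh t = (exp (2 * t) - 1) / (exp (2 * t) + 1) := by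
  have h : exp (2 * t) = exp t * exp t := by rw [← exp_add]; ring_nf
  have := exp_pos t
  rw [tanh_eq, exp_neg, h]
  field_simp

theorem div_one_add_le_tanh {t : ℝ} (ht : 0 < t) : t / (1 + t) ≤ tanh t := by
  have h := add_one_le_exp (2 * t)
  rw [tanh_eq_div, div_le_div_iff₀ (by positivity) (by positivity)]
  nlinarith

theorem tanh_nonneg {t : ℝ} (ht : 0 < t) : 0 ≤ tanh t :=
  le_trans (by positivity) (div_one_add_le_tanh ht)

theorem tanh_le_one (t : ℝ) : tanh t ≤ 1 := (tanh_lt_one t).le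

theorem mul_sq_one_sub_tanh_le {t : ℝ} (ht : 0 < t) : t * (1 - tanh t) ^ 2 ≤ tanh t := by
  have h := add_one_le_exp (2 * t)
  have h1 : t * (1 - tanh t) ≤ tanh t := by
    rw [tanh_eq_div]
    have : 0 < exp (2 * t) + 1 := by positivity
    rw [one_sub_div this.ne', ← mul_div_assoc]
    gcongr
    nlinarith
  have h2 : 0 ≤ 1 - tanh t := by linarith [tanh_le_one t]
  nlinarith [mul_nonneg ht.le h2, tanh_nonneg ht]

theorem cosh_div_sinh_eq {t : ℝ} (ht : 0 < t) :
    cosh (2 * t) / sinh (2 * t) = 1 / sinh (2 * t) + tanh t := by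
  have hS := sinh_two_mul_pos ht
  have hc := cosh_pos t
  rw [tanh_eq_sinh_div_cosh]
  rw [div_add_div _ _ hS.ne' hc.ne', div_eq_div_iff hS.ne' (by positivity)]
  rw [cosh_two_mul, sinh_two_mul]
  have := cosh_sq t
  linear_combination (2 * sinh t * cosh t ^ 2) * this

theorem rate_le {t : ℝ} (ht : 0 < t) : rate t ≤ 1 / t := by
  have hS := sinh_two_mul_pos ht
  have : 1 / sinh (2 * t) ≤ 1 / t :=
    one_div_le_one_div_of_le ht (by linarith [two_mul_le_sinh ht])
  rw [rate, cosh_div_sinh_eq ht]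
  linarith [tanh_le_one t]

theorem sinh_two_mul_le {t : ℝ} (ht : 0 < t) (ht1 : t ≤ 1) : sinh (2 * t) ≤ 16 * t := by
  have h1 : exp (-(2 * t)) = exp (2 * t) * exp (-(4 * t)) := by rw [← exp_add]; ring_nf
  have h2 := add_one_le_exp (-(4 * t))
  have h3 : exp (2 * t) ≤ 8 := by
    have : exp (2 * t) ≤ exp 1 * exp 1 := by rw [← exp_add]; exact exp_le_exp.2 (by linarith)
    have h4 := exp_one_lt_d9
    nlinarith [exp_pos 1]
  rw [sinh_eq, h1]
  nlinarith [exp_pos (2 * t)]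

/-- The decay of the kernel in time; `e^{-t}` up to the factor `1 + t` is what the spectral gap
gives in dimension one when `ν = -1/2`. -/
theorem one_div_sqrt_sinh_le {t : ℝ} (ht : 0 < t) :
    1 / √(sinh (2 * t)) ≤ 2 * (1 + t) * exp (-t) / √t := by
  have hS := sinh_two_mul_pos ht
  have h1 : t ≤ (2 * (1 + t) * exp (-t)) ^ 2 * sinh (2 * t) := by
    have e1 : exp (-t) ^ 2 * exp (2 * t) = 1 := by
      rw [← exp_nat_mul, ← exp_add]; simp
    have e2 : exp (-(2 * t)) = exp (2 * t) * exp (-(4 * t)) := by rw [← exp_add]; ring_nf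
    have e3 : exp (-(4 * t)) * (1 + 4 * t) ≤ 1 := by
      have := add_one_le_exp (4 * t)
      calc _ ≤ exp (-(4 * t)) * exp (4 * t) := by gcongr; linarith
        _ = 1 := by rw [← exp_add]; simp
    have e4 : (2 * (1 + t) * exp (-t)) ^ 2 * sinh (2 * t) =
        2 * (1 + t) ^ 2 * (1 - exp (-(4 * t))) := by
      rw [sinh_eq, e2]
      linear_combination (2 * (1 + t) ^ 2 * (1 - exp (-(4 * t)))) * e1
    rw [e4]
    have e5 : 4 * t ≤ (1 - exp (-(4 * t))) * (1 + 4 * t) := by linarith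
    have e6 : 0 ≤ 1 - exp (-(4 * t)) := by
      have : exp (-(4 * t)) ≤ 1 := exp_le_one_iff.2 (by linarith)
      linarith
    nlinarith [mul_nonneg e6 ht.le, mul_nonneg e6 (sq_nonneg t)]
  have h2 : √t ≤ 2 * (1 + t) * exp (-t) * √(sinh (2 * t)) := by
    have := sqrt_le_sqrt h1
    rwa [sqrt_mul (sq_nonneg _), sqrt_sq (by positivity)] at this
  rw [div_le_div_iff₀ (sqrt_pos.2 hS) (sqrt_pos.2 ht)]
  linarith

/-! ### The quadratic form in the exponent -/

/-- Twice the value of the phase at `s = 1`. It controls `|x - y|² / t`, `t x²` and `t y²`, up to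
polynomial factors in `t`. -/
def energy (t x y : ℝ) : ℝ := (x - y) ^ 2 / sinh (2 * t) + (x ^ 2 + y ^ 2) * tanh t

theorem energy_nonneg {t : ℝ} (ht : 0 < t) (x y : ℝ) : 0 ≤ energy t x y := by
  have := sinh_two_mul_pos ht
  have := tanh_nonneg ht
  unfold energy
  positivity

theorem energy_symm (t x y : ℝ) : energy t x y = energy t y x := by unfold energy; ring

theorem phase_eq {t : ℝ} (ht : 0 < t) (x y s : ℝ) :
    phase t x y s = energy t x y / 2 + x * y / sinh (2 * t) * (1 - s) := by
  have := sinh_two_mul_pos ht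
  rw [phase, energy, cosh_div_sinh_eq ht]
  field_simp
  ring

theorem sq_sub_div_le_energy {t : ℝ} (ht : 0 < t) (x y : ℝ) :
    (x - y) ^ 2 / (16 * t) ≤ energy t x y := by
  have hS := sinh_two_mul_pos ht
  rcases le_total t 1 with h | h
  · have h1 : (x - y) ^ 2 / (16 * t) ≤ (x - y) ^ 2 / sinh (2 * t) :=
      div_le_div_of_nonneg_left (sq_nonneg _) hS (sinh_two_mul_le ht h)
    have := mul_nonneg (add_nonneg (sq_nonneg x) (sq_nonneg y)) (tanh_nonneg ht)
    rw [energy]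
    linarith
  · have h1 : 1 / 2 ≤ tanh t := by
      refine le_trans ?_ (div_one_add_le_tanh ht)
      rw [div_le_div_iff₀ (by norm_num) (by positivity)]
      linarith
    have h2 : (x - y) ^ 2 / (16 * t) ≤ (x - y) ^ 2 / 16 :=
      div_le_div_of_nonneg_left (sq_nonneg _) (by norm_num) (by linarith)
    have h3 : 0 ≤ (x - y) ^ 2 / sinh (2 * t) := by positivity
    rw [energy]
    nlinarith [sq_nonneg (x + y), mul_le_mul_of_nonneg_left h1
      (add_nonneg (sq_nonneg x) (sq_nonneg y))]

theorem mul_sq_le_energy {t : ℝ} (ht : 0 < t) (x y : ℝ) :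
    t * x ^ 2 ≤ (1 + t) * energy t x y := by
  have hS := sinh_two_mul_pos ht
  have h1 := div_one_add_le_tanh ht
  rw [div_le_iff₀ (by positivity)] at h1
  have h2 : x ^ 2 * tanh t ≤ energy t x y := by
    have : 0 ≤ (x - y) ^ 2 / sinh (2 * t) := by positivity
    have := mul_nonneg (sq_nonneg y) (tanh_nonneg ht)
    rw [energy]
    linarith
  nlinarith [sq_nonneg x]

theorem sqrt_mul_le_energy {t : ℝ} (ht : 0 < t) (x y : ℝ) :
    √t * x ≤ (1 + t) * (1 + energy t x y) := by
  have h1 := mul_sq_le_energy ht x y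
  have h2 := sq_sqrt ht.le
  nlinarith [sq_nonneg (√t * x - 1), sq_nonneg (√t * x)]

theorem abs_sub_div_sqrt_le_energy {t : ℝ} (ht : 0 < t) (x y : ℝ) :
    |x - y| / √t ≤ 1 + 16 * energy t x y := by
  have h1 := sq_sub_div_le_energy ht x y
  have h2 : (|x - y| / √t) ^ 2 = 16 * ((x - y) ^ 2 / (16 * t)) := by
    rw [div_pow, sq_abs, sq_sqrt ht.le]; field_simp
  nlinarith [sq_nonneg (|x - y| / √t - 1)]

/-! ### Pointwise bound of the integrand -/

theorem exists_abs_hermite_le (m : ℕ) :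
    ∃ C > 0, ∀ v : ℝ, |Polynomial.aeval v (Polynomial.hermite m)| ≤ C * (1 + |v|) ^ m := by
  refine ⟨1 + ∑ i ∈ Finset.range (m + 1), |((Polynomial.hermite m).coeff i : ℝ)|, by positivity,
    fun v => ?_⟩
  rw [Polynomial.aeval_eq_sum_range, Polynomial.natDegree_hermite, add_mul, Finset.sum_mul]
  refine (Finset.abs_sum_le_sum_abs _ _).trans ?_
  refine le_trans (Finset.sum_le_sum fun i hi => ?_) (le_add_of_nonneg_left (by positivity))
  rw [zsmul_eq_mul, abs_mul, abs_pow]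
  have hi' : i ≤ m := by simpa [Nat.lt_succ_iff] using hi
  have h1 : 1 ≤ 1 + |v| := by linarith [abs_nonneg v]
  gcongr
  calc |v| ^ i ≤ (1 + |v|) ^ i := by gcongr; linarith
    _ ≤ (1 + |v|) ^ m := pow_le_pow_right₀ h1 hi'

theorem phase_nonneg {t x y s : ℝ} (ht : 0 < t) (hx : 0 < x) (hy : 0 < y) (hs : s ∈ Icc (-1) 1) :
    0 ≤ phase t x y s := by
  have hS := sinh_two_mul_pos ht
  rw [phase_eq ht]
  have h1 := energy_nonneg ht x y
  have h2 : 0 ≤ 1 - s := by linarith [hs.2]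
  positivity

/-- The argument of the Hermite polynomial is controlled by the phase itself, uniformly in all
parameters: this is why no case distinction between the regions near and away from the diagonal
is needed. -/
theorem sq_hermiteArg_le {t x y s : ℝ} (ht : 0 < t) (hx : 0 < x) (hy : 0 < y)
    (hs : s ∈ Icc (-1) 1) :
    (y * s / sinh (2 * t) - rate t * x) ^ 2 ≤ 6 * phase t x y s / t := by
  have hS := sinh_two_mul_pos ht
  have hP := phase_nonneg ht hx hy hs
  have hss : s ^ 2 ≤ 1 := by nlinarith [hs.1, hs.2]
  have e : y * s / sinh (2 * t) - rate t * x =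
      (y * s - x) / sinh (2 * t) + x * (1 - tanh t) := by
    rw [rate, cosh_div_sinh_eq ht]; ring
  have h1 : ((y * s - x) / sinh (2 * t)) ^ 2 ≤ phase t x y s / t := by
    have h2 : (y * s - x) ^ 2 ≤ 2 * sinh (2 * t) * phase t x y s := by
      have : 2 * sinh (2 * t) * phase t x y s =
          (x ^ 2 + y ^ 2) * cosh (2 * t) - 2 * (x * y * s) := by
        rw [phase]; field_simp
      rw [this]
      have hc := one_le_cosh (2 * t)
      nlinarith [sq_nonneg x, sq_nonneg y, mul_le_mul_of_nonneg_left hss (sq_nonneg y)]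
    rw [div_pow, div_le_div_iff₀ (by positivity) ht]
    have h3 := two_mul_le_sinh ht
    calc (y * s - x) ^ 2 * t ≤ (2 * sinh (2 * t) * phase t x y s) * t := by gcongr
      _ = phase t x y s * sinh (2 * t) * (2 * t) := by ring
      _ ≤ phase t x y s * sinh (2 * t) * sinh (2 * t) := by gcongr
      _ = _ := by ring
  have h4 : (x * (1 - tanh t)) ^ 2 ≤ 2 * phase t x y s / t := by
    have h5 : x ^ 2 * tanh t ≤ 2 * phase t x y s := by
      have h6 : 0 ≤ 1 - s := by linarith [hs.2]
      have h7 : 0 ≤ x * y / sinh (2 * t) * (1 - s) := by positivity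
      have h8 : 0 ≤ (x - y) ^ 2 / sinh (2 * t) := by positivity
      have h9 := mul_nonneg (sq_nonneg y) (tanh_nonneg ht)
      rw [phase_eq ht, energy]
      linarith
    rw [mul_pow, le_div_iff₀ ht]
    nlinarith [mul_sq_one_sub_tanh_le ht, sq_nonneg x]
  rw [e]
  calc _ ≤ 2 * ((y * s - x) / sinh (2 * t)) ^ 2 + 2 * (x * (1 - tanh t)) ^ 2 := by
        nlinarith [sq_nonneg ((y * s - x) / sinh (2 * t) - x * (1 - tanh t))]
    _ ≤ 2 * (phase t x y s / t) + 2 * (2 * phase t x y s / t) := by gcongr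
    _ = _ := by ring

theorem exists_abs_hermiteKernel_le (m : ℕ) :
    ∃ C > 0, ∀ t x y s : ℝ, 0 < t → 0 < x → 0 < y → s ∈ Icc (-1 : ℝ) 1 →
      |hermiteKernel m t x y s| ≤ C / √t ^ m * exp (-phase t x y s / 2) := by
  obtain ⟨C₁, hC₁, h₁⟩ := exists_abs_hermite_le m
  obtain ⟨C₂, hC₂, h₂⟩ := exists_one_add_rpow_mul_exp_le m (c := 1 / 2) (by norm_num)
  refine ⟨C₁ * 5 ^ m * C₂, by positivity, fun t x y s ht hx hy hs => ?_⟩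
  have hP := phase_nonneg ht hx hy hs
  set P := phase t x y s
  have hst : 0 < √t := sqrt_pos.2 ht
  have ha := rate_pos ht
  have hsa : 0 < √(rate t) := sqrt_pos.2 ha
  have h3 : √(rate t) ≤ 1 / √t := by
    rw [← sqrt_one, ← sqrt_div zero_le_one]
    exact sqrt_le_sqrt (rate_le ht)
  have h4 : √(rate t) * |hermiteArg t x y s| ≤ (1 + 3 * P) / √t := by
    rw [hermiteArg, abs_div, abs_of_pos hsa, mul_div_cancel₀ _ hsa.ne']
    refine abs_le_of_sq_le_sq ?_ (by positivity)
    refine (sq_hermiteArg_le ht hx hy hs).trans ?_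
    rw [div_pow, sq_sqrt ht.le]
    gcongr
    nlinarith
  have h5 : √(rate t) * (1 + |hermiteArg t x y s|) ≤ 5 * (1 + P) / √t := by
    calc _ = √(rate t) + √(rate t) * |hermiteArg t x y s| := by ring
      _ ≤ 1 / √t + (1 + 3 * P) / √t := by gcongr
      _ = (2 + 3 * P) / √t := by ring
      _ ≤ _ := by gcongr; linarith
  have h6 := h₂ P hP
  rw [rpow_natCast] at h6
  rw [hermiteKernel, abs_mul, abs_mul, abs_of_pos (exp_pos _), abs_of_pos (pow_pos hsa _)]
  calc √(rate t) ^ m * |Polynomial.aeval (hermiteArg t x y s) (Polynomial.hermite m)| * exp (-P)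
      ≤ √(rate t) ^ m * (C₁ * (1 + |hermiteArg t x y s|) ^ m) * exp (-P) := by
        gcongr; exact h₁ _
    _ = C₁ * (√(rate t) * (1 + |hermiteArg t x y s|)) ^ m * exp (-P) := by rw [mul_pow]; ring
    _ ≤ C₁ * (5 * (1 + P) / √t) ^ m * exp (-P) := by gcongr
    _ = C₁ * 5 ^ m / √t ^ m * ((1 + P) ^ m * exp (-(1 / 2 * P))) * exp (-P / 2) := by
        rw [div_pow, mul_pow, show -P = -(1 / 2 * P) + -P / 2 by ring, exp_add]; ring_nf
    _ ≤ C₁ * 5 ^ m / √t ^ m * C₂ * exp (-P / 2) := by gcongr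
    _ = _ := by ring

/-! ### The uniform bound of the kernel and its derivatives -/

theorem heatFactor_eq {ν t x y : ℝ} (ht : 0 < t) (hx : 0 < x) (hy : 0 < y) :
    heatFactor ν t x y = 2 * 2 ^ (-(ν + 1)) * (1 / √(sinh (2 * t)) *
      (x * y / sinh (2 * t)) ^ (ν + 1 / 2)) := by
  have hS := sinh_two_mul_pos ht
  rw [heatFactor, mul_rpow (by norm_num) hS.le, div_rpow (by positivity) hS.le, sqrt_eq_rpow,
    show -(ν + 1) = -(ν + 1 / 2) - 1 / 2 by ring, rpow_sub hS, rpow_neg hS.le (ν + 1 / 2)]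
  field_simp

theorem exists_abs_weightedKernel_le {ν : ℝ} (hν : -1 / 2 ≤ ν) (m : ℕ) :
    ∃ C > 0, ∀ (t x y : ℝ) (ψ : ℝ → ℝ) (B : ℝ), 0 < t → 0 < x → 0 < y →
      (∀ s ∈ Icc (-1 : ℝ) 1, |ψ s| * exp (-(x * y / sinh (2 * t) * (1 - s) / 4)) ≤ B) →
      |weightedKernel ν ψ m t y x| ≤ C * B / √t ^ m * (1 / √(sinh (2 * t)) *
        min 1 (x * y / sinh (2 * t)) ^ (ν + 1 / 2) * exp (-(energy t x y / 8))) := by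
  obtain ⟨C₁, hC₁, h₁⟩ := exists_abs_hermiteKernel_le m
  obtain ⟨C₂, hC₂, h₂⟩ := exists_integral_exp_besselMeasure_le hν
  refine ⟨2 * 2 ^ (-(ν + 1)) * C₁ * C₂, by positivity, fun t x y ψ B ht hx hy hψ => ?_⟩
  have hS := sinh_two_mul_pos ht
  have hst : 0 < √t := sqrt_pos.2 ht
  have hE := energy_nonneg ht x y
  have hB : 0 ≤ B := le_trans (by positivity) (hψ 0 (by norm_num))
  set z := x * y / sinh (2 * t) with hz
  have hz0 : 0 < z := by positivity
  have hfac : 0 ≤ heatFactor ν t x y := by rw [heatFactor_eq ht hx hy]; positivity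
  have h3 : |∫ s, hermiteKernel m t x y s * ψ s ∂besselMeasure ν| ≤
      C₁ * B / √t ^ m * exp (-(energy t x y / 8)) *
        ∫ s, exp (-(z * (1 - s) / 4)) ∂besselMeasure ν := by
    rw [← integral_const_mul, ← norm_eq_abs]
    refine norm_integral_le_of_norm_le
      (integrable_of_continuous_besselMeasure hν (by fun_prop)) ?_
    filter_upwards [ae_besselMeasure_mem_Icc ν] with s hs
    rw [norm_mul, norm_eq_abs, norm_eq_abs]
    have e : exp (-phase t x y s / 2) ≤ exp (-(energy t x y / 8)) *
        (exp (-(z * (1 - s) / 4)) * exp (-(z * (1 - s) / 4))) := by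
      rw [← exp_add, ← exp_add, phase_eq ht]
      refine exp_le_exp.2 ?_
      rw [← hz]
      linarith
    calc |hermiteKernel m t x y s| * |ψ s|
        ≤ (C₁ / √t ^ m * (exp (-(energy t x y / 8)) *
          (exp (-(z * (1 - s) / 4)) * exp (-(z * (1 - s) / 4))))) * |ψ s| := by
          gcongr
          exact (h₁ t x y s ht hx hy hs).trans (by gcongr)
      _ = C₁ / √t ^ m * exp (-(energy t x y / 8)) * exp (-(z * (1 - s) / 4)) *
          (|ψ s| * exp (-(z * (1 - s) / 4))) := by ring
      _ ≤ C₁ / √t ^ m * exp (-(energy t x y / 8)) * exp (-(z * (1 - s) / 4)) * B := by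
          gcongr; exact hψ s hs
      _ = _ := by ring
  rw [weightedKernel, abs_mul, abs_of_nonneg hfac]
  calc _ ≤ heatFactor ν t x y * (C₁ * B / √t ^ m * exp (-(energy t x y / 8)) *
        ∫ s, exp (-(z * (1 - s) / 4)) ∂besselMeasure ν) := by gcongr
    _ = 2 * 2 ^ (-(ν + 1)) * C₁ * B / √t ^ m * (1 / √(sinh (2 * t))) *
        exp (-(energy t x y / 8)) *
        (z ^ (ν + 1 / 2) * ∫ s, exp (-(z * (1 - s) / 4)) ∂besselMeasure ν) := by
        rw [heatFactor_eq ht hx hy, ← hz]; ring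
    _ ≤ 2 * 2 ^ (-(ν + 1)) * C₁ * B / √t ^ m * (1 / √(sinh (2 * t))) *
        exp (-(energy t x y / 8)) * (C₂ * min 1 z ^ (ν + 1 / 2)) :=
        mul_le_mul_of_nonneg_left (h₂ z hz0) (by positivity)
    _ = _ := by ring

theorem min_mul_sqrt_div_le {t x y : ℝ} (ht : 0 < t) (hx : 0 < x) (hy : 0 < y) :
    min 1 (x * y / sinh (2 * t)) * (√t / x) ≤ 2 + energy t x y := by
  have hS := sinh_two_mul_pos ht
  have hsS := sqrt_pos.2 hS
  have hE := energy_nonneg ht x y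
  have hts : √t ≤ √(sinh (2 * t)) := sqrt_le_sqrt (by linarith [two_mul_le_sinh ht])
  have hSS := mul_self_sqrt hS.le
  rcases le_total (√(sinh (2 * t))) x with h | h
  · have h1 : √t / x ≤ 1 := (div_le_one hx).2 (hts.trans h)
    have h2 := mul_le_mul (min_le_left 1 (x * y / sinh (2 * t))) h1 (by positivity) zero_le_one
    linarith
  · have h2 : (x - y) ^ 2 / sinh (2 * t) ≤ energy t x y := by
      rw [energy]
      have := mul_nonneg (add_nonneg (sq_nonneg x) (sq_nonneg y)) (tanh_nonneg ht)
      linarith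
    calc _ ≤ x * y / sinh (2 * t) * (√t / x) := by gcongr; exact min_le_right _ _
      _ = y * √t / sinh (2 * t) := by field_simp
      _ ≤ y * √(sinh (2 * t)) / sinh (2 * t) := by gcongr
      _ = y / √(sinh (2 * t)) := by
          rw [div_eq_div_iff hS.ne' hsS.ne', mul_assoc, hSS]
      _ ≤ (√(sinh (2 * t)) + |x - y|) / √(sinh (2 * t)) := by
          gcongr
          linarith [neg_abs_le (x - y)]
      _ = 1 + |x - y| / √(sinh (2 * t)) := by rw [add_div, div_self hsS.ne']
      _ ≤ 1 + (1 + (|x - y| / √(sinh (2 * t))) ^ 2) := by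
          nlinarith [sq_nonneg (|x - y| / √(sinh (2 * t)) - 1)]
      _ = 2 + (x - y) ^ 2 / sinh (2 * t) := by rw [div_pow, sq_abs, sq_sqrt hS.le]; ring
      _ ≤ _ := by linarith

theorem rho₁_pos (ν : ℝ) {x : ℝ} (hx : 0 < x) : 0 < rho₁ ν x := by
  have : 0 < x⁻¹ := inv_pos.2 hx
  unfold rho₁
  split_ifs
  · exact mul_pos (by norm_num) (lt_min one_pos this)
  · exact mul_pos (by norm_num) (lt_min hx this)

theorem one_div_rho₁_of_eq {x : ℝ} (hx : 0 < x) : 1 / rho₁ (-1 / 2) x = 16 * max 1 x := by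
  have : 0 < x⁻¹ := inv_pos.2 hx
  rw [rho₁, if_pos rfl]
  rcases le_total 1 x with h | h
  · rw [max_eq_right h, min_eq_right (inv_le_one_of_one_le₀ h)]; field_simp
  · rw [max_eq_left h, min_eq_left ((one_le_inv₀ hx).2 h)]; norm_num

theorem one_div_rho₁_of_lt {ν x : ℝ} (hν : -1 / 2 < ν) (hx : 0 < x) :
    1 / rho₁ ν x = 16 * max x x⁻¹ := by
  have : 0 < x⁻¹ := inv_pos.2 hx
  rw [rho₁, if_neg hν.ne']
  rcases le_total x⁻¹ x with h | h
  · rw [max_eq_left h, min_eq_right h]; field_simp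
  · rw [max_eq_right h, min_eq_left h]; field_simp

theorem one_le_decay₁ {ν t x y : ℝ} (hx : 0 < x) (hy : 0 < y) : 1 ≤ decay₁ ν t x y := by
  have h1 := rho₁_pos ν hx
  have h2 := rho₁_pos ν hy
  have h3 : 0 ≤ √t / rho₁ ν x := by positivity
  have h4 : 0 ≤ √t / rho₁ ν y := by positivity
  rw [decay₁]
  linarith

theorem sqrt_le_one_add {t : ℝ} (ht : 0 < t) : √t ≤ 1 + t := by
  have := sq_sqrt ht.le
  nlinarith [sq_nonneg (√t - 1), sqrt_nonneg t]

theorem decay₁_le_of_eq {t x y : ℝ} (ht : 0 < t) (hx : 0 < x) (hy : 0 < y) :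
    decay₁ (-1 / 2) t x y ≤ 97 * ((1 + t) * (1 + energy t x y)) := by
  have hE := energy_nonneg ht x y
  have h1 := sqrt_mul_le_energy ht x y
  have h2 := sqrt_mul_le_energy ht y x
  rw [energy_symm] at h2
  have h3 := sqrt_le_one_add ht
  have h5 : ∀ w : ℝ, 0 < w → √t / rho₁ (-1 / 2) w ≤ 16 * (√t + √t * w) := by
    intro w hw
    rw [div_eq_mul_one_div, one_div_rho₁_of_eq hw]
    have : max 1 w ≤ 1 + w := max_le (by linarith) (by linarith)
    nlinarith [sqrt_nonneg t, mul_le_mul_of_nonneg_left this (sqrt_nonneg t)]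
  rw [decay₁]
  have h6 := h5 x hx
  have h7 := h5 y hy
  nlinarith [mul_nonneg ht.le hE]

theorem min_mul_decay₁_le {ν t x y : ℝ} (hν : -1 / 2 < ν) (ht : 0 < t) (hx : 0 < x) (hy : 0 < y) :
    min 1 (x * y / sinh (2 * t)) * decay₁ ν t x y ≤ 97 * ((1 + t) * (1 + energy t x y)) := by
  have hS := sinh_two_mul_pos ht
  have hE := energy_nonneg ht x y
  have h1 := sqrt_mul_le_energy ht x y
  have h2 := sqrt_mul_le_energy ht y x
  rw [energy_symm] at h2
  have h3 := min_mul_sqrt_div_le ht hx hy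
  have h4 := min_mul_sqrt_div_le ht hy hx
  rw [energy_symm, mul_comm y x] at h4
  set μ := min 1 (x * y / sinh (2 * t)) with hμ
  have hμ0 : 0 ≤ μ := le_min zero_le_one (by positivity)
  have hμ1 : μ ≤ 1 := min_le_left _ _
  have h5 : ∀ w : ℝ, 0 < w → √t / rho₁ ν w ≤ 16 * (√t * w + √t / w) := by
    intro w hw
    rw [div_eq_mul_one_div, one_div_rho₁_of_lt hν hw, div_eq_mul_inv]
    have : max w w⁻¹ ≤ w + w⁻¹ := max_le (by linarith [inv_pos.2 hw]) (by linarith)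
    nlinarith [sqrt_nonneg t, mul_le_mul_of_nonneg_left this (sqrt_nonneg t)]
  have h6 : ∀ w : ℝ, 0 < w → √t * w ≤ (1 + t) * (1 + energy t x y) →
      μ * (√t / w) ≤ 2 + energy t x y →
      μ * (√t / rho₁ ν w) ≤ 48 * ((1 + t) * (1 + energy t x y)) := by
    intro w hw a b
    have c := mul_le_mul_of_nonneg_left (h5 w hw) hμ0
    have d : μ * (√t * w) ≤ 1 * (√t * w) := by gcongr
    nlinarith [mul_nonneg ht.le hE]
  have h7 := h6 x hx h1 h3
  have h8 := h6 y hy h2 h4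
  rw [decay₁]
  nlinarith [mul_nonneg ht.le hE]

/-- `γ` is an admissible exponent of decay in dimension one at the order `ν`: at most `ν + 1/2`,
and arbitrary if `ν = -1/2`. -/
def IsDecayExponent (ν γ : ℝ) : Prop := 0 ≤ γ ∧ (ν = -1 / 2 ∨ -1 / 2 < ν ∧ γ ≤ ν + 1 / 2)

theorem min_rpow_mul_decay₁_rpow_le {ν γ t x y : ℝ} (hγ : IsDecayExponent ν γ) (ht : 0 < t)
    (hx : 0 < x) (hy : 0 < y) :
    min 1 (x * y / sinh (2 * t)) ^ (ν + 1 / 2) * decay₁ ν t x y ^ γ ≤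
      (97 * ((1 + t) * (1 + energy t x y))) ^ γ := by
  have hS := sinh_two_mul_pos ht
  have hD := one_le_decay₁ (ν := ν) (t := t) hx hy
  obtain ⟨hγ0, h | ⟨h, h'⟩⟩ := hγ
  · subst h
    rw [show (-1 / 2 : ℝ) + 1 / 2 = 0 by norm_num, rpow_zero, one_mul]
    exact rpow_le_rpow (by linarith) (decay₁_le_of_eq ht hx hy) hγ0
  · have hμ0 : 0 < min 1 (x * y / sinh (2 * t)) := lt_min one_pos (by positivity)
    calc _ ≤ min 1 (x * y / sinh (2 * t)) ^ γ * decay₁ ν t x y ^ γ :=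
          mul_le_mul_of_nonneg_right (rpow_le_rpow_of_exponent_ge hμ0 (min_le_left _ _) h')
            (by positivity)
      _ = (min 1 (x * y / sinh (2 * t)) * decay₁ ν t x y) ^ γ :=
          (mul_rpow hμ0.le (by linarith)).symm
      _ ≤ _ := rpow_le_rpow (by positivity) (min_mul_decay₁_le h ht hx hy) hγ0

/-- The common majorant of all one-dimensional estimates. The factors `e^{-t/2}` and
`e^{-energy/32}` are left over to absorb powers of `x` and of `t`. -/
def majorant (ν γ : ℝ) (m : ℕ) (t x y : ℝ) : ℝ :=
  exp (-t / 2) / √t ^ (m + 1) * exp (-(energy t x y / 32)) * exp (-|x - y| ^ 2 / (512 * t)) *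
    decay₁ ν t x y ^ (-γ)

theorem exists_abs_weightedKernel_le_majorant {ν γ : ℝ} (hν : -1 / 2 ≤ ν)
    (hγ : IsDecayExponent ν γ) (m : ℕ) :
    ∃ C > 0, ∀ (t x y : ℝ) (ψ : ℝ → ℝ) (B : ℝ), 0 < t → 0 < x → 0 < y →
      (∀ s ∈ Icc (-1 : ℝ) 1, |ψ s| * exp (-(x * y / sinh (2 * t) * (1 - s) / 4)) ≤ B) →
      |weightedKernel ν ψ m t y x| ≤ C * B * majorant ν γ m t x y := by
  obtain ⟨C₁, hC₁, h₁⟩ := exists_abs_weightedKernel_le hν m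
  obtain ⟨C₂, hC₂, h₂⟩ := exists_one_add_rpow_mul_exp_le (1 + γ) (c := 1 / 2) (by norm_num)
  obtain ⟨C₃, hC₃, h₃⟩ := exists_one_add_rpow_mul_exp_le γ (c := 1 / 16) (by norm_num)
  refine ⟨C₁ * (2 * 97 ^ γ * C₂ * C₃), by positivity, fun t x y ψ B ht hx hy hψ => ?_⟩
  refine (h₁ t x y ψ B ht hx hy hψ).trans ?_
  have hB : 0 ≤ B := le_trans (by positivity) (hψ 0 (by norm_num))
  have hS := sinh_two_mul_pos ht
  have hst : 0 < √t := sqrt_pos.2 ht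
  have hE := energy_nonneg ht x y
  have hD := one_le_decay₁ (ν := ν) (t := t) hx hy
  have hDγ : 0 < decay₁ ν t x y ^ γ := rpow_pos_of_pos (by linarith) _
  have h4 := min_rpow_mul_decay₁_rpow_le hγ ht hx hy
  rw [mul_rpow (by norm_num) (by positivity), mul_rpow (by positivity) (by positivity)] at h4
  have h5 : exp (-(energy t x y / 32)) ≤ exp (-|x - y| ^ 2 / (512 * t)) := by
    refine exp_le_exp.2 ?_
    have := sq_sub_div_le_energy ht x y
    rw [sq_abs, neg_div, neg_le_neg_iff]
    calc (x - y) ^ 2 / (512 * t) = (x - y) ^ 2 / (16 * t) / 32 := by field_simp; ring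
      _ ≤ _ := by gcongr
  have h6 : min 1 (x * y / sinh (2 * t)) ^ (ν + 1 / 2) ≤
      97 ^ γ * ((1 + t) ^ γ * (1 + energy t x y) ^ γ) * decay₁ ν t x y ^ (-γ) := by
    rw [rpow_neg (by linarith), ← div_eq_mul_inv, le_div_iff₀ hDγ]
    exact h4
  have h7 : exp (-(energy t x y / 8)) = exp (-(1 / 16 * energy t x y)) *
      (exp (-(energy t x y / 32)) * exp (-(energy t x y / 32))) := by
    rw [← exp_add, ← exp_add]; ring_nf
  have h8 : exp (-t) = exp (-(1 / 2 * t)) * exp (-t / 2) := by rw [← exp_add]; ring_nf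
  have h9 := one_div_sqrt_sinh_le ht
  have hDn : 0 ≤ decay₁ ν t x y ^ (-γ) := by rw [rpow_neg (by linarith)]; positivity
  have h10 := h₂ t ht.le
  rw [rpow_add (by positivity), rpow_one] at h10
  calc C₁ * B / √t ^ m * (1 / √(sinh (2 * t)) *
        min 1 (x * y / sinh (2 * t)) ^ (ν + 1 / 2) * exp (-(energy t x y / 8)))
      ≤ C₁ * B / √t ^ m * (2 * (1 + t) * exp (-t) / √t *
        (97 ^ γ * ((1 + t) ^ γ * (1 + energy t x y) ^ γ) * decay₁ ν t x y ^ (-γ)) *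
        (exp (-(1 / 16 * energy t x y)) *
          (exp (-(energy t x y / 32)) * exp (-|x - y| ^ 2 / (512 * t))))) := by
        rw [h7]; gcongr
    _ = C₁ * (2 * 97 ^ γ * ((1 + t) * (1 + t) ^ γ * exp (-(1 / 2 * t))) *
          ((1 + energy t x y) ^ γ * exp (-(1 / 16 * energy t x y)))) * B *
          majorant ν γ m t x y := by
        rw [h8, majorant]
        field_simp
        ring
    _ ≤ _ := by
        have : 0 ≤ majorant ν γ m t x y := by unfold majorant; positivity
        gcongr
        exact h₃ _ hE

/-! ### The operators `δ_ν` in dimension one -/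

theorem rpow_natCast_div_two {t : ℝ} (ht : 0 < t) (k : ℕ) : t ^ ((k : ℝ) / 2) = √t ^ k := by
  rw [rpow_div_two_eq_sqrt _ ht.le, rpow_natCast]

theorem rpow_natCast_add_one_div_two {t : ℝ} (ht : 0 < t) (k : ℕ) :
    t ^ (((k : ℝ) + 1) / 2) = √t ^ (k + 1) := by
  rw [← rpow_natCast_div_two ht]
  push_cast
  rfl

theorem decay₁_rpow_nonneg {ν t x y γ : ℝ} (hx : 0 < x) (hy : 0 < y) :
    0 ≤ decay₁ ν t x y ^ γ :=
  rpow_nonneg (zero_le_one.trans (one_le_decay₁ hx hy)) _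

theorem majorant_nonneg {ν γ t x y : ℝ} (m : ℕ) (hx : 0 < x) (hy : 0 < y) :
    0 ≤ majorant ν γ m t x y := by
  have := decay₁_rpow_nonneg (ν := ν) (t := t) (γ := -γ) hx hy
  unfold majorant
  positivity

theorem majorant_add (ν γ t x y : ℝ) (i j : ℕ) :
    majorant ν γ (i + j) t x y = majorant ν γ j t x y / √t ^ i := by
  rw [majorant, majorant, add_assoc, pow_add]
  ring

theorem majorant_le {ν γ t x y : ℝ} (m : ℕ) (ht : 0 < t) (hx : 0 < x) (hy : 0 < y) :
    majorant ν γ m t x y ≤ exp (-t / 2) / √t ^ (m + 1) * exp (-|x - y| ^ 2 / (512 * t)) *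
      decay₁ ν t x y ^ (-γ) := by
  have := decay₁_rpow_nonneg (ν := ν) (t := t) (γ := -γ) hx hy
  rw [majorant]
  gcongr
  refine mul_le_of_le_one_right (by positivity) (exp_le_one_iff.2 ?_)
  have := energy_nonneg ht x y
  linarith

/-- The spare exponential factors of the majorant absorb powers of `1 + t` and of `1 + energy`. -/
theorem exists_pow_mul_majorant_le (k : ℕ) : ∃ C > 0, ∀ (ν γ t x y : ℝ) (m : ℕ), 0 < t → 0 < x →
    0 < y → ((1 + t) * (1 + energy t x y)) ^ k * majorant ν γ m t x y ≤
      C * (exp (-t / 4) / √t ^ (m + 1) * exp (-|x - y| ^ 2 / (512 * t)) *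
        decay₁ ν t x y ^ (-γ)) := by
  obtain ⟨C₁, hC₁, h₁⟩ := exists_one_add_rpow_mul_exp_le k (c := 1 / 4) (by norm_num)
  obtain ⟨C₂, hC₂, h₂⟩ := exists_one_add_rpow_mul_exp_le k (c := 1 / 32) (by norm_num)
  refine ⟨C₁ * C₂, by positivity, fun ν γ t x y m ht hx hy => ?_⟩
  have hE := energy_nonneg ht x y
  have hD := decay₁_rpow_nonneg (ν := ν) (t := t) (γ := -γ) hx hy
  have h3 := h₁ t ht.le
  have h4 := h₂ _ hE
  rw [rpow_natCast] at h3 h4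
  have h5 : exp (-t / 2) = exp (-(1 / 4 * t)) * exp (-t / 4) := by rw [← exp_add]; ring_nf
  calc _ = ((1 + t) ^ k * exp (-(1 / 4 * t))) *
        ((1 + energy t x y) ^ k * exp (-(1 / 32 * energy t x y))) *
        (exp (-t / 4) / √t ^ (m + 1) * exp (-|x - y| ^ 2 / (512 * t)) *
        decay₁ ν t x y ^ (-γ)) := by
        rw [majorant, h5, mul_pow, show energy t x y / 32 = 1 / 32 * energy t x y by ring]
        ring
    _ ≤ _ := by gcongr

theorem exists_abs_iterate_delta₁_heatKernel₁_le {ν γ : ℝ} (hν : -1 / 2 ≤ ν)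
    (hγ : IsDecayExponent ν γ) (m : ℕ) :
    ∃ C > 0, ∀ t x y : ℝ, 0 < t → 0 < x → 0 < y →
      |(delta₁ ν)^[m] (fun z => heatKernel₁ ν t z y) x| ≤ C * majorant ν γ m t x y := by
  obtain ⟨C, hC, h⟩ := exists_abs_weightedKernel_le_majorant hν hγ m
  refine ⟨C, hC, fun t x y ht hx hy => ?_⟩
  rw [iterate_delta₁_heatKernel₁ hν ht hx hy]
  refine (h t x y (fun _ => 1) 1 ht hx hy fun s hs => ?_).trans_eq (by rw [mul_one])
  have hS := sinh_two_mul_pos ht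
  have : 0 ≤ 1 - s := by linarith [hs.2]
  rw [abs_one, one_mul, exp_le_one_iff, neg_nonpos]
  positivity

theorem exists_abs_iterate_delta₁_heatKernel₁_sub_le {ν γ : ℝ} (hν : -1 / 2 ≤ ν)
    (hγ : IsDecayExponent ν γ) (m : ℕ) :
    ∃ C > 0, ∀ t x y : ℝ, 0 < t → 0 < x → 0 < y →
      |(delta₁ ν)^[m] (fun z => heatKernel₁ ν t z y - heatKernel₁ (ν + 1) t z y) x| ≤
        C * (sinh (2 * t) / (x * y)) * majorant ν γ m t x y := by
  obtain ⟨C, hC, h⟩ := exists_abs_weightedKernel_le_majorant hν hγ m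
  refine ⟨C * 4, by positivity, fun t x y ht hx hy => ?_⟩
  have hS := sinh_two_mul_pos ht
  rw [iterate_delta₁_heatKernel₁_sub hν ht hx hy]
  refine (h t x y (fun s => 1 - s) (4 * (sinh (2 * t) / (x * y))) ht hx hy
    fun s hs => ?_).trans_eq (by ring)
  have h1 : 0 ≤ 1 - s := by linarith [hs.2]
  -- `w e^{-w/4} ≤ 4` for `w = (xy / sinh 2t) (1 - s)`
  set w := x * y / sinh (2 * t) * (1 - s) with hw
  have h2 : w / 4 ≤ exp (w / 4) := by linarith [add_one_le_exp (w / 4)]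
  have h3 : w * exp (-(w / 4)) ≤ 4 := by
    rw [exp_neg, ← div_eq_mul_inv, div_le_iff₀ (exp_pos _)]
    linarith
  rw [abs_of_nonneg h1]
  calc (1 - s) * exp (-(w / 4)) = (sinh (2 * t) / (x * y)) * (w * exp (-(w / 4))) := by
        rw [hw]; field_simp
    _ ≤ (sinh (2 * t) / (x * y)) * 4 := by gcongr
    _ = _ := by ring

/-! ### Ordinary derivatives in terms of the operators `δ_ν` -/

theorem iterate_deriv_congr {f g : ℝ → ℝ} (h : EqOn f g (Ioi 0)) (k : ℕ) :
    EqOn (deriv^[k] f) (deriv^[k] g) (Ioi 0) := by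
  induction k with
  | zero => exact h
  | succ k ih =>
    simp only [Function.iterate_succ_apply']
    intro x hx
    exact (ih.eventuallyEq_of_mem (Ioi_mem_nhds hx)).deriv_eq

theorem iterate_deriv_const_mul_add {f g : ℝ → ℝ} (hf : ContDiffOn ℝ ∞ f (Ioi 0))
    (hg : ContDiffOn ℝ ∞ g (Ioi 0)) (a : ℝ) (k : ℕ) :
    EqOn (deriv^[k] fun x => a * f x + g x) (fun x => a * deriv^[k] f x + deriv^[k] g x)
      (Ioi 0) := by
  induction k with
  | zero => exact fun _ _ => rfl
  | succ k ih =>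
    simp only [Function.iterate_succ_apply']
    intro x hx
    rw [(ih.eventuallyEq_of_mem (Ioi_mem_nhds hx)).deriv_eq]
    have h1 := ((contDiffOn_iterate_deriv hf k).differentiableOn (by simp)).differentiableAt
      (Ioi_mem_nhds hx)
    have h2 := ((contDiffOn_iterate_deriv hg k).differentiableOn (by simp)).differentiableAt
      (Ioi_mem_nhds hx)
    exact ((h1.hasDerivAt.const_mul a).add h2.hasDerivAt).deriv

theorem contDiffOn_zpow_mul {f : ℝ → ℝ} (hf : ContDiffOn ℝ ∞ f (Ioi 0)) (p : ℤ) :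
    ContDiffOn ℝ ∞ (fun x => x ^ p * f x) (Ioi 0) := by
  refine ContDiffOn.mul (fun x hx => ?_) hf
  exact ((analyticAt_id (𝕜 := ℝ)).zpow (n := p)
    (mem_Ioi.1 hx).ne').contDiffAt.contDiffWithinAt

/-- The commutation rule behind the expansion of `∂^k` in the powers of `δ_ν`. -/
theorem deriv_zpow_mul_eqOn (ν : ℝ) {f : ℝ → ℝ} (hf : ContDiffOn ℝ ∞ f (Ioi 0)) (p : ℤ) :
    EqOn (deriv fun x => x ^ p * f x)
      (fun x => (p + ν + 1 / 2) * (x ^ (p - 1) * f x) +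
        (-1 * (x ^ (p + 1) * f x) + x ^ p * delta₁ ν f x)) (Ioi 0) := by
  intro x hx
  have hx0 : x ≠ 0 := (mem_Ioi.1 hx).ne'
  have h1 := ((hf.differentiableOn (by simp)).differentiableAt (Ioi_mem_nhds hx)).hasDerivAt
  refine ((hasDerivAt_zpow p x (Or.inl hx0)).mul h1).deriv.trans ?_
  simp only [delta₁]
  rw [zpow_sub_one₀ hx0, zpow_add_one₀ hx0]
  field_simp
  ring

/-- Expansion of `∂^k` in the powers of `δ_ν`, as an estimate: the coefficient of `δ_ν^i` is a
Laurent polynomial in `x` of size at most `w ^ (k - i)`. The predicate `P` singles out the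
exponents that can occur: all integers in general, only nonnegative ones if `ν = -1/2`. -/
theorem exists_abs_iterate_deriv_zpow_mul_le {ν : ℝ} {P : ℤ → Prop} {w : ℝ → ℝ}
    (hw : ∀ x, 0 < x → 1 ≤ w x) (hP : ∀ p, P p → P (p + 1))
    (hP' : ∀ p, P p → (p : ℝ) + ν + 1 / 2 ≠ 0 → P (p - 1))
    (hPw : ∀ p, P p → ∀ x, 0 < x → x ^ p ≤ w x ^ p.natAbs) (k : ℕ) :
    ∀ p, P p → ∃ C > 0, ∀ f : ℝ → ℝ, ContDiffOn ℝ ∞ f (Ioi 0) → ∀ x M : ℝ, 0 < x →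
      (∀ i ≤ k, w x ^ (k - i) * |(delta₁ ν)^[i] f x| ≤ M) →
      |deriv^[k] (fun z => z ^ p * f z) x| ≤ C * (w x ^ p.natAbs * M) := by
  induction k with
  | zero =>
    intro p hp
    refine ⟨1, one_pos, fun f _ x M hx hM => ?_⟩
    have h1 := hM 0 le_rfl
    simp only [Nat.sub_self, pow_zero, one_mul, Function.iterate_zero, id] at h1 ⊢
    rw [abs_mul, abs_of_pos (zpow_pos hx p)]
    exact mul_le_mul (hPw p hp x hx) h1 (abs_nonneg _)
      (pow_nonneg (zero_le_one.trans (hw x hx)) _)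
  | succ k ih =>
    intro p hp
    obtain ⟨C₁, hC₁, h₁⟩ : ∃ C > 0, ∀ f : ℝ → ℝ, ContDiffOn ℝ ∞ f (Ioi 0) → ∀ x M : ℝ, 0 < x →
        (∀ i ≤ k, w x ^ (k - i) * |(delta₁ ν)^[i] f x| ≤ M) →
        |((p : ℝ) + ν + 1 / 2) * deriv^[k] (fun z => z ^ (p - 1) * f z) x| ≤
          C * (w x ^ (p.natAbs + 1) * M) := by
      by_cases h0 : (p : ℝ) + ν + 1 / 2 = 0
      · refine ⟨1, one_pos, fun f _ x M hx hM => ?_⟩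
        have hw1 := zero_le_one.trans (hw x hx)
        have hM0 : 0 ≤ M := le_trans (by positivity) (hM 0 (Nat.zero_le _))
        rw [h0, zero_mul, abs_zero]
        positivity
      · obtain ⟨C, hC, h⟩ := ih (p - 1) (hP' p hp h0)
        refine ⟨|(p : ℝ) + ν + 1 / 2| * C, by positivity, fun f hf x M hx hM => ?_⟩
        have hw1 := zero_le_one.trans (hw x hx)
        have hM0 : 0 ≤ M := le_trans (by positivity) (hM 0 (Nat.zero_le _))
        rw [abs_mul, mul_assoc]
        gcongr
        refine (h f hf x M hx hM).trans ?_
        gcongr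
        · exact hw x hx
        · omega
    obtain ⟨C₂, hC₂, h₂⟩ := ih (p + 1) (hP p hp)
    obtain ⟨C₃, hC₃, h₃⟩ := ih p hp
    refine ⟨C₁ + C₂ + C₃, by positivity, fun f hf x M hx hM => ?_⟩
    have hw1 := hw x hx
    have hw0 : 0 < w x := one_pos.trans_le hw1
    have hM0 : 0 ≤ M := le_trans (by positivity) (hM 0 (Nat.zero_le _))
    have hδ := contDiffOn_delta₁ (ν := ν) hf
    have hMf : ∀ i ≤ k, w x ^ (k - i) * |(delta₁ ν)^[i] f x| ≤ M / w x := by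
      intro i hi
      rw [le_div_iff₀ hw0]
      refine le_trans (le_of_eq ?_) (hM i (by omega))
      rw [Nat.succ_sub hi, pow_succ]
      ring
    have hMδ : ∀ i ≤ k, w x ^ (k - i) * |(delta₁ ν)^[i] (delta₁ ν f) x| ≤ M := by
      intro i hi
      have := hM (i + 1) (by omega)
      rwa [Nat.add_sub_add_right, Function.iterate_succ_apply] at this
    have e : deriv^[k + 1] (fun z => z ^ p * f z) x =
        (p + ν + 1 / 2) * deriv^[k] (fun z => z ^ (p - 1) * f z) x +
        (-1 * deriv^[k] (fun z => z ^ (p + 1) * f z) x +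
          deriv^[k] (fun z => z ^ p * delta₁ ν f z) x) := by
      rw [Function.iterate_succ_apply, iterate_deriv_congr (deriv_zpow_mul_eqOn ν hf p) k hx,
        iterate_deriv_const_mul_add (contDiffOn_zpow_mul hf _)
          ((contDiffOn_const.mul (contDiffOn_zpow_mul hf _)).add (contDiffOn_zpow_mul hδ _))
          _ _ hx]
      dsimp only
      rw [iterate_deriv_const_mul_add (contDiffOn_zpow_mul hf _) (contDiffOn_zpow_mul hδ _) _ _ hx]
    have b1 := h₁ f hf x _ hx hMf
    have b2 := h₂ f hf x _ hx hMf
    have b3 := h₃ _ hδ x _ hx hMδ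
    have hcancel : w x ^ (p.natAbs + 1) * (M / w x) = w x ^ p.natAbs * M := by
      rw [pow_succ]; field_simp
    have b4 : w x ^ (p + 1).natAbs * (M / w x) ≤ w x ^ p.natAbs * M := by
      rw [← hcancel]
      gcongr
      omega
    rw [hcancel] at b1
    rw [e]
    refine (abs_add_le _ _).trans ?_
    have b5 := abs_add_le (-1 * deriv^[k] (fun z => z ^ (p + 1) * f z) x)
      (deriv^[k] (fun z => z ^ p * delta₁ ν f z) x)
    rw [abs_mul, abs_neg, abs_one, one_mul] at b5
    nlinarith [mul_le_mul_of_nonneg_left b4 hC₂.le]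

/-- Ordinary derivatives in terms of powers of `δ_ν`. Writing `∂ = δ_ν - x + (ν + 1/2) / x`, the
coefficients that occur in `∂^k` are powers of `x`, and `1 / (16 rho₁) ≥ 1` dominates them: if
`ν = -1/2` there are no negative powers, and `rho₁` contains `x` only through `min 1 x⁻¹`. -/
theorem exists_abs_iterate_deriv_le {ν : ℝ} (hν : -1 / 2 ≤ ν) (k : ℕ) :
    ∃ C > 0, ∀ f : ℝ → ℝ, ContDiffOn ℝ ∞ f (Ioi 0) → ∀ x M : ℝ, 0 < x →
      (∀ i ≤ k, (1 / rho₁ ν x / 16) ^ (k - i) * |(delta₁ ν)^[i] f x| ≤ M) →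
      |deriv^[k] f x| ≤ C * M := by
  have key : ∃ P : ℤ → Prop, P 0 ∧ (∀ p, P p → P (p + 1)) ∧
      (∀ p, P p → (p : ℝ) + ν + 1 / 2 ≠ 0 → P (p - 1)) ∧
      (∀ x, 0 < x → 1 ≤ 1 / rho₁ ν x / 16) ∧
      (∀ p, P p → ∀ x, 0 < x → x ^ p ≤ (1 / rho₁ ν x / 16) ^ p.natAbs) := by
    rcases hν.eq_or_lt' with h | h
    · subst h
      refine ⟨fun p => 0 ≤ p, le_rfl, fun p hp => by omega, fun p hp hp0 => ?_, fun x hx => ?_,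
        fun p hp x hx => ?_⟩
      · have : p ≠ 0 := by
          rintro rfl
          norm_num at hp0
        omega
      · rw [one_div_rho₁_of_eq hx, mul_div_cancel_left₀ _ (by norm_num)]
        exact le_max_left _ _
      · rw [one_div_rho₁_of_eq hx, mul_div_cancel_left₀ _ (by norm_num)]
        lift p to ℕ using hp
        rw [zpow_natCast, Int.natAbs_natCast]
        gcongr
        exact le_max_right _ _
    · refine ⟨fun _ => True, trivial, fun _ _ => trivial, fun _ _ _ => trivial, fun x hx => ?_,
        fun p _ x hx => ?_⟩
      · rw [one_div_rho₁_of_lt h hx, mul_div_cancel_left₀ _ (by norm_num)]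
        rcases le_total 1 x with h1 | h1
        · exact h1.trans (le_max_left _ _)
        · exact ((one_le_inv₀ hx).2 h1).trans (le_max_right _ _)
      · rw [one_div_rho₁_of_lt h hx, mul_div_cancel_left₀ _ (by norm_num)]
        have hx' := inv_pos.2 hx
        obtain ⟨n, rfl | rfl⟩ := p.eq_nat_or_neg
        · rw [zpow_natCast, Int.natAbs_natCast]
          gcongr
          exact le_max_left _ _
        · rw [zpow_neg, zpow_natCast, Int.natAbs_neg, Int.natAbs_natCast, ← inv_pow]
          gcongr
          exact le_max_right _ _
  obtain ⟨P, hP0, hP, hP', hw, hPw⟩ := key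
  obtain ⟨C, hC, h⟩ := exists_abs_iterate_deriv_zpow_mul_le hw hP hP' hPw k 0 hP0
  refine ⟨C, hC, fun f hf x M hx hM => ?_⟩
  simpa using h f hf x M hx hM

theorem exists_abs_iterate_deriv_delta₁_le {ν γ : ℝ} (hν : -1 / 2 ≤ ν)
    (hγ : IsDecayExponent ν γ) (k j : ℕ) :
    ∃ C > 0, ∀ t x y M : ℝ, 0 < t → 0 < x → 0 < y →
      (∀ i ≤ k, (1 / rho₁ ν x / 16) ^ (k - i) * majorant ν γ (i + j) t x y ≤ M) →
      |deriv^[k] ((delta₁ ν)^[j] (fun z => heatKernel₁ ν t z y)) x| ≤ C * M := by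
  obtain ⟨C, hC, h⟩ := exists_abs_iterate_deriv_le hν k
  choose D hD hb using fun i => exists_abs_iterate_delta₁_heatKernel₁_le hν hγ (i + j)
  refine ⟨C * ∑ i ∈ Finset.range (k + 1), D i,
    mul_pos hC (Finset.sum_pos (fun i _ => hD i) (by simp)), fun t x y M ht hx hy hM => ?_⟩
  have hρ := rho₁_pos ν hx
  rw [mul_assoc]
  refine h _ (contDiffOn_iterate_delta₁ (contDiffOn_heatKernel₁ hν ht hy) j) x _ hx fun i hi => ?_
  rw [← Function.iterate_add_apply]
  have hM0 : 0 ≤ M := le_trans (mul_nonneg (by positivity) (majorant_nonneg _ hx hy)) (hM i hi)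
  calc _ ≤ (1 / rho₁ ν x / 16) ^ (k - i) * (D i * majorant ν γ (i + j) t x y) := by
        gcongr; exact hb i t x y ht hx hy
    _ = D i * ((1 / rho₁ ν x / 16) ^ (k - i) * majorant ν γ (i + j) t x y) := by ring
    _ ≤ D i * M := mul_le_mul_of_nonneg_left (hM i hi) (hD i).le
    _ ≤ _ := by
        gcongr
        exact Finset.single_le_sum (fun i _ => (hD i).le) (Finset.mem_range.2 (by omega))

theorem exists_abs_iterate_deriv_delta₁_le_rho₁ {ν γ : ℝ} (hν : -1 / 2 ≤ ν)
    (hγ : IsDecayExponent ν γ) (k j : ℕ) :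
    ∃ C > 0, ∀ t x y : ℝ, 0 < t → 0 < x → 0 < y →
      |deriv^[k] ((delta₁ ν)^[j] (fun z => heatKernel₁ ν t z y)) x| ≤
        C * ((1 / rho₁ ν x ^ k + 1 / √t ^ k) * majorant ν γ j t x y) := by
  obtain ⟨C, hC, h⟩ := exists_abs_iterate_deriv_delta₁_le hν hγ k j
  refine ⟨C, hC, fun t x y ht hx hy => h t x y _ ht hx hy fun i hi => ?_⟩
  have hρ := rho₁_pos ν hx
  have hst : 0 < √t := sqrt_pos.2 ht
  have hm := majorant_nonneg (ν := ν) (γ := γ) (t := t) j hx hy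
  set A := 1 / rho₁ ν x with hA
  have hA0 : 0 < A := by positivity
  rw [majorant_add, div_eq_mul_one_div (majorant ν γ j t x y), mul_left_comm, ← one_div_pow,
    ← one_div_pow, ← one_div_pow, ← hA, mul_comm (majorant ν γ j t x y)]
  gcongr
  have hT0 : 0 < 1 / √t := by positivity
  generalize 1 / √t = T at hT0
  have h1 : (A / 16) ^ (k - i) ≤ A ^ (k - i) := by
    gcongr
    linarith
  have h2 : A ^ (k - i) * T ^ i ≤ max A T ^ k := by
    calc _ ≤ max A T ^ (k - i) * max A T ^ i := by
          gcongr
          · exact le_max_left _ _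
          · exact le_max_right _ _
      _ = _ := by rw [← pow_add, Nat.sub_add_cancel hi]
  have h3 : max A T ^ k ≤ A ^ k + T ^ k := by
    have := pow_pos hA0 k
    have := pow_pos hT0 k
    rcases max_choice A T with h | h <;> rw [h] <;> linarith
  calc _ ≤ A ^ (k - i) * T ^ i := by gcongr
    _ ≤ _ := h2.trans h3

/-! ### The estimates in dimension one -/

theorem isDecayExponent_self {ν : ℝ} (hν : -1 / 2 < ν) : IsDecayExponent ν (ν + 1 / 2) :=
  ⟨by linarith, Or.inr ⟨hν, le_rfl⟩⟩

theorem exists_abs_heatKernel₁_le {ν : ℝ} (hν : -1 / 2 < ν) :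
    ∃ C > 0, ∃ c > 0, ∀ t x y : ℝ, 0 < t → 0 < x → 0 < y →
      |heatKernel₁ ν t x y| ≤ C * (exp (-t / 2) / √t) * exp (-|x - y| ^ 2 / (c * t)) *
        decay₁ ν t x y ^ (-(ν + 1 / 2)) := by
  obtain ⟨C, hC, h⟩ := exists_abs_iterate_delta₁_heatKernel₁_le hν.le (isDecayExponent_self hν) 0
  refine ⟨C, hC, 512, by norm_num, fun t x y ht hx hy => (h t x y ht hx hy).trans ?_⟩
  have := majorant_le (ν := ν) (γ := ν + 1 / 2) 0 ht hx hy
  rw [zero_add, pow_one] at this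
  calc _ ≤ C * _ := mul_le_mul_of_nonneg_left this hC.le
    _ = _ := by ring

/-- A power of a quantity of size `O((1 + t)(1 + energy))` times a derivative of the kernel. -/
theorem exists_pow_mul_abs_iterate_delta₁_le {ν : ℝ} (hν : -1 / 2 < ν) (k m : ℕ) (K : ℝ)
    (hK : 0 < K) :
    ∃ C > 0, ∀ t x y q : ℝ, 0 < t → 0 < x → 0 < y → 0 ≤ q →
      q ≤ K * ((1 + t) * (1 + energy t x y)) →
      |q ^ k * (delta₁ ν)^[m] (fun z => heatKernel₁ ν t z y) x| ≤
        C * (exp (-t / 4) / t ^ (((m : ℝ) + 1) / 2)) * exp (-|x - y| ^ 2 / (512 * t)) *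
          decay₁ ν t x y ^ (-(ν + 1 / 2)) := by
  obtain ⟨C₁, hC₁, h₁⟩ :=
    exists_abs_iterate_delta₁_heatKernel₁_le hν.le (isDecayExponent_self hν) m
  obtain ⟨C₂, hC₂, h₂⟩ := exists_pow_mul_majorant_le k
  refine ⟨C₁ * K ^ k * C₂, by positivity, fun t x y q ht hx hy hq hqK => ?_⟩
  have hm := majorant_nonneg (ν := ν) (γ := ν + 1 / 2) (t := t) m hx hy
  have hE := energy_nonneg ht x y
  rw [abs_mul, abs_pow, abs_of_nonneg hq, rpow_natCast_add_one_div_two ht]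
  calc _ ≤ (K * ((1 + t) * (1 + energy t x y))) ^ k *
        (C₁ * majorant ν (ν + 1 / 2) m t x y) := by
        gcongr
        exact h₁ t x y ht hx hy
    _ = C₁ * K ^ k * (((1 + t) * (1 + energy t x y)) ^ k * majorant ν (ν + 1 / 2) m t x y) := by
        rw [mul_pow]; ring
    _ ≤ C₁ * K ^ k * _ := mul_le_mul_of_nonneg_left (h₂ ν _ t x y m ht hx hy) (by positivity)
    _ = _ := by ring

theorem exists_abs_pow_mul_iterate_delta₁_le_of_off_diagonal {ν : ℝ} (hν : -1 / 2 < ν)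
    (k m : ℕ) :
    ∃ C > 0, ∃ c > 0, ∀ t x y : ℝ, 0 < t → t < 1 → 0 < x → 0 < y →
      (x * y < t ∨ (t ≤ x * y ∧ y < x / 2) ∨ (t ≤ x * y ∧ 2 * x < y)) →
      |(x / √t) ^ k * (delta₁ ν)^[m] (fun z => heatKernel₁ ν t z y) x| ≤
        C * (1 / t ^ (((m : ℝ) + 1) / 2)) * exp (-|x - y| ^ 2 / (c * t)) *
          decay₁ ν t x y ^ (-(ν + 1 / 2)) := by
  obtain ⟨C, hC, h⟩ := exists_pow_mul_abs_iterate_delta₁_le hν k m 35 (by norm_num)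
  refine ⟨C, hC, 512, by norm_num, fun t x y ht _ hx hy hreg => ?_⟩
  have hst : 0 < √t := sqrt_pos.2 ht
  have hss := mul_self_sqrt ht.le
  have hE := energy_nonneg ht x y
  have hD := decay₁_rpow_nonneg (ν := ν) (t := t) (γ := -(ν + 1 / 2)) hx hy
  have h1 : x ≤ √t + 2 * |x - y| := by
    rcases hreg with h | ⟨-, h⟩ | ⟨-, h⟩
    · rcases le_total x (√t) with h' | h'
      · linarith [abs_nonneg (x - y)]
      · have : y ≤ √t := by
          by_contra! h''
          nlinarith [mul_le_mul h' h''.le hst.le hx.le]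
        linarith [le_abs_self (x - y), abs_nonneg (x - y)]
    · linarith [le_abs_self (x - y)]
    · linarith [neg_abs_le (x - y)]
  have h2 : x / √t ≤ 35 * ((1 + t) * (1 + energy t x y)) := by
    calc x / √t ≤ (√t + 2 * |x - y|) / √t := by gcongr
      _ = 1 + 2 * (|x - y| / √t) := by field_simp
      _ ≤ 1 + 2 * (1 + 16 * energy t x y) := by
          have := abs_sub_div_sqrt_le_energy ht x y
          linarith
      _ ≤ _ := by nlinarith [mul_nonneg ht.le hE]
  refine (h t x y _ ht hx hy (by positivity) h2).trans ?_
  have : exp (-t / 4) ≤ 1 := exp_le_one_iff.2 (by linarith)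
  gcongr

theorem exists_abs_pow_mul_iterate_delta₁_le_of_one_le {ν : ℝ} (hν : -1 / 2 < ν) (k m : ℕ) :
    ∃ C > 0, ∃ c > 0, ∀ t x y : ℝ, 1 ≤ t → 0 < x → 0 < y →
      |x ^ k * (delta₁ ν)^[m] (fun z => heatKernel₁ ν t z y) x| ≤
        C * (exp (-t / 2 ^ (m + 2)) / t ^ (((m : ℝ) + 1) / 2)) *
          exp (-|x - y| ^ 2 / (c * t)) * decay₁ ν t x y ^ (-(ν + 1 / 2)) := by
  obtain ⟨C, hC, h⟩ := exists_pow_mul_abs_iterate_delta₁_le hν k m 1 (by norm_num)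
  refine ⟨C, hC, 512, by norm_num, fun t x y ht1 hx hy => ?_⟩
  have ht : 0 < t := by linarith
  have hD := decay₁_rpow_nonneg (ν := ν) (t := t) (γ := -(ν + 1 / 2)) hx hy
  have h1 : x ≤ 1 * ((1 + t) * (1 + energy t x y)) := by
    rw [one_mul]
    refine le_trans ?_ (sqrt_mul_le_energy ht x y)
    exact le_mul_of_one_le_left hx.le (one_le_sqrt.2 ht1)
  refine (h t x y _ ht hx hy hx.le h1).trans ?_
  have : exp (-t / 4) ≤ exp (-t / 2 ^ (m + 2)) := by
    rw [exp_le_exp, neg_div, neg_div, neg_le_neg_iff]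
    refine div_le_div_of_nonneg_left ht.le (by norm_num) ?_
    calc (4 : ℝ) = 2 ^ 2 := by norm_num
      _ ≤ 2 ^ (m + 2) := pow_le_pow_right₀ (by norm_num) (by omega)
  gcongr

theorem exists_abs_iterate_delta₁_le {ν : ℝ} (hν : -1 / 2 < ν) (k : ℕ) :
    ∃ C > 0, ∀ t x y : ℝ, 0 < t → 0 < x → 0 < y →
      |(delta₁ ν)^[k] (fun z => heatKernel₁ ν t z y) x| ≤
        C * (1 / t ^ (((k : ℝ) + 1) / 2)) * exp (-|x - y| ^ 2 / (512 * t)) *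
          decay₁ ν t x y ^ (-(ν + 1 / 2)) := by
  obtain ⟨C, hC, h⟩ := exists_pow_mul_abs_iterate_delta₁_le hν 0 k 1 (by norm_num)
  refine ⟨C, hC, fun t x y ht hx hy => ?_⟩
  have hE := energy_nonneg ht x y
  have h1 := h t x y 0 ht hx hy le_rfl (by positivity)
  rw [pow_zero, one_mul] at h1
  refine h1.trans ?_
  have hD := decay₁_rpow_nonneg (ν := ν) (t := t) (γ := -(ν + 1 / 2)) hx hy
  have : exp (-t / 4) ≤ 1 := exp_le_one_iff.2 (by linarith)
  gcongr

theorem exists_abs_iterate_delta₁_sub_le {ν : ℝ} (hν : -1 / 2 < ν) (m : ℕ) :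
    ∃ C > 0, ∀ t x y : ℝ, 0 < t → t < 1 → 0 < x → 0 < y → t ≤ x * y → x / 2 ≤ y → y ≤ 2 * x →
      x / t * |(delta₁ ν)^[m]
          (fun z => heatKernel₁ ν t z y - heatKernel₁ (ν + 1) t z y) x| ≤
        C * (1 / t ^ (((m + 1 : ℕ) + 1 : ℝ) / 2)) * exp (-|x - y| ^ 2 / (512 * t)) *
          decay₁ ν t x y ^ (-(ν + 1 / 2)) := by
  obtain ⟨C, hC, h⟩ :=
    exists_abs_iterate_delta₁_heatKernel₁_sub_le hν.le (isDecayExponent_self hν) m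
  refine ⟨32 * C, by positivity, fun t x y ht ht1 hx hy hxy h1 _ => ?_⟩
  have hst : 0 < √t := sqrt_pos.2 ht
  have hss := mul_self_sqrt ht.le
  have hS := sinh_two_mul_pos ht
  have hm := majorant_nonneg (ν := ν) (γ := ν + 1 / 2) (t := t) m hx hy
  have hD := decay₁_rpow_nonneg (ν := ν) (t := t) (γ := -(ν + 1 / 2)) hx hy
  have h2 : √t ≤ 2 * y := by
    refine abs_le_of_sq_le_sq' ?_ (by positivity) |>.2
    rw [sq_sqrt ht.le]
    nlinarith
  have h3 : x / t * (sinh (2 * t) / (x * y)) ≤ 32 / √t := by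
    calc x / t * (sinh (2 * t) / (x * y)) = sinh (2 * t) / (t * y) := by field_simp
      _ ≤ 16 * t / (t * y) := by gcongr; exact sinh_two_mul_le ht ht1.le
      _ = 32 / (2 * y) := by field_simp; norm_num
      _ ≤ 32 / √t := by gcongr
  have h4 := majorant_le (ν := ν) (γ := ν + 1 / 2) m ht hx hy
  have h5 : exp (-t / 2) ≤ 1 := exp_le_one_iff.2 (by linarith)
  rw [rpow_natCast_add_one_div_two ht]
  calc _ ≤ x / t * (C * (sinh (2 * t) / (x * y)) * majorant ν (ν + 1 / 2) m t x y) := by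
        gcongr; exact h t x y ht hx hy
    _ = C * (x / t * (sinh (2 * t) / (x * y))) * majorant ν (ν + 1 / 2) m t x y := by ring
    _ ≤ C * (32 / √t) * (1 / √t ^ (m + 1) * exp (-|x - y| ^ 2 / (512 * t)) *
          decay₁ ν t x y ^ (-(ν + 1 / 2))) := by
        gcongr
        exact h4.trans (by gcongr)
    _ = _ := by rw [pow_succ √t (m + 1)]; field_simp

theorem exists_abs_near_diagonal_le {ν : ℝ} (hν : -1 / 2 < ν) {m : ℕ} (hm : 1 ≤ m) :
    ∃ C > 0, ∃ c > 0, ∀ t x y : ℝ, 0 < t → t < 1 → 0 < x → 0 < y → t ≤ x * y → x / 2 ≤ y →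
      y ≤ 2 * x →
      |(delta₁ ν)^[m] (fun z => heatKernel₁ ν t z y) x| +
        x / t * |(delta₁ ν)^[m - 1]
          (fun z => heatKernel₁ ν t z y - heatKernel₁ (ν + 1) t z y) x| ≤
        C * (1 / t ^ (((m : ℝ) + 1) / 2)) * exp (-|x - y| ^ 2 / (c * t)) *
          decay₁ ν t x y ^ (-(ν + 1 / 2)) := by
  obtain ⟨m, rfl⟩ := Nat.exists_eq_add_of_le' hm
  obtain ⟨C₁, hC₁, h₁⟩ := exists_abs_iterate_delta₁_le hν (m + 1)
  obtain ⟨C₂, hC₂, h₂⟩ := exists_abs_iterate_delta₁_sub_le hν m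
  refine ⟨C₁ + C₂, by positivity, 512, by norm_num, fun t x y ht ht1 hx hy a b c => ?_⟩
  rw [Nat.add_sub_cancel]
  calc _ ≤ _ := add_le_add (h₁ t x y ht hx hy) (h₂ t x y ht ht1 hx hy a b c)
    _ = _ := by ring

theorem exists_abs_iterate_deriv_delta₁_le_of_lt {ν : ℝ} (hν : -1 / 2 < ν) (k j : ℕ) :
    ∃ C > 0, ∃ c > 0, ∀ t x y : ℝ, 0 < t → 0 < x → 0 < y →
      |deriv^[k] ((delta₁ ν)^[j] (fun z => heatKernel₁ ν t z y)) x| ≤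
        C * (1 / rho₁ ν x ^ k + 1 / t ^ ((k : ℝ) / 2)) * (1 / t ^ (((j : ℝ) + 1) / 2)) *
          exp (-|x - y| ^ 2 / (c * t)) * decay₁ ν t x y ^ (-(ν + 1 / 2)) := by
  obtain ⟨C, hC, h⟩ := exists_abs_iterate_deriv_delta₁_le_rho₁ hν.le (isDecayExponent_self hν) k j
  refine ⟨C, hC, 512, by norm_num, fun t x y ht hx hy => (h t x y ht hx hy).trans ?_⟩
  have hst : 0 < √t := sqrt_pos.2 ht
  have hρ := rho₁_pos ν hx
  have hD := decay₁_rpow_nonneg (ν := ν) (t := t) (γ := -(ν + 1 / 2)) hx hy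
  have h5 : exp (-t / 2) ≤ 1 := exp_le_one_iff.2 (by linarith)
  rw [rpow_natCast_add_one_div_two ht, rpow_natCast_div_two ht]
  calc _ ≤ C * ((1 / rho₁ ν x ^ k + 1 / √t ^ k) * (1 / √t ^ (j + 1) *
        exp (-|x - y| ^ 2 / (512 * t)) * decay₁ ν t x y ^ (-(ν + 1 / 2)))) := by
        gcongr
        exact (majorant_le j ht hx hy).trans (by gcongr)
    _ = _ := by ring

/-- For `ν = -1/2` the critical function has no singularity at `x = 0`, so that the factors
`1 / rho₁` produced by ordinary derivatives are absorbed by the exponential factors. -/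
theorem exists_abs_iterate_deriv_delta₁_neg_half_le (k j : ℕ) {N : ℝ} (hN : 0 < N) :
    ∃ C > 0, ∃ c > 0, ∀ t x y : ℝ, 0 < t → 0 < x → 0 < y →
      |deriv^[k] ((delta₁ (-1 / 2))^[j] (fun z => heatKernel₁ (-1 / 2) t z y)) x| ≤
        C * (1 / t ^ (((j : ℝ) + k + 1) / 2)) * exp (-|x - y| ^ 2 / (c * t)) *
          decay₁ (-1 / 2) t x y ^ (-N) := by
  obtain ⟨C, hC, h⟩ := exists_abs_iterate_deriv_delta₁_le (ν := -1 / 2) le_rfl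
    (γ := N) ⟨hN.le, Or.inl rfl⟩ k j
  choose D hD hb using exists_pow_mul_majorant_le
  refine ⟨C * ∑ i ∈ Finset.range (k + 1), 2 ^ i * D i,
    mul_pos hC (Finset.sum_pos (fun i _ => mul_pos (by positivity) (hD i)) (by simp)),
    512, by norm_num, fun t x y ht hx hy => ?_⟩
  have hst : 0 < √t := sqrt_pos.2 ht
  have hE := energy_nonneg ht x y
  have hDn := decay₁_rpow_nonneg (ν := -1 / 2) (t := t) (γ := -N) hx hy
  have h5 : exp (-t / 4) ≤ 1 := exp_le_one_iff.2 (by linarith)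
  have hw : √t * max 1 x ≤ 2 * ((1 + t) * (1 + energy t x y)) := by
    have h1 := sqrt_mul_le_energy ht x y
    have h2 := sqrt_le_one_add ht
    have h3 : max 1 x ≤ 1 + x := max_le (by linarith) (by linarith)
    nlinarith [mul_le_mul_of_nonneg_left h3 hst.le, mul_nonneg ht.le hE]
  set G := exp (-|x - y| ^ 2 / (512 * t)) * decay₁ (-1 / 2) t x y ^ (-N) with hG
  have hG0 : 0 ≤ G := by positivity
  have key : ∀ i ≤ k, (1 / rho₁ (-1 / 2) x / 16) ^ (k - i) * majorant (-1 / 2) N (i + j) t x y ≤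
      (∑ i ∈ Finset.range (k + 1), 2 ^ i * D i) * (1 / √t ^ (j + k + 1) * G) := by
    intro i hi
    have hw0 : 0 ≤ √t * max 1 x := by positivity
    have hm := majorant_nonneg (ν := -1 / 2) (γ := N) (t := t) j hx hy
    rw [one_div_rho₁_of_eq hx, mul_div_cancel_left₀ _ (by norm_num), majorant_add]
    calc max 1 x ^ (k - i) * (majorant (-1 / 2) N j t x y / √t ^ i)
        = (√t * max 1 x) ^ (k - i) * majorant (-1 / 2) N j t x y / √t ^ k := by
          have : √t ^ k = √t ^ (k - i) * √t ^ i := by rw [← pow_add, Nat.sub_add_cancel hi]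
          rw [this, mul_pow]
          field_simp
      _ ≤ (2 * ((1 + t) * (1 + energy t x y))) ^ (k - i) * majorant (-1 / 2) N j t x y / √t ^ k := by
          gcongr
      _ = 2 ^ (k - i) * (((1 + t) * (1 + energy t x y)) ^ (k - i) * majorant (-1 / 2) N j t x y) /
          √t ^ k := by rw [mul_pow]; ring
      _ ≤ 2 ^ (k - i) * (D (k - i) * (1 / √t ^ (j + 1) * exp (-|x - y| ^ 2 / (512 * t)) *
          decay₁ (-1 / 2) t x y ^ (-N))) / √t ^ k := by
          have := hD (k - i)
          refine div_le_div_of_nonneg_right (mul_le_mul_of_nonneg_left ?_ (by positivity))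
            (by positivity)
          exact (hb (k - i) _ N t x y j ht hx hy).trans (by gcongr)
      _ = (2 ^ (k - i) * D (k - i)) * (1 / √t ^ (j + k + 1) * G) := by
          rw [show j + k + 1 = (j + 1) + k by ring, pow_add √t (j + 1) k, hG]
          field_simp
      _ ≤ _ := by
          refine mul_le_mul_of_nonneg_right ?_ (by positivity)
          exact Finset.single_le_sum (f := fun i => 2 ^ i * D i)
            (fun i _ => (mul_pos (by positivity) (hD i)).le) (Finset.mem_range.2 (by omega))
  have e : t ^ (((j : ℝ) + k + 1) / 2) = √t ^ (j + k + 1) := by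
    rw [← rpow_natCast_add_one_div_two ht]
    push_cast
    rfl
  rw [e]
  calc _ ≤ _ := h t x y _ ht hx hy key
    _ = _ := by rw [hG]; ring

/-! ### Products of functions of one variable on the orthant -/

theorem hasSum_pi_prod {n : ℕ} {f : Fin n → ℕ → ℝ} {a : Fin n → ℝ}
    (h : ∀ j, HasSum (f j) (a j)) :
    HasSum (fun k : Fin n → ℕ => ∏ j, f j (k j)) (∏ j, a j) := by
  induction n with
  | zero => simp
  | succ n ih =>
    have h1 : HasSum (fun k : Fin n → ℕ => ∏ j : Fin n, f j.succ (k j)) (∏ j : Fin n, a j.succ) :=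
      ih fun j => h j.succ
    have h2 : ∀ {F : ℕ → ℝ} {G : (Fin n → ℕ) → ℝ} {u v : ℝ}, HasSum F u → HasSum G v →
        HasSum (fun p : ℕ × (Fin n → ℕ) => F p.1 * G p.2) (u * v) := fun hF hG =>
      hF.mul hG (summable_mul_of_summable_norm hF.summable.norm hG.summable.norm)
    rw [Fin.prod_univ_succ, ← (Fin.consEquiv fun _ => ℕ).hasSum_iff]
    refine hasSum_of_eq (h2 (h 0) h1) (fun k => ?_) rfl
    simp [Fin.prod_univ_succ, Fin.consEquiv]

variable {n : ℕ}

theorem hasSum_heatTerm {ν : Fin n → ℝ} (hν : ∀ i, -1 / 2 ≤ ν i) {t : ℝ} (ht : 0 < t)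
    {x y : EuclideanSpace ℝ (Fin n)} (hx : x ∈ orthant n) (hy : y ∈ orthant n) :
    HasSum (heatTerm ν t x y) (∏ j, heatKernel₁ (ν j) t (x j) (y j)) := by
  refine hasSum_of_eq (hasSum_pi_prod fun j =>
    (hasSum_heatTerm₁ (hν j) ht (hx j) (hy j)).summable.hasSum) (fun k => ?_) rfl
  simp only [heatTerm₁, heatTerm, laguerreFunN, Finset.prod_mul_distrib]
  rw [← exp_sum]
  congr 3
  simp only [Finset.mul_sum, Finset.sum_add_distrib, mul_add, Finset.sum_const, Finset.card_univ,
    Fintype.card_fin, nsmul_eq_mul]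
  ring

theorem isOpen_orthant : IsOpen (orthant n) := by
  have : orthant n = ⋂ j, {x : EuclideanSpace ℝ (Fin n) | 0 < x j} := by
    ext x; simp [orthant]
  rw [this]
  exact isOpen_iInter_of_finite fun j => isOpen_lt continuous_const (by fun_prop)

/-- The function `z ↦ ∏ j, g j (z j)` with separated variables. -/
def prodFun (g : Fin n → ℝ → ℝ) (z : EuclideanSpace ℝ (Fin n)) : ℝ := ∏ j, g j (z j)

theorem prodFun_update (g : Fin n → ℝ → ℝ) (j : Fin n) (h : ℝ → ℝ)
    (z : EuclideanSpace ℝ (Fin n)) :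
    prodFun (Function.update g j h) z = h (z j) * ∏ i ∈ Finset.univ.erase j, g i (z i) := by
  rw [prodFun, ← Finset.mul_prod_erase _ _ (Finset.mem_univ j), Function.update_self]
  congr 1
  refine Finset.prod_congr rfl fun i hi => ?_
  rw [Function.update_of_ne (Finset.ne_of_mem_erase hi)]

theorem contDiffOn_prodFun {g : Fin n → ℝ → ℝ} (hg : ∀ j, ContDiffOn ℝ ∞ (g j) (Ioi 0)) :
    ContDiffOn ℝ ∞ (prodFun g) (orthant n) :=
  contDiffOn_prod fun j _ => (hg j).comp
    (EuclideanSpace.proj (𝕜 := ℝ) j : EuclideanSpace ℝ (Fin n) →L[ℝ] ℝ).contDiff.contDiffOn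
    fun _ hz => hz j

theorem partialD_eqOn_prodFun {F : EuclideanSpace ℝ (Fin n) → ℝ} {g : Fin n → ℝ → ℝ}
    (hg : ∀ j, ContDiffOn ℝ ∞ (g j) (Ioi 0)) (hF : EqOn F (prodFun g) (orthant n)) (j : Fin n) :
    EqOn (partialD j F) (prodFun (Function.update g j (deriv (g j)))) (orthant n) := by
  intro x hx
  rw [prodFun_update, partialD, lineDeriv]
  have hcont : Continuous fun s : ℝ => x + s • EuclideanSpace.single j (1 : ℝ) := by fun_prop
  have hmem : ∀ᶠ s in nhds (0 : ℝ), x + s • EuclideanSpace.single j (1 : ℝ) ∈ orthant n :=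
    hcont.continuousAt.eventually_mem (isOpen_orthant.mem_nhds (by simpa using hx))
  have he : (fun s : ℝ => F (x + s • EuclideanSpace.single j (1 : ℝ))) =ᶠ[nhds 0]
      fun s => g j (x j + s) * ∏ i ∈ Finset.univ.erase j, g i (x i) := by
    filter_upwards [hmem] with s hs
    rw [hF hs, prodFun, ← Finset.mul_prod_erase _ _ (Finset.mem_univ j)]
    congr 1
    · simp
    · refine Finset.prod_congr rfl fun i hi => ?_
      simp [Finset.ne_of_mem_erase hi]
  rw [he.deriv_eq]
  have h1 := (((hg j).differentiableOn (by simp)).differentiableAt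
    (Ioi_mem_nhds (hx j))).hasDerivAt
  have h2 : HasDerivAt (fun s => g j (x j + s)) (deriv (g j) (x j)) 0 := by
    have h3 : HasDerivAt (g j) (deriv (g j) (x j)) (x j + 0) := by rwa [add_zero]
    exact h3.comp_const_add (x j) 0
  exact (h2.mul_const _).deriv

theorem delta_eqOn_prodFun {ν : Fin n → ℝ} {F : EuclideanSpace ℝ (Fin n) → ℝ}
    {g : Fin n → ℝ → ℝ} (hg : ∀ j, ContDiffOn ℝ ∞ (g j) (Ioi 0))
    (hF : EqOn F (prodFun g) (orthant n)) (j : Fin n) :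
    EqOn (delta ν j F) (prodFun (Function.update g j (delta₁ (ν j) (g j)))) (orthant n) := by
  intro x hx
  rw [delta, partialD_eqOn_prodFun hg hF j hx, hF hx, prodFun_update, prodFun_update, prodFun,
    ← Finset.mul_prod_erase _ _ (Finset.mem_univ j), delta₁]
  ring

/-- Operators that act on the `j`-th factor of functions with separated variables, applied in
succession for all `j`. -/
theorem multiPow_eqOn_prodFun
    {D : Fin n → (EuclideanSpace ℝ (Fin n) → ℝ) → (EuclideanSpace ℝ (Fin n) → ℝ)}
    {D₁ : Fin n → (ℝ → ℝ) → (ℝ → ℝ)}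
    (hs : ∀ j f, ContDiffOn ℝ ∞ f (Ioi 0) → ContDiffOn ℝ ∞ (D₁ j f) (Ioi 0))
    (hD : ∀ F g, (∀ i, ContDiffOn ℝ ∞ (g i) (Ioi 0)) → EqOn F (prodFun g) (orthant n) → ∀ j,
      EqOn (D j F) (prodFun (Function.update g j (D₁ j (g j)))) (orthant n))
    {F : EuclideanSpace ℝ (Fin n) → ℝ} {g : Fin n → ℝ → ℝ}
    (hg : ∀ i, ContDiffOn ℝ ∞ (g i) (Ioi 0)) (hF : EqOn F (prodFun g) (orthant n))
    (k : Fin n → ℕ) :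
    EqOn (multiPow D k F) (prodFun fun j => (D₁ j)^[k j] (g j)) (orthant n) := by
  have hiter : ∀ j m f, ContDiffOn ℝ ∞ f (Ioi 0) → ContDiffOn ℝ ∞ ((D₁ j)^[m] f) (Ioi 0) := by
    intro j m f hf
    induction m with
    | zero => exact hf
    | succ m ih => rw [Function.iterate_succ_apply']; exact hs j _ ih
  have hupd : ∀ (g : Fin n → ℝ → ℝ) j m, (∀ i, ContDiffOn ℝ ∞ (g i) (Ioi 0)) →
      ∀ i, ContDiffOn ℝ ∞ (Function.update g j ((D₁ j)^[m] (g j)) i) (Ioi 0) := by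
    intro g j m hg i
    rcases eq_or_ne i j with rfl | h
    · rw [Function.update_self]; exact hiter _ _ _ (hg i)
    · rw [Function.update_of_ne h]; exact hg i
  have hpow : ∀ F g j m, (∀ i, ContDiffOn ℝ ∞ (g i) (Ioi 0)) → EqOn F (prodFun g) (orthant n) →
      EqOn ((D j)^[m] F) (prodFun (Function.update g j ((D₁ j)^[m] (g j)))) (orthant n) := by
    intro F g j m hg hF
    induction m with
    | zero => simpa using hF
    | succ m ih =>
      rw [Function.iterate_succ_apply', Function.iterate_succ_apply']
      have := hD _ _ (hupd g j m hg) ih j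
      rwa [Function.update_self, Function.update_idem] at this
  have hlist : ∀ (L : List (Fin n)), L.Nodup → ∀ F g, (∀ i, ContDiffOn ℝ ∞ (g i) (Ioi 0)) →
      EqOn F (prodFun g) (orthant n) →
      EqOn (L.foldl (fun G j => (D j)^[k j] G) F)
        (prodFun fun j => if j ∈ L then (D₁ j)^[k j] (g j) else g j) (orthant n) := by
    intro L
    induction L with
    | nil => intro _ F g _ hF; simpa using hF
    | cons a L ih =>
      intro hL F g hg hF
      rw [List.nodup_cons] at hL
      rw [List.foldl_cons]
      refine (ih hL.2 _ _ (hupd g a (k a) hg) (hpow F g a (k a) hg hF)).trans fun x _ => ?_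
      congr 1
      funext j
      rcases eq_or_ne j a with rfl | h
      · simp [hL.1]
      · simp [h]
  have := hlist (List.finRange n) (List.nodup_finRange n) F g hg hF
  simpa [multiPow] using this

theorem multiPow_delta_eqOn {ν : Fin n → ℝ} {F : EuclideanSpace ℝ (Fin n) → ℝ}
    {g : Fin n → ℝ → ℝ} (hg : ∀ j, ContDiffOn ℝ ∞ (g j) (Ioi 0))
    (hF : EqOn F (prodFun g) (orthant n)) (k : Fin n → ℕ) :
    EqOn (multiPow (delta ν) k F) (prodFun fun j => (delta₁ (ν j))^[k j] (g j)) (orthant n) :=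
  multiPow_eqOn_prodFun (D₁ := fun j => delta₁ (ν j)) (fun _ _ => contDiffOn_delta₁)
    (fun _ _ hg hF => delta_eqOn_prodFun hg hF) hg hF k

theorem multiPow_partialD_eqOn {F : EuclideanSpace ℝ (Fin n) → ℝ}
    {g : Fin n → ℝ → ℝ} (hg : ∀ j, ContDiffOn ℝ ∞ (g j) (Ioi 0))
    (hF : EqOn F (prodFun g) (orthant n)) (k : Fin n → ℕ) :
    EqOn (multiPow partialD k F) (prodFun fun j => deriv^[k j] (g j)) (orthant n) :=
  multiPow_eqOn_prodFun (D₁ := fun _ => deriv) (fun _ _ => contDiffOn_deriv)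
    (fun _ _ hg hF => partialD_eqOn_prodFun hg hF) hg hF k

theorem heatKernel_eqOn {ν : Fin n → ℝ} (hν : ∀ i, -1 / 2 ≤ ν i) {t : ℝ} (ht : 0 < t)
    {y : EuclideanSpace ℝ (Fin n)} (hy : y ∈ orthant n) :
    EqOn (fun z => heatKernel ν t z y) (prodFun fun j z => heatKernel₁ (ν j) t z (y j))
      (orthant n) :=
  fun _ hx => (hasSum_heatTerm hν ht hx hy).tsum_eq

/-! ### The critical function in dimension `n` -/

theorem le_one_div_rho₁ (ν : ℝ) {x : ℝ} (hx : 0 < x) (hν : -1 / 2 ≤ ν) :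
    16 ≤ 1 / rho₁ ν x ∧ 16 * x ≤ 1 / rho₁ ν x ∧ (-1 / 2 < ν → 16 * x⁻¹ ≤ 1 / rho₁ ν x) := by
  rcases hν.eq_or_lt' with h | h
  · subst h
    rw [one_div_rho₁_of_eq hx]
    exact ⟨by linarith [le_max_left 1 x], by linarith [le_max_right 1 x],
      fun h => absurd h (lt_irrefl _)⟩
  · rw [one_div_rho₁_of_lt h hx]
    have h1 : 1 ≤ max x x⁻¹ := by
      rcases le_total 1 x with h1 | h1
      · exact h1.trans (le_max_left _ _)
      · exact ((one_le_inv₀ hx).2 h1).trans (le_max_right _ _)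
    exact ⟨by linarith, by linarith [le_max_left x x⁻¹], fun _ => by linarith [le_max_right x x⁻¹]⟩

theorem coord_le_norm (x : EuclideanSpace ℝ (Fin n)) (j : Fin n) : x j ≤ ‖x‖ :=
  (le_abs_self _).trans (PiLp.norm_apply_le x j)

theorem norm_le_sum_coord {x : EuclideanSpace ℝ (Fin n)} (hx : x ∈ orthant n) :
    ‖x‖ ≤ ∑ j, x j := by
  have h0 : ∀ j ∈ Finset.univ, 0 ≤ x j := fun j _ => (hx j).le
  refine abs_le_of_sq_le_sq' ?_ (Finset.sum_nonneg h0) |>.2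
  rw [EuclideanSpace.norm_sq_eq]
  simp only [norm_eq_abs, sq_abs]
  exact Finset.sum_sq_le_sq_sum_of_nonneg h0

theorem norm_pos_of_mem_orthant (hn : 1 ≤ n) {x : EuclideanSpace ℝ (Fin n)}
    (hx : x ∈ orthant n) : 0 < ‖x‖ :=
  (hx ⟨0, hn⟩).trans_le (coord_le_norm x _)

theorem rho_cases (ν : Fin n → ℝ) (x : EuclideanSpace ℝ (Fin n)) :
    rho ν x = 1 / 16 * ‖x‖⁻¹ ∨ rho ν x = 1 / 16 ∨ ∃ j, -1 / 2 < ν j ∧ rho ν x = 1 / 16 * x j := by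
  obtain ⟨m, hm, h⟩ : ∃ m, rho ν x = 1 / 16 * m ∧
      m ∈ insert ‖x‖⁻¹ (insert 1 ((J ν).image fun j => x j)) := ⟨_, rfl, Finset.min'_mem _ _⟩
  simp only [Finset.mem_insert, Finset.mem_image, J, Finset.mem_filter, Finset.mem_univ,
    true_and] at h
  rw [hm]
  rcases h with h | h | ⟨j, hj, h⟩
  · left; rw [h]
  · right; left; rw [h, mul_one]
  · right; right; exact ⟨j, hj, by rw [h]⟩

theorem rho_pos (hn : 1 ≤ n) (ν : Fin n → ℝ) {x : EuclideanSpace ℝ (Fin n)}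
    (hx : x ∈ orthant n) : 0 < rho ν x := by
  have := norm_pos_of_mem_orthant hn hx
  rcases rho_cases ν x with h | h | ⟨j, -, h⟩ <;> rw [h]
  · positivity
  · norm_num
  · have := hx j
    positivity

theorem rho_le_rho₁ (ν : Fin n → ℝ) {x : EuclideanSpace ℝ (Fin n)} (hx : x ∈ orthant n)
    (hν : ∀ i, -1 / 2 ≤ ν i) (j : Fin n) : rho ν x ≤ rho₁ (ν j) (x j) := by
  have hmin : ∀ a ∈ insert ‖x‖⁻¹ (insert 1 ((J ν).image fun j => x j)), rho ν x ≤ 1 / 16 * a :=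
    fun a ha => mul_le_mul_of_nonneg_left (Finset.min'_le _ a ha) (by norm_num)
  have h1 : rho ν x ≤ 1 / 16 * (x j)⁻¹ := by
    refine (hmin ‖x‖⁻¹ (by simp)).trans ?_
    have := inv_anti₀ (hx j) (coord_le_norm x j)
    linarith
  have h2 : rho ν x ≤ 1 / 16 * 1 := hmin 1 (by simp)
  rw [rho₁]
  split_ifs with h
  · rcases min_choice 1 (x j)⁻¹ with h' | h' <;> rw [h'] <;> assumption
  · have hj : -1 / 2 < ν j := lt_of_le_of_ne (hν j) (Ne.symm h)
    have h3 : rho ν x ≤ 1 / 16 * x j := hmin (x j) (by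
      simp only [Finset.mem_insert, Finset.mem_image, J, Finset.mem_filter, Finset.mem_univ,
        true_and]
      exact Or.inr (Or.inr ⟨j, hj, rfl⟩))
    rcases min_choice (x j) (x j)⁻¹ with h' | h' <;> rw [h'] <;> assumption

theorem one_div_rho_le_sum (hn : 1 ≤ n) {ν : Fin n → ℝ} {x : EuclideanSpace ℝ (Fin n)}
    (hx : x ∈ orthant n) (hν : ∀ i, -1 / 2 ≤ ν i) :
    1 / rho ν x ≤ ∑ j, 1 / rho₁ (ν j) (x j) := by
  have h0 : ∀ j ∈ Finset.univ, 0 ≤ 1 / rho₁ (ν j) (x j) := fun j _ => by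
    have := rho₁_pos (ν j) (hx j); positivity
  have hb := fun j => le_one_div_rho₁ (ν j) (hx j) (hν j)
  rcases rho_cases ν x with h | h | ⟨j, hj, h⟩ <;> rw [h]
  · have h1 := norm_le_sum_coord hx
    calc 1 / (1 / 16 * ‖x‖⁻¹) = 16 * ‖x‖ := by field_simp
      _ ≤ 16 * ∑ j, x j := by linarith
      _ = ∑ j, 16 * x j := Finset.mul_sum _ _ _
      _ ≤ _ := Finset.sum_le_sum fun j _ => (hb j).2.1
  · refine le_trans ?_ (Finset.single_le_sum h0 (Finset.mem_univ ⟨0, hn⟩))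
    refine le_trans (by norm_num) (hb _).1
  · refine le_trans ?_ (Finset.single_le_sum h0 (Finset.mem_univ j))
    refine le_trans (le_of_eq ?_) ((hb j).2.2 hj)
    have := hx j
    field_simp

theorem decay_pos (hn : 1 ≤ n) {ν : Fin n → ℝ} {t : ℝ} {x y : EuclideanSpace ℝ (Fin n)}
    (hx : x ∈ orthant n) (hy : y ∈ orthant n) : 0 < decay ν t x y := by
  have h1 := rho_pos hn ν hx
  have h2 := rho_pos hn ν hy
  unfold decay
  positivity

/-- Since all the one-dimensional quantities are at least `1`, their product dominates each of
them, and hence their mean, which dominates the `n`-dimensional one. -/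
theorem decay_le_prod (hn : 1 ≤ n) {ν : Fin n → ℝ} (hν : ∀ i, -1 / 2 ≤ ν i) (t : ℝ)
    {x y : EuclideanSpace ℝ (Fin n)} (hx : x ∈ orthant n) (hy : y ∈ orthant n) :
    decay ν t x y ≤ n * ∏ j, decay₁ (ν j) t (x j) (y j) := by
  have h1 : ∀ j, 1 ≤ decay₁ (ν j) t (x j) (y j) := fun j => one_le_decay₁ (hx j) (hy j)
  have hn' : (1 : ℝ) ≤ n := by exact_mod_cast hn
  calc decay ν t x y ≤ ∑ j, decay₁ (ν j) t (x j) (y j) := by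
        simp only [decay, decay₁, Finset.sum_add_distrib, Finset.sum_const, Finset.card_univ,
          Fintype.card_fin, nsmul_eq_mul, mul_one]
        have e : ∀ z : EuclideanSpace ℝ (Fin n), z ∈ orthant n →
            √t / rho ν z ≤ ∑ j, √t / rho₁ (ν j) (z j) := by
          intro z hz
          simp only [div_eq_mul_one_div (√t)]
          rw [← Finset.mul_sum]
          exact mul_le_mul_of_nonneg_left (one_div_rho_le_sum hn hz hν) (sqrt_nonneg t)
        linarith [e x hx, e y hy]
    _ ≤ ∑ _j : Fin n, ∏ i, decay₁ (ν i) t (x i) (y i) := by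
        refine Finset.sum_le_sum fun j _ => ?_
        rw [← Finset.mul_prod_erase _ _ (Finset.mem_univ j)]
        refine le_mul_of_one_le_right (zero_le_one.trans (h1 j)) ?_
        rw [← Finset.prod_const_one (s := Finset.univ.erase j)]
        exact Finset.prod_le_prod (fun _ _ => zero_le_one) fun i _ => h1 i
    _ = _ := by simp

/-! ### The estimates in dimension `n` -/

theorem prod_majorant_le (hn : 1 ≤ n) {ν : Fin n → ℝ} (hν : ∀ i, -1 / 2 ≤ ν i) {γ t : ℝ}
    (hγ : 0 ≤ γ) (ht : 0 < t) (m : Fin n → ℕ) {x y : EuclideanSpace ℝ (Fin n)}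
    (hx : x ∈ orthant n) (hy : y ∈ orthant n) :
    ∏ j, majorant (ν j) γ (m j) t (x j) (y j) ≤
      (n : ℝ) ^ γ * (1 / t ^ (((n : ℝ) + ∑ i, (m i : ℝ)) / 2) *
        exp (-‖x - y‖ ^ 2 / (512 * t)) * decay ν t x y ^ (-γ)) := by
  have hst : 0 < √t := sqrt_pos.2 ht
  have h1 : ∀ j, 1 ≤ decay₁ (ν j) t (x j) (y j) := fun j => one_le_decay₁ (hx j) (hy j)
  have hn' : (0 : ℝ) < n := by exact_mod_cast hn
  have hd := decay_pos (ν := ν) (t := t) hn hx hy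
  have e1 : ∏ j, (1 / √t ^ (m j + 1)) = 1 / t ^ (((n : ℝ) + ∑ i, (m i : ℝ)) / 2) := by
    rw [Finset.prod_div_distrib, Finset.prod_const_one, Finset.prod_pow_eq_pow_sum,
      ← rpow_natCast_div_two ht]
    congr 3
    push_cast
    rw [Finset.sum_add_distrib]
    simp
    ring
  have e2 : ∏ j, exp (-|x j - y j| ^ 2 / (512 * t)) = exp (-‖x - y‖ ^ 2 / (512 * t)) := by
    rw [← exp_sum, ← Finset.sum_div, Finset.sum_neg_distrib, EuclideanSpace.norm_sq_eq]
    simp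
  have e3 : ∏ j, decay₁ (ν j) t (x j) (y j) ^ (-γ) ≤ (n : ℝ) ^ γ * decay ν t x y ^ (-γ) := by
    have hp : 0 < ∏ j, decay₁ (ν j) t (x j) (y j) :=
      Finset.prod_pos fun j _ => one_pos.trans_le (h1 j)
    rw [Real.finsetProd_rpow _ _ fun j _ => zero_le_one.trans (h1 j)]
    rw [rpow_neg hp.le, rpow_neg hd.le, ← div_eq_mul_inv, inv_eq_one_div,
      div_le_div_iff₀ (by positivity) (by positivity), one_mul, ← mul_rpow hn'.le hp.le]
    exact rpow_le_rpow hd.le (decay_le_prod hn hν t hx hy) hγ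
  calc ∏ j, majorant (ν j) γ (m j) t (x j) (y j)
      ≤ ∏ j, (1 / √t ^ (m j + 1) * exp (-|x j - y j| ^ 2 / (512 * t)) *
        decay₁ (ν j) t (x j) (y j) ^ (-γ)) := by
        refine Finset.prod_le_prod (fun j _ => majorant_nonneg _ (hx j) (hy j)) fun j _ => ?_
        refine (majorant_le _ ht (hx j) (hy j)).trans ?_
        have := decay₁_rpow_nonneg (ν := ν j) (t := t) (γ := -γ) (hx j) (hy j)
        have : exp (-t / 2) ≤ 1 := exp_le_one_iff.2 (by linarith)
        gcongr
    _ = 1 / t ^ (((n : ℝ) + ∑ i, (m i : ℝ)) / 2) * exp (-‖x - y‖ ^ 2 / (512 * t)) *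
        ∏ j, decay₁ (ν j) t (x j) (y j) ^ (-γ) := by
        rw [Finset.prod_mul_distrib, Finset.prod_mul_distrib, e1, e2]
    _ ≤ 1 / t ^ (((n : ℝ) + ∑ i, (m i : ℝ)) / 2) * exp (-‖x - y‖ ^ 2 / (512 * t)) *
        ((n : ℝ) ^ γ * decay ν t x y ^ (-γ)) := by gcongr
    _ = _ := by ring

theorem forDecayExponent_of_forall {ν : Fin n → ℝ} (hν : ∀ i, -1 / 2 ≤ ν i) {P : ℝ → Prop}
    (h : ∀ γ, 0 ≤ γ → (∀ j, IsDecayExponent (ν j) γ) → P γ) : ForDecayExponent ν P := by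
  have hJ : ∀ j, j ∈ J ν ↔ -1 / 2 < ν j := fun j => by simp [J]
  refine ⟨fun hne => ?_, fun hem N hN => h N hN.le fun j => ⟨hN.le, Or.inl ?_⟩⟩
  · have h0 : 0 ≤ (J ν).inf' hne ν + 1 / 2 := by
      have : -1 / 2 ≤ (J ν).inf' hne ν := Finset.le_inf' _ _ fun j _ => hν j
      linarith
    refine h _ h0 fun j => ⟨h0, ?_⟩
    rcases (hν j).eq_or_lt' with hj | hj
    · exact Or.inl hj
    · refine Or.inr ⟨hj, ?_⟩
      have := Finset.inf'_le ν ((hJ j).2 hj)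
      linarith
  · have : ¬ -1 / 2 < ν j := by rw [← hJ, hem]; simp
    exact le_antisymm (not_lt.1 this) (hν j)

theorem exists_abs_multiPow_delta_le (hn : 1 ≤ n) {ν : Fin n → ℝ} (hν : ∀ i, -1 / 2 ≤ ν i)
    {γ : ℝ} (hγ : 0 ≤ γ) (hγν : ∀ j, IsDecayExponent (ν j) γ) (l : Fin n → ℕ) :
    ∃ C > 0, ∃ c > 0, ∀ t : ℝ, 0 < t → ∀ x ∈ orthant n, ∀ y ∈ orthant n,
      |multiPow (delta ν) l (fun z => heatKernel ν t z y) x| ≤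
        C * (1 / t ^ (((n : ℝ) + ∑ i, (l i : ℝ)) / 2)) * exp (-‖x - y‖ ^ 2 / (c * t)) *
          decay ν t x y ^ (-γ) := by
  choose C hC h using fun j => exists_abs_iterate_delta₁_heatKernel₁_le (hν j) (hγν j) (l j)
  have hn' : (0 : ℝ) < n := by exact_mod_cast hn
  refine ⟨(∏ j, C j) * (n : ℝ) ^ γ, mul_pos (Finset.prod_pos fun j _ => hC j) (by positivity),
    512, by norm_num, fun t ht x hx y hy => ?_⟩
  rw [multiPow_delta_eqOn (fun j => contDiffOn_heatKernel₁ (hν j) ht (hy j))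
    (heatKernel_eqOn hν ht hy) l hx, prodFun, Finset.abs_prod]
  calc _ ≤ ∏ j, (C j * majorant (ν j) γ (l j) t (x j) (y j)) :=
        Finset.prod_le_prod (fun j _ => abs_nonneg _) fun j _ => h j t _ _ ht (hx j) (hy j)
    _ = (∏ j, C j) * ∏ j, majorant (ν j) γ (l j) t (x j) (y j) := Finset.prod_mul_distrib
    _ ≤ (∏ j, C j) * _ := mul_le_mul_of_nonneg_left (prod_majorant_le hn hν hγ ht l hx hy)
        (Finset.prod_nonneg fun j _ => (hC j).le)
    _ = _ := by ring

theorem exists_abs_multiPow_partialD_delta_le (hn : 1 ≤ n) {ν : Fin n → ℝ}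
    (hν : ∀ i, -1 / 2 ≤ ν i) {γ : ℝ} (hγ : 0 ≤ γ) (hγν : ∀ j, IsDecayExponent (ν j) γ)
    (k l : Fin n → ℕ) :
    ∃ C > 0, ∃ c > 0, ∀ t : ℝ, 0 < t → ∀ x ∈ orthant n, ∀ y ∈ orthant n,
      |multiPow partialD k (multiPow (delta ν) l (fun z => heatKernel ν t z y)) x| ≤
        C * (1 / rho ν x ^ (∑ i, k i) + 1 / t ^ ((∑ i, (k i : ℝ)) / 2)) *
          (1 / t ^ (((n : ℝ) + ∑ i, (l i : ℝ)) / 2)) * exp (-‖x - y‖ ^ 2 / (c * t)) *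
          decay ν t x y ^ (-γ) := by
  choose C hC h using fun j =>
    exists_abs_iterate_deriv_delta₁_le_rho₁ (hν j) (hγν j) (k j) (l j)
  have hn' : (0 : ℝ) < n := by exact_mod_cast hn
  refine ⟨(∏ j, C j) * 2 ^ n * (n : ℝ) ^ γ,
    mul_pos (mul_pos (Finset.prod_pos fun j _ => hC j) (by positivity)) (by positivity),
    512, by norm_num, fun t ht x hx y hy => ?_⟩
  have hsm := fun j => contDiffOn_heatKernel₁ (hν j) ht (hy j)
  rw [multiPow_partialD_eqOn (fun j => contDiffOn_iterate_delta₁ (hsm j) (l j))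
    (multiPow_delta_eqOn hsm (heatKernel_eqOn hν ht hy) l) k hx, prodFun, Finset.abs_prod]
  have hst : 0 < √t := sqrt_pos.2 ht
  have hρ := rho_pos hn ν hx
  set A := 1 / rho ν x with hA
  set T := 1 / √t with hT
  have hA0 : 0 < A := by positivity
  have hT0 : 0 < T := by positivity
  have hq : ∀ j, 1 / rho₁ (ν j) (x j) ^ k j + 1 / √t ^ k j ≤ 2 * max A T ^ k j := by
    intro j
    have hρj := rho₁_pos (ν j) (hx j)
    have h1 : 1 / rho₁ (ν j) (x j) ≤ max A T :=
      (one_div_le_one_div_of_le hρ (rho_le_rho₁ ν hx hν j)).trans (le_max_left _ _)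
    rw [← one_div_pow, ← one_div_pow, two_mul, ← hT]
    gcongr
    exact le_max_right _ _
  have hmax : max A T ^ (∑ i, k i) ≤ A ^ (∑ i, k i) + T ^ (∑ i, k i) := by
    have := pow_pos hA0 (∑ i, k i)
    have := pow_pos hT0 (∑ i, k i)
    rcases max_choice A T with h | h <;> rw [h] <;> linarith
  have hm : ∀ j, 0 ≤ majorant (ν j) γ (l j) t (x j) (y j) :=
    fun j => majorant_nonneg _ (hx j) (hy j)
  have hAe : 1 / rho ν x ^ (∑ i, k i) + 1 / t ^ ((∑ i, (k i : ℝ)) / 2) =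
      A ^ (∑ i, k i) + T ^ (∑ i, k i) := by
    rw [hA, hT, one_div_pow, one_div_pow, ← rpow_natCast_div_two ht, Nat.cast_sum]
  rw [hAe]
  have hC0 : 0 ≤ ∏ j, C j := Finset.prod_nonneg fun j _ => (hC j).le
  calc _ ≤ ∏ j, (C j * ((2 * max A T ^ k j) * majorant (ν j) γ (l j) t (x j) (y j))) :=
        Finset.prod_le_prod (fun j _ => abs_nonneg _) fun j _ =>
          (h j t _ _ ht (hx j) (hy j)).trans (mul_le_mul_of_nonneg_left
            (mul_le_mul_of_nonneg_right (hq j) (hm j)) (hC j).le)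
    _ = (∏ j, C j) * 2 ^ n * max A T ^ (∑ i, k i) *
        ∏ j, majorant (ν j) γ (l j) t (x j) (y j) := by
        simp only [Finset.prod_mul_distrib, Finset.prod_pow_eq_pow_sum, Finset.prod_const,
          Finset.card_univ, Fintype.card_fin]
        ring
    _ ≤ (∏ j, C j) * 2 ^ n * (A ^ (∑ i, k i) + T ^ (∑ i, k i)) * _ :=
        mul_le_mul (mul_le_mul_of_nonneg_left hmax (by positivity))
          (prod_majorant_le hn hν hγ ht l hx hy) (Finset.prod_nonneg fun j _ => hm j)
          (by positivity)
    _ = _ := by ring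

end Laguerre

end

theorem proposition3p12 :
    -- the one-dimensional kernel is well defined and smooth in the first variable
    (∀ ν : ℝ, -1 / 2 ≤ ν → ∀ t : ℝ, 0 < t → ∀ y : ℝ, 0 < y →
      (∀ x : ℝ, 0 < x → Summable (Laguerre.heatTerm₁ ν t x y)) ∧
      ContDiffOn ℝ ∞ (fun x => Laguerre.heatKernel₁ ν t x y) (Ioi 0)) ∧
    -- dimension one, bound for the kernel
    (∀ ν : ℝ, -1 / 2 < ν → ∃ C > 0, ∃ c > 0, ∀ t x y : ℝ, 0 < t → 0 < x → 0 < y →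
      |Laguerre.heatKernel₁ ν t x y| ≤
        C * (exp (-t / 2) / √t) * exp (-|x - y| ^ 2 / (c * t)) *
          Laguerre.decay₁ ν t x y ^ (-(ν + 1 / 2))) ∧
    -- dimension one, small time, off-diagonal region
    (∀ (ν : ℝ) (k m : ℕ), -1 / 2 < ν → ∃ C > 0, ∃ c > 0, ∀ t x y : ℝ,
      0 < t → t < 1 → 0 < x → 0 < y →
      (x * y < t ∨ (t ≤ x * y ∧ y < x / 2) ∨ (t ≤ x * y ∧ 2 * x < y)) →
      |(x / √t) ^ k * (Laguerre.delta₁ ν)^[m] (fun z => Laguerre.heatKernel₁ ν t z y) x| ≤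
        C * (1 / t ^ (((m : ℝ) + 1) / 2)) * exp (-|x - y| ^ 2 / (c * t)) *
          Laguerre.decay₁ ν t x y ^ (-(ν + 1 / 2))) ∧
    -- dimension one, large time
    (∀ (ν : ℝ) (k m : ℕ), -1 / 2 < ν → ∃ C > 0, ∃ c > 0, ∀ t x y : ℝ,
      1 ≤ t → 0 < x → 0 < y →
      |x ^ k * (Laguerre.delta₁ ν)^[m] (fun z => Laguerre.heatKernel₁ ν t z y) x| ≤
        C * (exp (-t / 2 ^ (m + 2)) / t ^ (((m : ℝ) + 1) / 2)) * exp (-|x - y| ^ 2 / (c * t)) *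
          Laguerre.decay₁ ν t x y ^ (-(ν + 1 / 2))) ∧
    -- dimension one, small time, near-diagonal region
    (∀ (ν : ℝ) (m : ℕ), -1 / 2 < ν → 1 ≤ m → ∃ C > 0, ∃ c > 0, ∀ t x y : ℝ,
      0 < t → t < 1 → 0 < x → 0 < y → t ≤ x * y → x / 2 ≤ y → y ≤ 2 * x →
      |(Laguerre.delta₁ ν)^[m] (fun z => Laguerre.heatKernel₁ ν t z y) x| +
        x / t * |(Laguerre.delta₁ ν)^[m - 1]
          (fun z => Laguerre.heatKernel₁ ν t z y - Laguerre.heatKernel₁ (ν + 1) t z y) x| ≤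
        C * (1 / t ^ (((m : ℝ) + 1) / 2)) * exp (-|x - y| ^ 2 / (c * t)) *
          Laguerre.decay₁ ν t x y ^ (-(ν + 1 / 2))) ∧
    -- dimension one, all times and all points
    (∀ (ν : ℝ) (k : ℕ), -1 / 2 < ν → ∃ C > 0, ∃ c > 0, ∀ t x y : ℝ,
      0 < t → 0 < x → 0 < y →
      |(Laguerre.delta₁ ν)^[k] (fun z => Laguerre.heatKernel₁ ν t z y) x| ≤
        C * (1 / t ^ (((k : ℝ) + 1) / 2)) * exp (-|x - y| ^ 2 / (c * t)) *
          Laguerre.decay₁ ν t x y ^ (-(ν + 1 / 2))) ∧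
    -- dimension one, mixed derivatives, `ν > -1/2`
    (∀ (ν : ℝ) (k j : ℕ), -1 / 2 < ν → ∃ C > 0, ∃ c > 0, ∀ t x y : ℝ,
      0 < t → 0 < x → 0 < y →
      |deriv^[k] ((Laguerre.delta₁ ν)^[j] (fun z => Laguerre.heatKernel₁ ν t z y)) x| ≤
        C * (1 / Laguerre.rho₁ ν x ^ k + 1 / t ^ ((k : ℝ) / 2)) *
          (1 / t ^ (((j : ℝ) + 1) / 2)) * exp (-|x - y| ^ 2 / (c * t)) *
          Laguerre.decay₁ ν t x y ^ (-(ν + 1 / 2))) ∧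
    -- dimension one, mixed derivatives, `ν = -1/2`
    (∀ (k j : ℕ) (N : ℝ), 0 < N → ∃ C > 0, ∃ c > 0, ∀ t x y : ℝ,
      0 < t → 0 < x → 0 < y →
      |deriv^[k] ((Laguerre.delta₁ (-1 / 2))^[j]
          (fun z => Laguerre.heatKernel₁ (-1 / 2) t z y)) x| ≤
        C * (1 / t ^ (((j : ℝ) + k + 1) / 2)) * exp (-|x - y| ^ 2 / (c * t)) *
          Laguerre.decay₁ (-1 / 2) t x y ^ (-N)) ∧
    -- dimension `n`
    (∀ (n : ℕ) (ν : Fin n → ℝ), 1 ≤ n → (∀ i, -1 / 2 ≤ ν i) →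
      -- the kernel is well defined and smooth in the first variable
      (∀ t : ℝ, 0 < t → ∀ y ∈ Laguerre.orthant n,
        (∀ x ∈ Laguerre.orthant n, Summable (Laguerre.heatTerm ν t x y)) ∧
        ContDiffOn ℝ ∞ (fun x => Laguerre.heatKernel ν t x y) (Laguerre.orthant n)) ∧
      -- the derivatives `δ_ν^ℓ`
      (∀ l : Fin n → ℕ, Laguerre.ForDecayExponent ν fun γ => ∃ C > 0, ∃ c > 0,
        ∀ t : ℝ, 0 < t → ∀ x ∈ Laguerre.orthant n, ∀ y ∈ Laguerre.orthant n,
        |Laguerre.multiPow (Laguerre.delta ν) l (fun z => Laguerre.heatKernel ν t z y) x| ≤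
          C * (1 / t ^ (((n : ℝ) + ∑ i, (l i : ℝ)) / 2)) * exp (-‖x - y‖ ^ 2 / (c * t)) *
            Laguerre.decay ν t x y ^ (-γ)) ∧
      -- the mixed derivatives `∂^k δ_ν^j`
      (∀ k j : Fin n → ℕ, Laguerre.ForDecayExponent ν fun γ => ∃ C > 0, ∃ c > 0,
        ∀ t : ℝ, 0 < t → ∀ x ∈ Laguerre.orthant n, ∀ y ∈ Laguerre.orthant n,
        |Laguerre.multiPow Laguerre.partialD k
            (Laguerre.multiPow (Laguerre.delta ν) j (fun z => Laguerre.heatKernel ν t z y)) x| ≤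
          C * (1 / Laguerre.rho ν x ^ (∑ i, k i) + 1 / t ^ ((∑ i, (k i : ℝ)) / 2)) *
            (1 / t ^ (((n : ℝ) + ∑ i, (j i : ℝ)) / 2)) * exp (-‖x - y‖ ^ 2 / (c * t)) *
            Laguerre.decay ν t x y ^ (-γ))) := by
  refine ⟨fun ν hν t ht y hy => ⟨fun x hx => (Laguerre.hasSum_heatTerm₁ hν ht hx hy).summable,
      Laguerre.contDiffOn_heatKernel₁ hν ht hy⟩,
    fun ν hν => Laguerre.exists_abs_heatKernel₁_le hν,
    fun ν k m hν => Laguerre.exists_abs_pow_mul_iterate_delta₁_le_of_off_diagonal hν k m,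
    fun ν k m hν => Laguerre.exists_abs_pow_mul_iterate_delta₁_le_of_one_le hν k m,
    fun ν m hν hm => Laguerre.exists_abs_near_diagonal_le hν hm,
    fun ν k hν => ?_,
    fun ν k j hν => Laguerre.exists_abs_iterate_deriv_delta₁_le_of_lt hν k j,
    fun k j N hN => Laguerre.exists_abs_iterate_deriv_delta₁_neg_half_le k j hN,
    fun n ν hn hν => ⟨fun t ht y hy => ⟨fun x hx => ?_, ?_⟩, fun l => ?_, fun k j => ?_⟩⟩
  · obtain ⟨C, hC, h⟩ := Laguerre.exists_abs_iterate_delta₁_le hν k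
    exact ⟨C, hC, 512, by norm_num, h⟩
  · exact (Laguerre.hasSum_heatTerm hν ht hx hy).summable
  · exact (Laguerre.contDiffOn_prodFun fun j =>
      Laguerre.contDiffOn_heatKernel₁ (hν j) ht (hy j)).congr (Laguerre.heatKernel_eqOn hν ht hy)
  · exact Laguerre.forDecayExponent_of_forall hν fun γ hγ hγν =>
      Laguerre.exists_abs_multiPow_delta_le hn hν hγ hγν l
  · exact Laguerre.forDecayExponent_of_forall hν fun γ hγ hγν =>
      Laguerre.exists_abs_multiPow_partialD_delta_le hn hν hγ hγν k j
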